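/- Let $m>0$, let $\kappa\ge 1$ be an integer, and let $v$ be a real-valued function in $L^2(\mathbb R_+)$, $\mathbb R_+=(0,\infty)$, whose (essential) support satisfies $0<\gamma:=\sup\operatorname{supp}v<\infty$ (Condition A). In $L^2(\mathbb R_+)\oplus L^2(\mathbb R_+)$ consider the radial Dirac operator $$Hf=\begin{pmatrix} m+v & -\partial_x+\frac{\kappa}{x}\\ \partial_x+\frac{\kappa}{x} & -m+v\end{pmatrix}f,\qquad f=\begin{pmatrix}f_1\\ f_2\end{pmatrix},\qquad f_1(0)=0,$$ with domain all $f\in L^2$ that are locally absolutely continuous on $(0,\infty)$ with $Hf\in L^2$ and $f_1(0+)=0$. For continuous $h:\mathbb R_+\to\mathbb C^2$ with compact support in $(0,\infty)$ put $\Phi_h(\lambda)=((H-\lambda)^{-1}h,h)$, $\operatorname{Im}\lambda>0$. Let $\sigma=(-\infty,-m]\cup[m,\infty)$. On the physical sheet, $\Phi_h$ is continued meromorphically from $\mathbb C_+$ to $\mathbb C\setminus\sigma$ (through the gap $(-m,m)$). Continue also $\Phi_h$ meromorphically from $\mathbb C_+$ through $\sigma$ to $\mathbb C\setminus[-m,m]$;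 the meromorphic continuation to $\mathbb C\setminus\sigma$ of the restriction of this function to $\mathbb C_-$ is the branch of $\Phi_h$ on the non-physical sheet. A point $\mu\in(-m,m)$ is called an *eigenvalue* of $H$ if, for some $h$, the branch of $\Phi_h$ on the physical sheet has a pole at $\mu$; it is called an *anti-bound state* if, for some $h$, the branch of $\Phi_h$ on the non-physical sheet has a pole at $\mu$, and its multiplicity is then the largest order of this pole over all $h$. Then these continuations exist for every $h$, and: 1. The number of eigenvalues of $H$ is finite. 2. If $\mu\in(-m,m)$ is an eigenvalue of $H$, then $\mu$, considered on the non-physical sheet, is not an anti-bound state. 3. Let $\mu_1<\mu_2$ be eigenvalues of $H$ such that there is no other eigenvalue in $(\mu_1,\mu_2)$. Then the interval $(\mu_1,\mu_2)$ on the non-physical sheet contains finitely many anti-bound states, and their number, counted with multiplicities, is odd (in particular at least $1$). -/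

import Mathlib

open MeasureTheory Set Filter Topology

namespace RadialDirac

/-- The fibre `ℂ²` with its Hilbert space norm. -/
abbrev Spinor : Type := EuclideanSpace ℂ (Fin 2)

/-- Lebesgue measure on the half-line `ℝ₊ = (0, ∞)`. -/
noncomputable abbrev halfLine : Measure ℝ := volume.restrict (Ioi 0)

/-- Condition A: `v ∈ L²(ℝ₊)` is real valued and `γ = sup supp v` is finite and positive, where
`supp v` is the (essential) support; thus `γ` is the least `c ≥ 0` such that `v` vanishes almost
everywhere on `(c, ∞)`. -/
structure ConditionA (v : ℝ → ℝ) (γ : ℝ) : Prop where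
  memLp : MemLp v 2 halfLine
  pos : 0 < γ
  sup_supp : IsLeast {c : ℝ | 0 ≤ c ∧ ∀ᵐ x : ℝ, c < x → v x = 0} γ

/-- The differential expression
`H f = (-i σ₂ ∂ₓ + σ₃ m + σ₁ κ / x + v) f`, that is
`(H f)₁ = (m + v) f₁ - f₂' + (κ / x) f₂` and `(H f)₂ = f₁' + (κ / x) f₁ + (v - m) f₂`. -/
noncomputable def diracExpr (m : ℝ) (κ : ℕ) (v : ℝ → ℝ) (f : ℝ → Spinor) (x : ℝ) : Spinor :=
  !₂[((m + v x : ℝ) : ℂ) * f x 0 - deriv f x 1 + ((κ / x : ℝ) : ℂ) * f x 1,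
    deriv f x 0 + ((κ / x : ℝ) : ℂ) * f x 0 + ((v x - m : ℝ) : ℂ) * f x 1]

/-- The domain of the radial Dirac operator `H` in `L²(ℝ₊) ⊕ L²(ℝ₊)`: the square integrable `f`,
locally absolutely continuous on `(0, ∞)`, with `H f` square integrable and `f₁(0) = 0`. -/
structure InDomain (m : ℝ) (κ : ℕ) (v : ℝ → ℝ) (f : ℝ → Spinor) : Prop where
  memLp : MemLp f 2 halfLine
  absCont : ∀ a b : ℝ, 0 < a → 0 < b → AbsolutelyContinuousOnInterval f a b
  memLp_expr : MemLp (diracExpr m κ v f) 2 halfLine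
  dirichlet : Tendsto (fun x => f x 0) (𝓝[>] 0) (𝓝 0)

/-- `u = (H - z)⁻¹ h`: the function `u` lies in the domain of `H` and `(H - z) u = h`. -/
def IsResolventAt (m : ℝ) (κ : ℕ) (v : ℝ → ℝ) (z : ℂ) (h u : ℝ → Spinor) : Prop :=
  InDomain m κ v u ∧ ∀ᵐ x ∂halfLine, diracExpr m κ v u x - z • u x = h x

/-- `h ∈ C₀(ℝ₊, ℂ²)`: continuous with compact support in `(0, ∞)`. -/
structure IsTestFunction (h : ℝ → Spinor) : Prop where
  continuous : Continuous h
  compact : HasCompactSupport h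
  support : tsupport h ⊆ Ioi 0

/-- The scalar product `(u, h)` of `L²(ℝ₊, ℂ²)`, linear in `u`. -/
noncomputable def pairing (u h : ℝ → Spinor) : ℂ := ∫ x in Ioi (0 : ℝ), inner ℂ (h x) (u x)

/-- A sheet of the Riemann surface of `√(z² - m²)`: the plane cut along
`σ_ac(H₀) = (-∞, -m] ∪ [m, ∞)`. -/
def sheet (m : ℝ) : Set ℂ := {z : ℂ | ¬ (z.im = 0 ∧ m ≤ |z.re|)}

/-- The plane cut along the gap, `Λ = ℂ \ [-m, m]`. Its upper half lies on the physical sheet and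
its lower half on the non-physical one; the two are glued along `σ_ac(H₀)`. -/
def cutPlane (m : ℝ) : Set ℂ := {z : ℂ | ¬ (z.im = 0 ∧ |z.re| ≤ m)}

/-- Meromorphic continuation of `Φ(z) = ((H - z)⁻¹ h, h)`, `Im z > 0`, to the two-sheeted Riemann
surface. `P` is the branch on the physical sheet, `N` the branch on the non-physical sheet, and `G`
the continuation from the upper half-plane through `σ_ac(H₀)` to `ℂ \ [-m, m]`. -/
structure IsContinuation (m : ℝ) (κ : ℕ) (v : ℝ → ℝ) (h : ℝ → Spinor) (P G N : ℂ → ℂ) :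
    Prop where
  physical : MeromorphicOn P (sheet m)
  cut : MeromorphicOn G (cutPlane m)
  nonphysical : MeromorphicOn N (sheet m)
  resolvent : ∀ z : ℂ, 0 < z.im → ∃ u, IsResolventAt m κ v z h u ∧ P z = pairing u h
  upper : ∀ z : ℂ, 0 < z.im → G z = P z
  lower : ∀ z : ℂ, z.im < 0 → G z = N z

/-- A point `μ` of the gap `(-m, m)`, taken on the physical sheet, is an eigenvalue of `H` if for
some `h` the function `Φ` has a pole there. -/
def IsEigenvalue (m : ℝ) (κ : ℕ) (v : ℝ → ℝ) (μ : ℝ) : Prop :=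
  μ ∈ Ioo (-m) m ∧ ∃ h P G N, IsTestFunction h ∧ IsContinuation m κ v h P G N ∧
    meromorphicOrderAt P (μ : ℂ) < 0

/-- A point `μ` of the gap `(-m, m)`, taken on the non-physical sheet, is an anti-bound state of
`H` if for some `h` the continuation of `Φ` has a pole there. -/
def IsAntibound (m : ℝ) (κ : ℕ) (v : ℝ → ℝ) (μ : ℝ) : Prop :=
  μ ∈ Ioo (-m) m ∧ ∃ h P G N, IsTestFunction h ∧ IsContinuation m κ v h P G N ∧
    meromorphicOrderAt N (μ : ℂ) < 0

/-- The multiplicity of `μ` as an anti-bound state: the multiplicity of the pole, i.e. the largest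
pole order at `μ` on the non-physical sheet over all `h`. -/
noncomputable def antiboundMultiplicity (m : ℝ) (κ : ℕ) (v : ℝ → ℝ) (μ : ℝ) : ℕ∞ :=
  sSup {d : ℕ∞ | ∃ n : ℕ, d = n ∧ ∃ h P G N, IsTestFunction h ∧
    IsContinuation m κ v h P G N ∧ meromorphicOrderAt N (μ : ℂ) = ((-(n : ℤ) : ℤ) : WithTop ℤ)}

end RadialDirac

/-! Everything is read off from the Jost function. The system `(H - z) f = 0` has a solution `phi`
regular at the origin, entire in `z`, and, for each `τ` with `τ² = m² - z²`, a Jost solution `psi`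
that equals the explicit free solution of type `e^{-τx}` beyond the support of `v`. Let `F(z, τ)`
(`jost`) be their Wronskian. By variation of constants `Φ_h = N_h(z, τ) / F(z, τ)`, with `N_h`
(`resolventNum`) holomorphic wherever `τ` is a holomorphic function of `z`. The physical sheet is `τ
= gapRoot`, with `Re τ > 0`, and the non-physical sheet is `τ = -gapRoot`; the root `cutRoot`,
holomorphic off `[-m, m]`, agrees with the first above the real axis and with the second below it.
So the same quotient supplies all three branches, and the identity theorem makes them unique
(`IsContinuation.eventuallyEq`).

The central identity is `connection`: a nonzero multiple of `phi` equals `F(-τ) ψ(τ) - F(τ) ψ(-τ)`.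
Hence `F(τ)` and `F(-τ)` never vanish together when `τ ≠ 0`, which is statement 2. Moreover, at a
zero of `F(τ)` the Jost solution is a nonzero multiple of `phi`, and for `h` a cutoff of `phi` the
numerator is a nonzero multiple of `(∫ χ |φ|²)²`. So poles in the gap are exactly the zeros of `F`,
with the same order (`isEigenvalue_iff`, `isAntibound_iff`, `antiboundMultiplicity_eq`).

Statement 1: zeros in the gap might accumulate at `±m`, where the square root branches. With `z = m
cos θ`, `τ = m sin θ` the Jost function becomes entire in `θ` and the closed gap becomes the compact
interval `[0, π]`; since it does not vanish identically, it has finitely many zeros there.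

Statement 3: `Im Φ_h = Im z ‖u‖² ≥ 0` in the upper half-plane, so poles on the real axis are simple
with negative residue. At an eigenvalue the residue is computed from `F_P'(μ)`, `F_N(μ)` and the
Wronskian of the two Jost solutions, and its sign says that `(-1)^κ F_P'(μ) F_N(μ) > 0`
(`exists_hasDerivAt_jostP`). At consecutive simple zeros `F_P'` changes sign, hence so does `F_N`.
As `F_N` is real on the gap and nonzero at both ends, it has an odd number of zeros in between,
counted with multiplicity. -/

namespace AbsolutelyContinuousOnInterval

/-! ### Absolutely continuous complex-valued functions -/

theorem comp_lipschitzWith {X Y : Type*} [PseudoMetricSpace X] [PseudoMetricSpace Y]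
    {f : ℝ → X} {a b : ℝ} (hf : AbsolutelyContinuousOnInterval f a b) {g : X → Y} {K : NNReal}
    (hg : LipschitzWith K g) : AbsolutelyContinuousOnInterval (fun x => g (f x)) a b := by
  refine squeeze_zero (fun t => Finset.sum_nonneg fun i _ => dist_nonneg) (fun t => ?_)
    (by simpa using Tendsto.const_mul (K : ℝ) hf)
  rw [Finset.mul_sum]
  exact Finset.sum_le_sum fun i _ => hg.dist_le_mul _ _

theorem congr {X : Type*} [PseudoMetricSpace X] {f g : ℝ → X} {a b : ℝ}
    (hf : AbsolutelyContinuousOnInterval f a b) (h : ∀ x ∈ uIcc a b, f x = g x) :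
    AbsolutelyContinuousOnInterval g a b := by
  rw [absolutelyContinuousOnInterval_iff] at hf ⊢
  intro ε hε
  obtain ⟨δ, hδ, H⟩ := hf ε hε
  refine ⟨δ, hδ, fun E hE hs => ?_⟩
  have := H E hE hs
  rwa [Finset.sum_congr rfl fun i hi => by rw [h _ (hE.1 i hi).1, h _ (hE.1 i hi).2]] at this

theorem re {f : ℝ → ℂ} {a b : ℝ} (hf : AbsolutelyContinuousOnInterval f a b) :
    AbsolutelyContinuousOnInterval (fun x => (f x).re) a b :=
  hf.comp_lipschitzWith Complex.reCLM.lipschitz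

theorem im {f : ℝ → ℂ} {a b : ℝ} (hf : AbsolutelyContinuousOnInterval f a b) :
    AbsolutelyContinuousOnInterval (fun x => (f x).im) a b :=
  hf.comp_lipschitzWith Complex.imCLM.lipschitz

theorem complex_of_re_im {f : ℝ → ℂ} {a b : ℝ}
    (hre : AbsolutelyContinuousOnInterval (fun x => (f x).re) a b)
    (him : AbsolutelyContinuousOnInterval (fun x => (f x).im) a b) :
    AbsolutelyContinuousOnInterval f a b := by
  have h1 := hre.comp_lipschitzWith Complex.ofRealCLM.lipschitz
  have h2 := (him.comp_lipschitzWith Complex.ofRealCLM.lipschitz).const_smul Complex.I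
  have := h1.add h2
  refine AbsolutelyContinuousOnInterval.congr this fun x _ => ?_
  simp [mul_comm Complex.I, Complex.re_add_im]

theorem complex_mul {f g : ℝ → ℂ} {a b : ℝ} (hf : AbsolutelyContinuousOnInterval f a b)
    (hg : AbsolutelyContinuousOnInterval g a b) :
    AbsolutelyContinuousOnInterval (fun x => f x * g x) a b :=
  hf.smul hg

theorem conj {f : ℝ → ℂ} {a b : ℝ} (hf : AbsolutelyContinuousOnInterval f a b) :
    AbsolutelyContinuousOnInterval (fun x => (starRingEnd ℂ) (f x)) a b :=
  hf.comp_lipschitzWith Complex.conjLIE.lipschitz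

theorem complex_intervalIntegrable_of_hasDerivAt {f f' : ℝ → ℂ} {a b : ℝ}
    (hf : AbsolutelyContinuousOnInterval f a b)
    (hd : ∀ᵐ x, x ∈ uIcc a b → HasDerivAt f (f' x) x) : IntervalIntegrable f' volume a b := by
  have h1 := hf.re.intervalIntegrable_deriv
  have h2 := hf.im.intervalIntegrable_deriv
  rw [intervalIntegrable_iff] at h1 h2 ⊢
  have := (h1.ofReal (𝕜 := ℂ)).add ((h2.ofReal (𝕜 := ℂ)).const_mul Complex.I)
  refine this.congr ?_
  filter_upwards [ae_restrict_of_ae hd, ae_restrict_mem measurableSet_uIoc] with x hx hm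
  have hx := hx (uIoc_subset_uIcc hm)
  have e1 : HasDerivAt (fun x => (f x).re) (f' x).re x :=
    Complex.reCLM.hasFDerivAt.comp_hasDerivAt x hx
  have e2 : HasDerivAt (fun x => (f x).im) (f' x).im x :=
    Complex.imCLM.hasFDerivAt.comp_hasDerivAt x hx
  simp [e1.deriv, e2.deriv, mul_comm Complex.I, Complex.re_add_im]

/-- Follows from the real fundamental theorem of calculus for real and imaginary parts. The
derivative is any `f'` valid almost everywhere, so that it can be taken directly from the
differential system. -/
theorem complex_integral_eq_sub {f f' : ℝ → ℂ} {a b : ℝ}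
    (hf : AbsolutelyContinuousOnInterval f a b)
    (hd : ∀ᵐ x, x ∈ uIcc a b → HasDerivAt f (f' x) x) : ∫ x in a..b, f' x = f b - f a := by
  have hi := hf.complex_intervalIntegrable_of_hasDerivAt hd
  have h1 := hf.re.integral_deriv_eq_sub
  have h2 := hf.im.integral_deriv_eq_sub
  have e1 : ∫ x in a..b, deriv (fun x => (f x).re) x = ∫ x in a..b, (f' x).re := by
    refine intervalIntegral.integral_congr_ae ?_
    filter_upwards [hd] with x hx hm
    exact (Complex.reCLM.hasFDerivAt.comp_hasDerivAt x (hx (uIoc_subset_uIcc hm))).deriv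
  have e2 : ∫ x in a..b, deriv (fun x => (f x).im) x = ∫ x in a..b, (f' x).im := by
    refine intervalIntegral.integral_congr_ae ?_
    filter_upwards [hd] with x hx hm
    exact (Complex.imCLM.hasFDerivAt.comp_hasDerivAt x (hx (uIoc_subset_uIcc hm))).deriv
  have r1 := Complex.reCLM.intervalIntegral_comp_comm hi
  have r2 := Complex.imCLM.intervalIntegral_comp_comm hi
  simp only [Complex.reCLM_apply, Complex.imCLM_apply] at r1 r2
  apply Complex.ext
  · rw [← r1, ← e1, h1, Complex.sub_re]
  · rw [← r2, ← e2, h2, Complex.sub_im]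

theorem complex_ae_differentiableAt {f : ℝ → ℂ} {a b : ℝ}
    (hf : AbsolutelyContinuousOnInterval f a b) :
    ∀ᵐ x, x ∈ uIcc a b → DifferentiableAt ℝ f x := by
  filter_upwards [hf.re.ae_differentiableAt, hf.im.ae_differentiableAt] with x h1 h2 hx
  have a1 := ((h1 hx).hasDerivAt.ofReal_comp).add
    ((h2 hx).hasDerivAt.ofReal_comp.mul_const Complex.I)
  refine DifferentiableAt.congr_of_eventuallyEq a1.differentiableAt (Eventually.of_forall ?_)
  intro y
  simp [Complex.re_add_im]

end AbsolutelyContinuousOnInterval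

theorem IntervalIntegrable.complex_absolutelyContinuousOnInterval {f : ℝ → ℂ} {a b c : ℝ}
    (h : IntervalIntegrable f volume a b) (hc : c ∈ uIcc a b) :
    AbsolutelyContinuousOnInterval (fun x => ∫ t in c..x, f t) a b := by
  have hsub : ∀ x ∈ uIcc a b, IntervalIntegrable f volume c x := fun x hx =>
    h.mono_set (uIcc_subset_uIcc hc hx)
  have h1 : IntervalIntegrable (fun t => (f t).re) volume a b := ⟨h.1.re, h.2.re⟩
  have h2 : IntervalIntegrable (fun t => (f t).im) volume a b := ⟨h.1.im, h.2.im⟩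
  refine AbsolutelyContinuousOnInterval.complex_of_re_im
    ((h1.absolutelyContinuousOnInterval_intervalIntegral hc).congr fun x hx => ?_)
    ((h2.absolutelyContinuousOnInterval_intervalIntegral hc).congr fun x hx => ?_)
  · exact Complex.reCLM.intervalIntegral_comp_comm (hsub x hx)
  · exact Complex.imCLM.intervalIntegral_comp_comm (hsub x hx)

/-- A property that holds almost everywhere on each compact subinterval of `(0, ∞)` holds almost
everywhere on `(0, ∞)`. -/
theorem ae_pos_of_forall_ae_Icc {p : ℝ → Prop}
    (h : ∀ a b : ℝ, 0 < a → 0 < b → ∀ᵐ x : ℝ, x ∈ uIcc a b → p x) : ∀ᵐ x : ℝ, 0 < x → p x := by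
  have : ∀ᵐ x : ℝ, ∀ n : ℕ, x ∈ uIcc ((1 : ℝ) / (n + 1)) (n + 1) → p x :=
    ae_all_iff.2 fun n => h _ _ (by positivity) (by positivity)
  filter_upwards [this] with x hx h0
  obtain ⟨n, hn⟩ := exists_nat_gt (max x (1 / x))
  refine hx n ?_
  rw [max_lt_iff] at hn
  have h2 : (1 : ℝ) / (n + 1) ≤ x := by
    rw [div_le_iff₀ (by positivity)]
    have := hn.2
    rw [div_lt_iff₀ h0] at this
    nlinarith
  rw [uIcc_of_le (by linarith)]
  exact ⟨h2, by linarith⟩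

/-! ### Solutions of the first-order system and Wronskians -/

namespace RadialDirac

/-- `(f₁, f₂)` is locally absolutely continuous on `(0, ∞)` and solves `(H - z) f = (h₁, h₂)`. -/
structure IsSol (m : ℝ) (κ : ℕ) (v : ℝ → ℝ) (z : ℂ) (h₁ h₂ f₁ f₂ : ℝ → ℂ) : Prop where
  absCont_fst : ∀ a b : ℝ, 0 < a → 0 < b → AbsolutelyContinuousOnInterval f₁ a b
  absCont_snd : ∀ a b : ℝ, 0 < a → 0 < b → AbsolutelyContinuousOnInterval f₂ a b
  deriv_fst : ∀ᵐ x : ℝ, 0 < x →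
    HasDerivAt f₁ (-((κ / x : ℝ) : ℂ) * f₁ x + ((m - v x : ℝ) + z) * f₂ x + h₂ x) x
  deriv_snd : ∀ᵐ x : ℝ, 0 < x →
    HasDerivAt f₂ (((κ / x : ℝ) : ℂ) * f₂ x + ((m + v x : ℝ) - z) * f₁ x - h₁ x) x

theorem pos_of_mem_uIcc {a b x : ℝ} (ha : 0 < a) (hb : 0 < b) (hx : x ∈ uIcc a b) : 0 < x :=
  lt_of_lt_of_le (lt_min ha hb) hx.1

namespace IsSol

variable {m : ℝ} {κ : ℕ} {v : ℝ → ℝ} {z z' : ℂ} {h₁ h₂ f₁ f₂ k₁ k₂ g₁ g₂ : ℝ → ℂ}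

theorem continuousOn_fst (hf : IsSol m κ v z h₁ h₂ f₁ f₂) : ContinuousOn f₁ (Ioi 0) := by
  intro x hx
  have hx : 0 < x := hx
  have := (hf.absCont_fst (x / 2) (x + 1) (by linarith) (by linarith)).continuousOn
  rw [uIcc_of_le (by linarith)] at this
  exact (this.continuousAt (Icc_mem_nhds (by linarith) (by linarith))).continuousWithinAt

theorem continuousOn_snd (hf : IsSol m κ v z h₁ h₂ f₁ f₂) : ContinuousOn f₂ (Ioi 0) := by
  intro x hx
  have hx : 0 < x := hx
  have := (hf.absCont_snd (x / 2) (x + 1) (by linarith) (by linarith)).continuousOn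
  rw [uIcc_of_le (by linarith)] at this
  exact (this.continuousAt (Icc_mem_nhds (by linarith) (by linarith))).continuousWithinAt

/-- Lagrange's identity for the Wronskian `f₁ g₂ - f₂ g₁`. -/
theorem lagrange (hf : IsSol m κ v z h₁ h₂ f₁ f₂) (hg : IsSol m κ v z' k₁ k₂ g₁ g₂) {a b : ℝ}
    (ha : 0 < a) (hb : 0 < b) :
    IntervalIntegrable (fun x => (z - z') * (f₁ x * g₁ x + f₂ x * g₂ x)
      + (h₁ x * g₁ x + h₂ x * g₂ x) - (k₁ x * f₁ x + k₂ x * f₂ x)) volume a b ∧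
    ∫ x in a..b, ((z - z') * (f₁ x * g₁ x + f₂ x * g₂ x)
      + (h₁ x * g₁ x + h₂ x * g₂ x) - (k₁ x * f₁ x + k₂ x * f₂ x)) =
      (f₁ b * g₂ b - f₂ b * g₁ b) - (f₁ a * g₂ a - f₂ a * g₁ a) := by
  have hac : AbsolutelyContinuousOnInterval (fun x => f₁ x * g₂ x - f₂ x * g₁ x) a b :=
    ((hf.absCont_fst a b ha hb).complex_mul (hg.absCont_snd a b ha hb)).sub
      ((hf.absCont_snd a b ha hb).complex_mul (hg.absCont_fst a b ha hb))
  have hd : ∀ᵐ x : ℝ, x ∈ uIcc a b → HasDerivAt (fun x => f₁ x * g₂ x - f₂ x * g₁ x)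
      ((z - z') * (f₁ x * g₁ x + f₂ x * g₂ x)
      + (h₁ x * g₁ x + h₂ x * g₂ x) - (k₁ x * f₁ x + k₂ x * f₂ x)) x := by
    filter_upwards [hf.deriv_fst, hf.deriv_snd, hg.deriv_fst, hg.deriv_snd] with x a1 a2 a3 a4 hx
    have hx := pos_of_mem_uIcc ha hb hx
    refine HasDerivAt.congr_deriv (((a1 hx).mul (a4 hx)).sub ((a2 hx).mul (a3 hx))) ?_
    push_cast
    ring
  exact ⟨hac.complex_intervalIntegrable_of_hasDerivAt hd, hac.complex_integral_eq_sub hd⟩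

theorem wronskian_const (hf : IsSol m κ v z 0 0 f₁ f₂) (hg : IsSol m κ v z 0 0 g₁ g₂) {a b : ℝ}
    (ha : 0 < a) (hb : 0 < b) : f₁ b * g₂ b - f₂ b * g₁ b = f₁ a * g₂ a - f₂ a * g₁ a := by
  have := (hf.lagrange hg ha hb).2
  simp only [Pi.zero_apply, sub_self, zero_mul, add_zero, intervalIntegral.integral_zero] at this
  linear_combination -this

/-- The coefficients `m`, `v`, `κ / x` are real, so conjugation touches only `z` and the source.
Pairing a solution with its own conjugate in `lagrange` then produces the imaginary part of the
resolvent form. -/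
theorem conj (hf : IsSol m κ v z h₁ h₂ f₁ f₂) :
    IsSol m κ v (starRingEnd ℂ z) (fun x => starRingEnd ℂ (h₁ x)) (fun x => starRingEnd ℂ (h₂ x))
      (fun x => starRingEnd ℂ (f₁ x)) (fun x => starRingEnd ℂ (f₂ x)) where
  absCont_fst a b ha hb := (hf.absCont_fst a b ha hb).conj
  absCont_snd a b ha hb := (hf.absCont_snd a b ha hb).conj
  deriv_fst := by
    filter_upwards [hf.deriv_fst] with x hx h0
    refine HasDerivAt.congr_deriv (Complex.conjCLE.hasFDerivAt.comp_hasDerivAt x (hx h0)) ?_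
    simp
  deriv_snd := by
    filter_upwards [hf.deriv_snd] with x hx h0
    refine HasDerivAt.congr_deriv (Complex.conjCLE.hasFDerivAt.comp_hasDerivAt x (hx h0)) ?_
    simp

theorem sub (hf : IsSol m κ v z h₁ h₂ f₁ f₂) (hg : IsSol m κ v z k₁ k₂ g₁ g₂) :
    IsSol m κ v z (fun x => h₁ x - k₁ x) (fun x => h₂ x - k₂ x) (fun x => f₁ x - g₁ x)
      (fun x => f₂ x - g₂ x) where
  absCont_fst a b ha hb := (hf.absCont_fst a b ha hb).sub (hg.absCont_fst a b ha hb)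
  absCont_snd a b ha hb := (hf.absCont_snd a b ha hb).sub (hg.absCont_snd a b ha hb)
  deriv_fst := by
    filter_upwards [hf.deriv_fst, hg.deriv_fst] with x hx hx' h0
    refine HasDerivAt.congr_deriv ((hx h0).sub (hx' h0)) ?_
    ring
  deriv_snd := by
    filter_upwards [hf.deriv_snd, hg.deriv_snd] with x hx hx' h0
    refine HasDerivAt.congr_deriv ((hx h0).sub (hx' h0)) ?_
    ring

end IsSol

end RadialDirac

/-! ### Powers of `x` and limits at infinity -/

theorem absolutelyContinuousOnInterval_of_hasDerivAt {f f' : ℝ → ℂ} {a b : ℝ}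
    (h : ∀ x ∈ uIcc a b, HasDerivAt f (f' x) x) (hc : ContinuousOn f' (uIcc a b)) :
    AbsolutelyContinuousOnInterval f a b := by
  obtain ⟨C, hC⟩ := isCompact_uIcc.exists_bound_of_continuousOn hc
  have : LipschitzOnWith (Real.toNNReal C) f (uIcc a b) :=
    (convex_uIcc a b).lipschitzOnWith_of_nnnorm_hasDerivWithin_le
      (fun x hx => (h x hx).hasDerivWithinAt) fun x hx => by
        rw [← NNReal.coe_le_coe, coe_nnnorm]
        exact (hC x hx).trans (Real.le_coe_toNNReal C)
  exact this.absolutelyContinuousOnInterval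

theorem hasDerivAt_ofReal_zpow (n : ℤ) {x : ℝ} (hx : 0 < x) :
    HasDerivAt (fun y : ℝ => (y : ℂ) ^ n) ((n : ℂ) / x * (x : ℂ) ^ n) x := by
  have h0 : (x : ℂ) ≠ 0 := by exact_mod_cast hx.ne'
  refine HasDerivAt.congr_deriv ((hasDerivAt_zpow n (x : ℂ) (Or.inl h0)).comp_ofReal) ?_
  rw [zpow_sub_one₀ h0]
  field_simp

theorem continuousOn_ofReal_zpow (n : ℤ) : ContinuousOn (fun y : ℝ => (y : ℂ) ^ n) (Ioi 0) :=
  fun _ hx => (hasDerivAt_ofReal_zpow n hx).continuousAt.continuousWithinAt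

theorem uIcc_subset_Ioi {a b : ℝ} (ha : 0 < a) (hb : 0 < b) : uIcc a b ⊆ Ioi 0 :=
  fun _ hx => lt_of_lt_of_le (lt_min ha hb) hx.1

theorem absolutelyContinuousOnInterval_ofReal_zpow (n : ℤ) {a b : ℝ} (ha : 0 < a) (hb : 0 < b) :
    AbsolutelyContinuousOnInterval (fun y : ℝ => (y : ℂ) ^ n) a b := by
  refine absolutelyContinuousOnInterval_of_hasDerivAt
    (fun x hx => hasDerivAt_ofReal_zpow n (uIcc_subset_Ioi ha hb hx)) ?_
  refine ContinuousOn.mul (continuousOn_const.div Complex.continuous_ofReal.continuousOn ?_)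
    ((continuousOn_ofReal_zpow n).mono (uIcc_subset_Ioi ha hb))
  intro x hx
  exact_mod_cast (uIcc_subset_Ioi ha hb hx : 0 < x).ne'

/-- A nonzero limit would keep `g` above a positive constant near infinity. This removes the
boundary term at infinity for square integrable solutions, for which no pointwise decay is known. -/
theorem eq_zero_of_tendsto_of_norm_le_integrableOn {W : ℝ → ℂ} {g : ℝ → ℝ} {c : ℂ}
    (hW : Tendsto W atTop (𝓝 c)) (hg : IntegrableOn g (Ioi 0)) (hle : ∀ x > 0, ‖W x‖ ≤ g x) :
    c = 0 := by
  by_contra hc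
  have hc' : 0 < ‖c‖ := norm_pos_iff.2 hc
  have h1 : ∀ᶠ x in atTop, ‖c‖ / 2 < ‖W x‖ := hW.norm.eventually_const_lt (by linarith)
  obtain ⟨X, hX⟩ := (h1.and (eventually_gt_atTop 0)).exists_forall_of_atTop
  have h2 : IntegrableOn (fun _ : ℝ => ‖c‖ / 2) (Ioi X) := by
    refine Integrable.mono (hg.mono_set (Ioi_subset_Ioi (hX X le_rfl).2.le))
      aestronglyMeasurable_const ?_
    filter_upwards [ae_restrict_mem measurableSet_Ioi] with x hx
    have hx' := hX x (le_of_lt hx)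
    have := hle x hx'.2
    rw [Real.norm_of_nonneg (by positivity), Real.norm_of_nonneg (by linarith [hx'.1])]
    linarith [hx'.1]
  rw [integrableOn_const_iff] at h2
  rcases h2 with h2 | h2
  · exact hc (by simpa using h2)
  · simp at h2

/-! ### The energy identity on the half-line -/

namespace RadialDirac

namespace IsSol

variable {m : ℝ} {κ : ℕ} {v : ℝ → ℝ} {z : ℂ} {h₁ h₂ f₁ f₂ : ℝ → ℂ}

/-- The factor `x^{-κ}` is the integrating factor of the second equation: it absorbs the singular
term `(κ / x) f₂`. -/
theorem integral_zpow_mul_snd (hf : IsSol m κ v z h₁ h₂ f₁ f₂) {a b : ℝ}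
    (ha : 0 < a) (hb : 0 < b) :
    ∫ x in a..b, (x : ℂ) ^ (-κ : ℤ) * (((m + v x : ℝ) - z) * f₁ x - h₁ x) =
      (b : ℂ) ^ (-κ : ℤ) * f₂ b - (a : ℂ) ^ (-κ : ℤ) * f₂ a := by
  refine ((absolutelyContinuousOnInterval_ofReal_zpow (-κ) ha hb).complex_mul
    (hf.absCont_snd a b ha hb)).complex_integral_eq_sub ?_
  filter_upwards [hf.deriv_snd] with x h2 hx
  have hx := uIcc_subset_Ioi ha hb hx
  have hx0 : (x : ℂ) ≠ 0 := by exact_mod_cast (ne_of_gt hx)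
  refine HasDerivAt.congr_deriv ((hasDerivAt_ofReal_zpow (-κ) hx).mul (h2 hx)) ?_
  push_cast
  field_simp
  ring

/-- The domain imposes no condition on `f₂` at the origin, yet the boundary term there needs `f₂`
bounded. Solving the second equation backwards from a fixed `X` weights the integrand by `(a / x)^κ
≤ 1`, and what remains is controlled by the integrability of `v`. -/
theorem exists_bound_snd (hf : IsSol m κ v z h₁ h₂ f₁ f₂)
    (hv : ∀ X, IntegrableOn v (Ioc 0 X)) (h0 : Tendsto f₁ (𝓝[>] 0) (𝓝 0))
    (hh : ∀ᶠ x in 𝓝[>] 0, h₁ x = 0) : ∃ C, ∀ᶠ x in 𝓝[>] 0, ‖f₂ x‖ ≤ C := by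
  have h1 : ∀ᶠ x in 𝓝[>] 0, ‖f₁ x‖ ≤ 1 := by
    filter_upwards [h0.norm.eventually_lt_const (u := 1) (by simp)] with x hx using hx.le
  obtain ⟨X, hX0, hX⟩ := mem_nhdsGT_iff_exists_Ioc_subset.1 (h1.and hh)
  have hX0 : 0 < X := hX0
  refine ⟨‖f₂ X‖ + ∫ x in Ioc 0 X, (|m| + |v x| + ‖z‖), ?_⟩
  have hint : IntegrableOn (fun x => |m| + |v x| + ‖z‖) (Ioc 0 X) :=
    ((integrableOn_const (by simp)).add (hv X).norm).add (integrableOn_const (by simp))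
  filter_upwards [Ioc_mem_nhdsGT hX0] with a ha
  have haa : (a : ℂ) ≠ 0 := by exact_mod_cast ha.1.ne'
  have key := hf.integral_zpow_mul_snd ha.1 hX0
  have e : f₂ a = (a : ℂ) ^ κ * ((X : ℂ) ^ (-κ : ℤ) * f₂ X) - ∫ x in a..X,
      (a : ℂ) ^ κ * ((x : ℂ) ^ (-κ : ℤ) * (((m + v x : ℝ) - z) * f₁ x - h₁ x)) := by
    rw [intervalIntegral.integral_const_mul, key, zpow_neg, zpow_natCast, zpow_neg, zpow_natCast]
    field_simp
    ring
  have hr : ∀ x, a ≤ x → ‖(a : ℂ) ^ κ * (x : ℂ) ^ (-κ : ℤ)‖ ≤ 1 := by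
    intro x hx
    rw [zpow_neg, zpow_natCast, norm_mul, norm_inv, norm_pow, norm_pow, Complex.norm_real,
      Complex.norm_real, Real.norm_of_nonneg ha.1.le, Real.norm_of_nonneg (ha.1.le.trans hx),
      ← div_eq_mul_inv]
    exact div_le_one_of_le₀ (pow_le_pow_left₀ ha.1.le hx κ) (pow_nonneg (ha.1.le.trans hx) κ)
  rw [e]
  refine (norm_sub_le _ _).trans (add_le_add ?_ ?_)
  · rw [← mul_assoc, norm_mul]
    exact mul_le_of_le_one_left (norm_nonneg _) (hr X ha.2)
  · rw [intervalIntegral.integral_of_le ha.2]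
    refine (norm_integral_le_of_norm_le (hint.mono_set (Ioc_subset_Ioc_left ha.1.le)) ?_).trans
      (setIntegral_mono_set hint (Eventually.of_forall fun x => by positivity)
        (Ioc_subset_Ioc_left ha.1.le).eventuallyLE)
    filter_upwards [ae_restrict_mem measurableSet_Ioc] with x hx
    have hx' := hX ⟨ha.1.trans hx.1, hx.2⟩
    rw [← mul_assoc, norm_mul]
    refine (mul_le_of_le_one_left (norm_nonneg _) (hr x hx.1.le)).trans ?_
    rw [hx'.2, sub_zero, norm_mul]
    refine (mul_le_of_le_one_right (norm_nonneg _) hx'.1).trans ?_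
    refine (norm_sub_le _ _).trans ?_
    rw [Complex.norm_real]
    gcongr
    exact abs_add_le _ _

/-- The identity `Im (u, h) = Im z ‖u‖²` for `u = (H - z)⁻¹ h`, in integrated form. -/
theorem integral_lagrange_conj_eq_zero (hf : IsSol m κ v z h₁ h₂ f₁ f₂)
    (hv : ∀ X, IntegrableOn v (Ioc 0 X)) (h0 : Tendsto f₁ (𝓝[>] 0) (𝓝 0))
    (hh : ∀ᶠ x in 𝓝[>] 0, h₁ x = 0)
    (hL : IntegrableOn (fun x => ‖f₁ x‖ ^ 2 + ‖f₂ x‖ ^ 2) (Ioi 0))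
    (hhf : IntegrableOn (fun x => h₁ x * starRingEnd ℂ (f₁ x) + h₂ x * starRingEnd ℂ (f₂ x))
      (Ioi 0)) :
    z.im * ∫ x in Ioi 0, (‖f₁ x‖ ^ 2 + ‖f₂ x‖ ^ 2) = - (∫ x in Ioi 0,
      (h₁ x * starRingEnd ℂ (f₁ x) + h₂ x * starRingEnd ℂ (f₂ x))).im := by
  set W : ℝ → ℂ := fun x => f₁ x * starRingEnd ℂ (f₂ x) - f₂ x * starRingEnd ℂ (f₁ x) with hWdef
  set Φ : ℝ → ℂ := fun x => (z - starRingEnd ℂ z) *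
      (f₁ x * starRingEnd ℂ (f₁ x) + f₂ x * starRingEnd ℂ (f₂ x))
      + (h₁ x * starRingEnd ℂ (f₁ x) + h₂ x * starRingEnd ℂ (f₂ x))
      - (starRingEnd ℂ (h₁ x) * f₁ x + starRingEnd ℂ (h₂ x) * f₂ x) with hΦdef
  have hΦ : Φ = fun x => ((2 * (z.im * (‖f₁ x‖ ^ 2 + ‖f₂ x‖ ^ 2) +
      (h₁ x * starRingEnd ℂ (f₁ x) + h₂ x * starRingEnd ℂ (f₂ x)).im) : ℝ) : ℂ) * Complex.I := by
    funext x
    have a1 := Complex.sub_conj z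
    have a2 := Complex.sub_conj (h₁ x * starRingEnd ℂ (f₁ x) + h₂ x * starRingEnd ℂ (f₂ x))
    simp only [map_add, map_mul, Complex.conj_conj] at a2
    have a3 := Complex.mul_conj' (f₁ x)
    have a4 := Complex.mul_conj' (f₂ x)
    simp only [hΦdef]
    rw [a1, a3, a4]
    push_cast at a2 ⊢
    linear_combination a2
  have hΦint : IntegrableOn Φ (Ioi 0) := by
    rw [hΦ]
    exact (((hL.const_mul _).add hhf.im).const_mul 2).ofReal.mul_const _
  have hWle : ∀ x > 0, ‖W x‖ ≤ ‖f₁ x‖ ^ 2 + ‖f₂ x‖ ^ 2 := by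
    intro x _
    refine (norm_sub_le _ _).trans ?_
    rw [norm_mul, norm_mul, RCLike.norm_conj, RCLike.norm_conj]
    nlinarith [sq_nonneg (‖f₁ x‖ - ‖f₂ x‖)]
  have hlag : ∀ a b : ℝ, 0 < a → 0 < b → ∫ x in a..b, Φ x = W b - W a := fun a b ha hb =>
    (hf.lagrange hf.conj ha hb).2
  -- Integrability of `Φ` gives `W` a limit at infinity; `W` is dominated by an integrable function,
  -- so the limit is zero.
  have hWa : ∀ a : ℝ, 0 < a → W a = - ∫ x in Ioi a, Φ x := by
    intro a ha
    have t1 : Tendsto (fun b => W a + ∫ x in a..b, Φ x) atTop (𝓝 (W a + ∫ x in Ioi a, Φ x)) :=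
      tendsto_const_nhds.add (intervalIntegral_tendsto_integral_Ioi a
        (hΦint.mono_set (Ioi_subset_Ioi ha.le)) tendsto_id)
    have t2 : Tendsto W atTop (𝓝 (W a + ∫ x in Ioi a, Φ x)) := by
      refine t1.congr' ?_
      filter_upwards [eventually_gt_atTop 0] with b hb
      rw [hlag a b ha hb]
      ring
    have := eq_zero_of_tendsto_of_norm_le_integrableOn t2 hL hWle
    linear_combination this
  -- Each term of `W` is a factor tending to zero (`f₁` or its conjugate) times a bounded one (`f₂`
  -- or its conjugate).
  have hW0 : Tendsto W (𝓝[>] 0) (𝓝 0) := by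
    obtain ⟨C, hC⟩ := hf.exists_bound_snd hv h0 hh
    have hb : IsBoundedUnder (· ≤ ·) (𝓝[>] 0) (fun x => ‖f₂ x‖) := ⟨C, by simpa using hC⟩
    have hb' : IsBoundedUnder (· ≤ ·) (𝓝[>] 0) (fun x => ‖starRingEnd ℂ (f₂ x)‖) := by
      simpa using hb
    have h0' : Tendsto (fun x => starRingEnd ℂ (f₁ x)) (𝓝[>] 0) (𝓝 0) := by
      have := (Complex.continuous_conj.tendsto 0).comp h0
      rwa [map_zero] at this
    have := (h0.zero_mul_isBoundedUnder_le hb').sub (h0'.zero_mul_isBoundedUnder_le hb)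
    rw [sub_zero] at this
    refine this.congr fun x => ?_
    simp only [hWdef]
    ring
  have hlim : Tendsto (fun a => ∫ x in Ioi a, Φ x) (𝓝[>] 0) (𝓝 (∫ x in Ioi 0, Φ x)) := by
    have hc : ContinuousOn (fun a => ∫ x in (0 : ℝ)..a, Φ x) (uIcc 0 1) := by
      refine intervalIntegral.continuousOn_primitive_interval ?_
      rw [uIcc_of_le zero_le_one, integrableOn_Icc_iff_integrableOn_Ioc]
      exact hΦint.mono_set Ioc_subset_Ioi_self
    have h2 : Tendsto (fun a => ∫ x in (0 : ℝ)..a, Φ x) (𝓝[>] 0) (𝓝 0) := by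
      have := hc 0 (by simp)
      rw [ContinuousWithinAt, intervalIntegral.integral_same, uIcc_of_le zero_le_one] at this
      refine this.mono_left ?_
      rw [← nhdsWithin_Ioc_eq_nhdsGT (zero_lt_one)]
      exact nhdsWithin_mono _ Ioc_subset_Icc_self
    have h3 := tendsto_const_nhds (x := ∫ x in Ioi 0, Φ x).sub h2
    rw [sub_zero] at h3
    refine h3.congr' ?_
    filter_upwards [self_mem_nhdsWithin] with a ha
    have ha : 0 < a := ha
    rw [← intervalIntegral.integral_Ioi_sub_Ioi hΦint ha.le]
    ring
  have hzero : ∫ x in Ioi 0, Φ x = 0 := by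
    have h1 : Tendsto W (𝓝[>] 0) (𝓝 (-∫ x in Ioi 0, Φ x)) := by
      refine hlim.neg.congr' ?_
      filter_upwards [self_mem_nhdsWithin] with a ha using (hWa a ha).symm
    have := tendsto_nhds_unique h1 hW0
    linear_combination -this
  rw [hΦ, integral_mul_const, mul_eq_zero, or_iff_left Complex.I_ne_zero] at hzero
  have him : IntegrableOn (fun x => (h₁ x * starRingEnd ℂ (f₁ x) +
      h₂ x * starRingEnd ℂ (f₂ x)).im) (Ioi 0) := hhf.im
  rw [integral_complex_ofReal, Complex.ofReal_eq_zero, integral_const_mul, integral_add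
    (hL.const_mul _) him, integral_const_mul] at hzero
  have e : ∫ x in Ioi 0, (h₁ x * starRingEnd ℂ (f₁ x) + h₂ x * starRingEnd ℂ (f₂ x)).im =
      (∫ x in Ioi 0, (h₁ x * starRingEnd ℂ (f₁ x) + h₂ x * starRingEnd ℂ (f₂ x))).im :=
    integral_im (𝕜 := ℂ) hhf
  rw [e] at hzero
  linarith

/-- A square integrable solution of `(H - z) f = 0`, `Im z > 0`, with `f₁(0) = 0` vanishes. -/
theorem eq_zero_of_im_pos (hf : IsSol m κ v z 0 0 f₁ f₂)
    (hv : ∀ X, IntegrableOn v (Ioc 0 X)) (h0 : Tendsto f₁ (𝓝[>] 0) (𝓝 0))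
    (hL : IntegrableOn (fun x => ‖f₁ x‖ ^ 2 + ‖f₂ x‖ ^ 2) (Ioi 0)) (hz : 0 < z.im) {x : ℝ}
    (hx : 0 < x) : f₁ x = 0 ∧ f₂ x = 0 := by
  have key := hf.integral_lagrange_conj_eq_zero hv h0 (by simp) hL (by simp)
  simp only [Pi.zero_apply, zero_mul, add_zero, integral_zero, Complex.zero_im, neg_zero,
    mul_eq_zero, hz.ne', false_or] at key
  rw [setIntegral_eq_zero_iff_of_nonneg_ae (Eventually.of_forall fun x => by positivity) hL] at key
  have hc : ContinuousOn (fun x => ‖f₁ x‖ ^ 2 + ‖f₂ x‖ ^ 2) (Ioi 0) :=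
    (hf.continuousOn_fst.norm.pow 2).add (hf.continuousOn_snd.norm.pow 2)
  have := Measure.eqOn_open_of_ae_eq key isOpen_Ioi hc continuousOn_const hx
  simp only [Pi.zero_apply] at this
  constructor
  · have : ‖f₁ x‖ ^ 2 = 0 := by nlinarith [sq_nonneg ‖f₁ x‖, sq_nonneg ‖f₂ x‖]
    simpa using this
  · have : ‖f₂ x‖ ^ 2 = 0 := by nlinarith [sq_nonneg ‖f₁ x‖, sq_nonneg ‖f₂ x‖]
    simpa using this

end IsSol

end RadialDirac

/-! ### Passing between the operator and the system -/

namespace RadialDirac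

theorem ConditionA.integrableOn {v : ℝ → ℝ} {γ : ℝ} (hv : ConditionA v γ) (X : ℝ) :
    IntegrableOn v (Ioc 0 X) := by
  have h1 : MemLp v 2 (volume.restrict (Ioc 0 X)) :=
    hv.memLp.mono_measure (Measure.restrict_mono Ioc_subset_Ioi_self le_rfl)
  exact h1.integrable (by norm_num)

theorem ConditionA.ae_eq_zero {v : ℝ → ℝ} {γ : ℝ} (hv : ConditionA v γ) :
    ∀ᵐ x : ℝ, γ < x → v x = 0 := hv.sup_supp.1.2

theorem lipschitzWith_coord (i : Fin 2) : LipschitzWith 1 (fun w : Spinor => w i) := by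
  refine LipschitzWith.of_dist_le_mul fun x y => ?_
  rw [NNReal.coe_one, one_mul, dist_eq_norm, dist_eq_norm]
  exact PiLp.norm_apply_le (x - y) i

theorem deriv_coord {f : ℝ → Spinor} {x : ℝ} (hf : DifferentiableAt ℝ f x) (i : Fin 2) :
    HasDerivAt (fun y => f y i) (deriv f x i) x :=
  (((EuclideanSpace.proj i : Spinor →L[ℂ] ℂ).restrictScalars ℝ).hasFDerivAt.comp_hasDerivAt x
    hf.hasDerivAt)

section

variable {m : ℝ} {κ : ℕ} {v : ℝ → ℝ} {z : ℂ}

/-- Local absolute continuity makes `u` differentiable almost everywhere, so `deriv` in `diracExpr`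
is a true derivative off a null set and the two components can be solved for it. -/
theorem IsResolventAt.isSol {h u : ℝ → Spinor} (hu : IsResolventAt m κ v z h u) :
    IsSol m κ v z (fun x => h x 0) (fun x => h x 1) (fun x => u x 0) (fun x => u x 1) := by
  have hac : ∀ (i : Fin 2) (a b : ℝ), 0 < a → 0 < b →
      AbsolutelyContinuousOnInterval (fun x => u x i) a b := fun i a b ha hb =>
    (hu.1.absCont a b ha hb).comp_lipschitzWith (lipschitzWith_coord i)
  have hd : ∀ᵐ x : ℝ, 0 < x → DifferentiableAt ℝ u x := by
    refine ae_pos_of_forall_ae_Icc fun a b ha hb => ?_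
    filter_upwards [(hac 0 a b ha hb).complex_ae_differentiableAt,
      (hac 1 a b ha hb).complex_ae_differentiableAt] with x h0 h1 hx
    refine (differentiableAt_piLp (𝕜 := ℝ) 2).2 ?_
    intro i
    fin_cases i
    exacts [h0 hx, h1 hx]
  have he := (ae_restrict_iff' measurableSet_Ioi).1 hu.2
  refine ⟨hac 0, hac 1, ?_, ?_⟩
  · filter_upwards [hd, he] with x hx hx' h0
    refine (deriv_coord (hx h0) 0).congr_deriv ?_
    have := congrArg (fun w : Spinor => w 1) (hx' h0)
    simp [diracExpr] at this
    rw [← this]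
    push_cast
    ring
  · filter_upwards [hd, he] with x hx hx' h0
    refine (deriv_coord (hx h0) 1).congr_deriv ?_
    have := congrArg (fun w : Spinor => w 0) (hx' h0)
    simp [diracExpr] at this
    rw [← this]
    push_cast
    ring

theorem integrableOn_sq_of_memLp {u : ℝ → Spinor} (hu : MemLp u 2 halfLine) :
    IntegrableOn (fun x => ‖u x 0‖ ^ 2 + ‖u x 1‖ ^ 2) (Ioi 0) := by
  have := (memLp_two_iff_integrable_sq_norm hu.1).1 hu
  refine this.congr (Eventually.of_forall fun x => ?_)
  simp [EuclideanSpace.norm_sq_eq]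

theorem IsSol.isResolventAt {h : ℝ → Spinor} {f₁ f₂ : ℝ → ℂ}
    (hf : IsSol m κ v z (fun x => h x 0) (fun x => h x 1) f₁ f₂) (hh : MemLp h 2 halfLine)
    (h1 : MemLp f₁ 2 halfLine) (h2 : MemLp f₂ 2 halfLine) (h0 : Tendsto f₁ (𝓝[>] 0) (𝓝 0)) :
    IsResolventAt m κ v z h (fun x => !₂[f₁ x, f₂ x]) := by
  set u : ℝ → Spinor := fun x => !₂[f₁ x, f₂ x] with hu
  have hLp : MemLp u 2 halfLine := by
    rw [memLp_piLp_iff]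
    intro i
    fin_cases i
    exacts [h1, h2]
  have heq : ∀ᵐ x ∂halfLine, diracExpr m κ v u x - z • u x = h x := by
    rw [ae_restrict_iff' measurableSet_Ioi]
    filter_upwards [hf.deriv_fst, hf.deriv_snd] with x hx1 hx2 h0
    have hd : DifferentiableAt ℝ u x := by
      refine (differentiableAt_piLp (𝕜 := ℝ) 2).2 ?_
      intro i
      fin_cases i
      exacts [(hx1 h0).differentiableAt, (hx2 h0).differentiableAt]
    have e0 : deriv u x 0 = _ := (deriv_coord hd 0).unique (hx1 h0)
    have e1 : deriv u x 1 = _ := (deriv_coord hd 1).unique (hx2 h0)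
    have u0 : u x 0 = f₁ x := rfl
    have u1 : u x 1 = f₂ x := rfl
    clear_value u
    ext i
    fin_cases i
    · simp [diracExpr, e1, u0, u1]
      ring
    · simp [diracExpr, e0, u0, u1]
      ring
  refine ⟨⟨hLp, fun a b ha hb => ?_, ?_, h0⟩, heq⟩
  · have l : ∀ e : Spinor, LipschitzWith ‖e‖₊ (fun c : ℂ => c • e) := fun e =>
      LipschitzWith.of_dist_le_mul fun x y => by
        rw [dist_eq_norm, ← sub_smul, norm_smul, dist_eq_norm, mul_comm, coe_nnnorm]
    refine AbsolutelyContinuousOnInterval.congr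
      (((hf.absCont_fst a b ha hb).comp_lipschitzWith (l !₂[1, 0])).add
      ((hf.absCont_snd a b ha hb).comp_lipschitzWith (l !₂[0, 1]))) fun x _ => ?_
    ext i
    fin_cases i <;> simp [hu]
  -- Square integrability of `H u` comes from the equation itself: `H u = z u + h` almost
  -- everywhere.
  · refine MemLp.ae_eq ?_ ((hLp.const_smul z).add hh)
    filter_upwards [heq] with x hx
    simp only [Pi.add_apply, Pi.smul_apply]
    rw [← hx]
    abel

/-- The difference of two resolvent functions is a square integrable homogeneous solution with the
boundary condition, hence zero for nonreal `z`. This makes the value of `Φ_h` independent of the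
chosen `u`. -/
theorem IsResolventAt.eqOn (hv : ∀ X, IntegrableOn v (Ioc 0 X)) (hz : 0 < z.im)
    {h u w : ℝ → Spinor} (hu : IsResolventAt m κ v z h u) (hw : IsResolventAt m κ v z h w) :
    EqOn u w (Ioi 0) := by
  have hs := hu.isSol.sub hw.isSol
  simp only [sub_self] at hs
  have hL := integrableOn_sq_of_memLp (hu.1.memLp.sub hw.1.memLp)
  have ht := hu.1.dirichlet.sub hw.1.dirichlet
  rw [sub_zero] at ht
  intro x hx
  obtain ⟨e0, e1⟩ := hs.eq_zero_of_im_pos hv ht hL hz hx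
  ext i
  fin_cases i
  exacts [sub_eq_zero.1 e0, sub_eq_zero.1 e1]

theorem pairing_eq (u h : ℝ → Spinor) : pairing u h =
    ∫ x in Ioi (0 : ℝ), (starRingEnd ℂ (h x 0) * u x 0 + starRingEnd ℂ (h x 1) * u x 1) := by
  refine integral_congr_ae (Eventually.of_forall fun x => ?_)
  simp [PiLp.inner_apply, mul_comm]

theorem IsTestFunction.memLp {h : ℝ → Spinor} (hh : IsTestFunction h) : MemLp h 2 halfLine :=
  (hh.continuous.memLp_of_hasCompactSupport hh.compact).restrict _

/-- The support of a test function is contained in a compact interval of `(0, ∞)`. -/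
theorem IsTestFunction.exists_Icc {h : ℝ → Spinor} (hh : IsTestFunction h) (γ : ℝ) :
    ∃ a b, 0 < a ∧ a < b ∧ γ < b ∧ ∀ x, x ∉ Icc a b → h x = 0 := by
  have h0 : (tsupport h)ᶜ ∈ 𝓝 (0 : ℝ) := (isClosed_tsupport h).isOpen_compl.mem_nhds
    fun hx => lt_irrefl (0 : ℝ) (hh.support hx)
  obtain ⟨ε, hε, hball⟩ := Metric.mem_nhds_iff.1 h0
  obtain ⟨R, hR⟩ := hh.compact.isBounded.subset_closedBall 0
  refine ⟨ε, max (max γ R) ε + 1, hε, by linarith [le_max_right (max γ R) ε],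
    by linarith [le_max_left (max γ R) ε, le_max_left γ R], fun x hx => ?_⟩
  by_contra hne
  have hx1 : x ∈ tsupport h := subset_tsupport h hne
  have hx0 : 0 < x := hh.support hx1
  have h2 := hR hx1
  rw [Metric.mem_closedBall, Real.dist_eq, sub_zero, abs_of_pos hx0] at h2
  have h3 : x ∉ Metric.ball 0 ε := fun hb => hball hb hx1
  rw [Metric.mem_ball, Real.dist_eq, sub_zero, abs_of_pos hx0, not_lt] at h3
  exact hx ⟨h3, by linarith [le_max_left (max γ R) ε, le_max_right γ R]⟩

/-- The Herglotz property of `Φ_h`: its imaginary part is `Im z ‖u‖²`. -/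
theorem IsResolventAt.im_pairing_nonneg (hv : ∀ X, IntegrableOn v (Ioc 0 X)) (hz : 0 < z.im)
    {h u : ℝ → Spinor} (hh : IsTestFunction h) (hu : IsResolventAt m κ v z h u) :
    0 ≤ (pairing u h).im := by
  obtain ⟨a, b, ha, -, -, hab⟩ := hh.exists_Icc 0
  have h1 : ∀ᶠ x in 𝓝[>] 0, h x 0 = 0 := by
    filter_upwards [Ioo_mem_nhdsGT ha] with x hx
    rw [hab x fun hx' => absurd hx'.1 (not_le.2 hx.2)]
    rfl
  have hint : IntegrableOn (fun x => h x 0 * starRingEnd ℂ (u x 0) +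
      h x 1 * starRingEnd ℂ (u x 1)) (Ioi 0) := by
    have hc := memLp_piLp_iff.1 hh.memLp
    have uc := memLp_piLp_iff.1 hu.1.memLp
    exact ((hc 0).integrable_mul (uc 0).star).add ((hc 1).integrable_mul (uc 1).star)
  have key := hu.isSol.integral_lagrange_conj_eq_zero hv hu.1.dirichlet h1
    (integrableOn_sq_of_memLp hu.1.memLp) hint
  have e : pairing u h = starRingEnd ℂ (∫ x in Ioi 0, (h x 0 * starRingEnd ℂ (u x 0) +
      h x 1 * starRingEnd ℂ (u x 1))) := by
    rw [pairing_eq, ← integral_conj]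
    refine integral_congr_ae (Eventually.of_forall fun x => ?_)
    simp
  rw [e, Complex.conj_im, ← key]
  exact mul_nonneg hz.le (integral_nonneg fun x => by positivity)

end

end RadialDirac

/-! ### Holomorphic dependence on the spectral parameter -/

/-- Holomorphy of an integral depending holomorphically on a parameter. -/
theorem differentiableOn_integral_of_dominated {α : Type*} [MeasurableSpace α] {μ : Measure α}
    {F : α → ℂ → ℂ} {U : Set ℂ} (hU : IsOpen U)
    (hm : ∀ z ∈ U, AEStronglyMeasurable (fun a => F a z) μ)
    (hd : ∀ᵐ a ∂μ, DifferentiableOn ℂ (F a) U)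
    (hb : ∀ z₀ ∈ U, ∃ V ∈ 𝓝 z₀, ∃ bound : α → ℝ, Integrable bound μ ∧
      ∀ᵐ a ∂μ, ∀ z ∈ V, ‖F a z‖ ≤ bound a) :
    DifferentiableOn ℂ (fun z => ∫ a, F a z ∂μ) U := by
  intro z₀ hz₀
  obtain ⟨V, hV, bound, hbi, hbd⟩ := hb z₀ hz₀
  obtain ⟨r, hr, hball⟩ := Metric.mem_nhds_iff.1 (inter_mem hV (hU.mem_nhds hz₀))
  -- The derivative is an almost everywhere limit of difference quotients along a sequence. The
  -- increments `r / (n + 2)` are strictly less than `r` already for `n = 0`, so all points stay in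
  -- `U`.
  have hF'm : AEStronglyMeasurable (fun a => deriv (F a) z₀) μ := by
    have ht : Tendsto (fun n : ℕ => z₀ + ((r / (n + 2) : ℝ) : ℂ)) atTop (𝓝[≠] z₀) := by
      refine tendsto_nhdsWithin_iff.2 ⟨?_, Eventually.of_forall fun n => ?_⟩
      · have h1 : Tendsto (fun n : ℕ => r / ((n : ℝ) + 2)) atTop (𝓝 0) :=
          tendsto_const_nhds.div_atTop
            (tendsto_atTop_add_const_right _ _ tendsto_natCast_atTop_atTop)
        have h2 := (Complex.continuous_ofReal.tendsto 0).comp h1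
        simpa using tendsto_const_nhds (x := z₀).add h2
      · have h3 : (r / ((n : ℝ) + 2)) ≠ 0 := by positivity
        simp only [mem_compl_iff, mem_singleton_iff, add_eq_left, Complex.ofReal_eq_zero]
        exact h3
    refine aestronglyMeasurable_of_tendsto_ae atTop
      (f := fun (n : ℕ) a => slope (F a) z₀ (z₀ + ((r / (n + 2) : ℝ) : ℂ))) (fun n => ?_) ?_
    · have h4 : z₀ + ((r / ((n : ℝ) + 2) : ℝ) : ℂ) ∈ U := by
        refine (hball ?_).2
        rw [Metric.mem_ball, dist_eq_norm, add_sub_cancel_left, Complex.norm_real,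
          Real.norm_of_nonneg (by positivity)]
        exact div_lt_self hr (by linarith [n.cast_nonneg (α := ℝ)])
      simp only [slope_def_field, div_eq_mul_inv]
      exact ((hm _ h4).sub (hm _ hz₀)).mul_const _
    · filter_upwards [hd] with a ha
      exact (hasDerivAt_iff_tendsto_slope.1
        (ha.differentiableAt (hU.mem_nhds hz₀)).hasDerivAt).comp ht
  have key := hasDerivAt_integral_of_dominated_loc_of_deriv_le (𝕜 := ℂ) (μ := μ)
    (F := fun z a => F a z) (F' := fun z a => deriv (F a) z) (x₀ := z₀)
    (s := Metric.ball z₀ (r / 2)) (bound := fun a => bound a / (r / 2))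
    (Metric.ball_mem_nhds _ (by positivity))
    (by filter_upwards [hU.mem_nhds hz₀] with z hz using hm z hz)
    (hbi.mono' (hm z₀ hz₀) (by
      filter_upwards [hbd] with a ha using ha z₀ (hball (Metric.mem_ball_self hr)).1))
    hF'm ?_ (hbi.div_const _) ?_
  · exact key.2.differentiableAt.differentiableWithinAt
  -- Cauchy's estimate on the circle of radius `r / 2` about `z`, which stays in the ball of radius
  -- `r` about `z₀`, turns the bound on `F` into one on its derivative.
  · filter_upwards [hbd, hd] with a ha hda z hz
    refine Complex.norm_deriv_le_of_forall_mem_sphere_norm_le (by positivity) ?_ ?_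
    · have hsub : Metric.closedBall z (r / 2) ⊆ U := fun w hw => by
        refine (hball ?_).2
        rw [Metric.mem_ball] at hz ⊢
        rw [Metric.mem_closedBall] at hw
        linarith [dist_triangle w z z₀]
      exact (hda.mono hsub).diffContOnCl_ball subset_rfl
    · intro w hw
      refine ha w (hball ?_).1
      rw [Metric.mem_ball] at hz ⊢
      rw [mem_sphere_iff_norm, ← dist_eq_norm] at hw
      linarith [dist_triangle w z z₀]
  · filter_upwards [hd] with a hda z hz
    refine (hda.differentiableAt (hU.mem_nhds (hball ?_).2)).hasDerivAt
    exact Metric.ball_subset_ball (by linarith) hz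

/-- A family of functions of `x ∈ (0, ∞)`, continuous in `x`, holomorphic in `z ∈ U` and locally
bounded. -/
structure HolFamily (U : Set ℂ) (f : ℝ → ℂ → ℂ) : Prop where
  cont : ∀ z ∈ U, ContinuousOn (fun x => f x z) (Ioi 0)
  diff : ∀ x > 0, DifferentiableOn ℂ (f x) U
  bdd : ∀ z₀ ∈ U, ∀ a b : ℝ, 0 < a → ∃ C, ∃ V ∈ 𝓝 z₀, ∀ x ∈ Icc a b, ∀ z ∈ V, ‖f x z‖ ≤ C

namespace HolFamily

variable {U : Set ℂ} {f g : ℝ → ℂ → ℂ}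

theorem mono {V : Set ℂ} (hf : HolFamily U f) (hV : V ⊆ U) : HolFamily V f :=
  ⟨fun z hz => hf.cont z (hV hz), fun x hx => (hf.diff x hx).mono hV,
    fun z hz => hf.bdd z (hV hz)⟩

theorem of_continuous {f : ℝ → ℂ} (hf : ContinuousOn f (Ioi 0)) :
    HolFamily U (fun x _ => f x) where
  cont _ _ := hf
  diff _ _ := differentiableOn_const _
  bdd z₀ _ a b ha := by
    obtain ⟨C, hC⟩ := isCompact_Icc.exists_bound_of_continuousOn
      (hf.mono fun x (hx : x ∈ Icc a b) => lt_of_lt_of_le ha hx.1)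
    exact ⟨C, univ, univ_mem, fun x hx _ _ => hC x hx⟩

theorem of_differentiableOn {f : ℂ → ℂ} (hU : IsOpen U) (hf : DifferentiableOn ℂ f U) :
    HolFamily U (fun _ z => f z) where
  cont _ _ := continuousOn_const
  diff _ _ := hf
  bdd z₀ hz₀ a b _ := by
    have hc := (hf.differentiableAt (hU.mem_nhds hz₀)).continuousAt.norm
    exact ⟨‖f z₀‖ + 1, _, hc.eventually_le_const (u := ‖f z₀‖ + 1) (by linarith),
      fun x _ z hz => hz⟩

theorem add (hf : HolFamily U f) (hg : HolFamily U g) :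
    HolFamily U (fun x z => f x z + g x z) where
  cont z hz := (hf.cont z hz).add (hg.cont z hz)
  diff x hx := (hf.diff x hx).add (hg.diff x hx)
  bdd z₀ hz₀ a b ha := by
    obtain ⟨C, V, hV, hC⟩ := hf.bdd z₀ hz₀ a b ha
    obtain ⟨D, W, hW, hD⟩ := hg.bdd z₀ hz₀ a b ha
    exact ⟨C + D, V ∩ W, inter_mem hV hW, fun x hx z hz =>
      (norm_add_le _ _).trans (add_le_add (hC x hx z hz.1) (hD x hx z hz.2))⟩

theorem mul (hf : HolFamily U f) (hg : HolFamily U g) :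
    HolFamily U (fun x z => f x z * g x z) where
  cont z hz := (hf.cont z hz).mul (hg.cont z hz)
  diff x hx := (hf.diff x hx).mul (hg.diff x hx)
  bdd z₀ hz₀ a b ha := by
    obtain ⟨C, V, hV, hC⟩ := hf.bdd z₀ hz₀ a b ha
    obtain ⟨D, W, hW, hD⟩ := hg.bdd z₀ hz₀ a b ha
    refine ⟨C * D, V ∩ W, inter_mem hV hW, fun x hx z hz => ?_⟩
    rw [norm_mul]
    exact mul_le_mul (hC x hx z hz.1) (hD x hx z hz.2) (norm_nonneg _)
      ((norm_nonneg _).trans (hC x hx z hz.1))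

theorem neg (hf : HolFamily U f) : HolFamily U (fun x z => -f x z) where
  cont z hz := (hf.cont z hz).neg
  diff x hx := (hf.diff x hx).neg
  bdd z₀ hz₀ a b ha := by simpa using hf.bdd z₀ hz₀ a b ha

theorem intervalIntegrable (hf : HolFamily U f) {z : ℂ} (hz : z ∈ U) {a b : ℝ} (ha : 0 < a)
    (hb : 0 < b) : IntervalIntegrable (fun x => f x z) volume a b :=
  ((hf.cont z hz).mono (uIcc_subset_Ioi ha hb)).intervalIntegrable

theorem differentiableOn_integral (hf : HolFamily U f) (hU : IsOpen U) {a b : ℝ} (ha : 0 < a)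
    (hb : 0 < b) : DifferentiableOn ℂ (fun z => ∫ x in a..b, f x z) U := by
  simp only [intervalIntegral.intervalIntegral_eq_integral_uIoc]
  refine DifferentiableOn.const_smul ?_ _
  have hsub : uIoc a b ⊆ Ioi 0 := uIoc_subset_uIcc.trans (uIcc_subset_Ioi ha hb)
  refine differentiableOn_integral_of_dominated hU (fun z hz => ?_) ?_ fun z₀ hz₀ => ?_
  · exact ((hf.cont z hz).mono hsub).aestronglyMeasurable measurableSet_uIoc
  · filter_upwards [ae_restrict_mem measurableSet_uIoc] with x hx using hf.diff x (hsub hx)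
  · obtain ⟨C, V, hV, hC⟩ := hf.bdd z₀ hz₀ (min a b) (max a b) (lt_min ha hb)
    refine ⟨V, hV, fun _ => C, integrableOn_const measure_Ioc_lt_top.ne, ?_⟩
    filter_upwards [ae_restrict_mem measurableSet_uIoc] with x hx z hz
    exact hC x (uIoc_subset_uIcc hx) z hz

theorem primitive (hf : HolFamily U f) (hU : IsOpen U) {a : ℝ} (ha : 0 < a) :
    HolFamily U (fun x z => ∫ t in a..x, f t z) where
  cont z hz := by
    intro x hx
    have hx : 0 < x := hx
    have h1 := intervalIntegral.integral_hasDerivAt_right (hf.intervalIntegrable hz ha hx)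
      ((hf.cont z hz).stronglyMeasurableAtFilter isOpen_Ioi x hx)
      ((hf.cont z hz).continuousAt (Ioi_mem_nhds hx))
    exact h1.continuousAt.continuousWithinAt
  diff x hx := hf.differentiableOn_integral hU ha hx
  bdd z₀ hz₀ c d hc := by
    obtain ⟨C, V, hV, hC⟩ := hf.bdd z₀ hz₀ (min a c) (max a d) (lt_min ha hc)
    refine ⟨C * (|d| + |a|), V, hV, fun x hx z hz => ?_⟩
    have hC0 : 0 ≤ C := (norm_nonneg _).trans (hC a ⟨min_le_left _ _, le_max_left _ _⟩ z hz)
    refine (intervalIntegral.norm_integral_le_of_norm_le_const (C := C) fun t ht => ?_).trans ?_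
    · have ht := uIoc_subset_uIcc ht
      refine hC t ⟨le_trans ?_ ht.1, ht.2.trans ?_⟩ z hz
      · exact min_le_min_left a hx.1
      · exact max_le_max_left a hx.2
    · refine mul_le_mul_of_nonneg_left ?_ hC0
      refine (abs_sub _ _).trans (add_le_add_left ?_ _)
      rw [abs_of_pos (hc.trans_le hx.1)]
      exact hx.2.trans (le_abs_self d)

end HolFamily

/-! ### Volterra systems by successive approximation -/

theorem abs_integral_le_of_mem_uIoc {β : ℝ → ℝ} (hβ : ∀ t, 0 ≤ β t) {x₀ x t : ℝ}
    (hi : IntervalIntegrable β volume x₀ x) (ht : t ∈ uIcc x₀ x) :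
    |∫ s in x₀..t, β s| ≤ |∫ s in x₀..x, β s| := by
  rcases le_total x₀ x with h | h
  · rw [uIcc_of_le h] at ht
    have h1 : 0 ≤ ∫ s in x₀..t, β s := intervalIntegral.integral_nonneg ht.1 fun s _ => hβ s
    rw [abs_of_nonneg h1]
    refine le_trans ?_ (le_abs_self _)
    exact intervalIntegral.integral_mono_interval le_rfl ht.1 ht.2
      (Eventually.of_forall hβ) hi
  · rw [uIcc_of_ge h] at ht
    rw [intervalIntegral.integral_symm, intervalIntegral.integral_symm x, abs_neg, abs_neg]
    have h1 : 0 ≤ ∫ s in t..x₀, β s := intervalIntegral.integral_nonneg ht.2 fun s _ => hβ s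
    rw [abs_of_nonneg h1]
    refine le_trans ?_ (le_abs_self _)
    exact intervalIntegral.integral_mono_interval ht.1 ht.2 le_rfl
      (Eventually.of_forall hβ) hi.symm

theorem AbsolutelyContinuousOnInterval.real_pow {f : ℝ → ℝ} {a b : ℝ}
    (hf : AbsolutelyContinuousOnInterval f a b) (n : ℕ) :
    AbsolutelyContinuousOnInterval (fun x => f x ^ (n + 1)) a b := by
  induction n with
  | zero => simpa using hf
  | succ n ih =>
    simp only [pow_succ _ (n + 1)]
    exact ih.mul hf

/-- The power `B^{n+1}` of the primitive `B` of `β` is absolutely continuous with derivative `(n +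
1) β B^n` almost everywhere. This is what produces the factorials in the iteration although `β` is
merely integrable. -/
theorem integral_mul_primitive_pow {β : ℝ → ℝ} {x₀ x : ℝ}
    (hi : IntervalIntegrable β volume x₀ x) (n : ℕ) :
    ∫ t in x₀..x, β t * (∫ s in x₀..t, β s) ^ n = (∫ s in x₀..x, β s) ^ (n + 1) / (n + 1) := by
  have hac := (hi.absolutelyContinuousOnInterval_intervalIntegral left_mem_uIcc).real_pow n
  have h1 := hac.integral_deriv_eq_sub
  rw [intervalIntegral.integral_same, zero_pow n.succ_ne_zero, sub_zero] at h1
  rw [eq_div_iff (by positivity), ← h1, ← intervalIntegral.integral_mul_const]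
  refine intervalIntegral.integral_congr_ae ?_
  filter_upwards [hi.ae_hasDerivAt_integral] with t ht hm
  have h2 := (ht (uIoc_subset_uIcc hm) x₀ left_mem_uIcc).pow (n + 1)
  rw [show deriv (fun x => (∫ v in x₀..x, β v) ^ (n + 1)) t = _ from h2.deriv]
  push_cast
  ring

/-- The absolute values allow the base point on either side of `x`: the regular solution starts at
`0` and moves right, the solutions with data at `γ` move left. -/
theorem abs_integral_mul_abs_primitive_pow {β : ℝ → ℝ} (hβ : ∀ t, 0 ≤ β t) {x₀ x : ℝ}
    (hi : IntervalIntegrable β volume x₀ x) (n : ℕ) :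
    |∫ t in x₀..x, β t * |∫ s in x₀..t, β s| ^ n| = |∫ s in x₀..x, β s| ^ (n + 1) / (n + 1) := by
  have key := integral_mul_primitive_pow hi n
  have hn : |(n : ℝ) + 1| = n + 1 := abs_of_pos (by positivity)
  rcases le_total x₀ x with h | h
  · have : ∀ t ∈ uIcc x₀ x, β t * |∫ s in x₀..t, β s| ^ n = β t * (∫ s in x₀..t, β s) ^ n := by
      intro t ht
      rw [uIcc_of_le h] at ht
      rw [abs_of_nonneg (intervalIntegral.integral_nonneg ht.1 fun s _ => hβ s)]
    rw [intervalIntegral.integral_congr this, key, abs_div, abs_pow, hn]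
  · have : ∀ t ∈ uIcc x₀ x, β t * |∫ s in x₀..t, β s| ^ n =
        (-1) ^ n * (β t * (∫ s in x₀..t, β s) ^ n) := by
      intro t ht
      rw [uIcc_of_ge h] at ht
      have h1 : ∫ s in x₀..t, β s ≤ 0 := by
        rw [intervalIntegral.integral_symm]
        exact neg_nonpos.2 (intervalIntegral.integral_nonneg ht.2 fun s _ => hβ s)
      rw [abs_of_nonpos h1, neg_pow]
      ring
    rw [intervalIntegral.integral_congr this, intervalIntegral.integral_const_mul, key, abs_mul,
      abs_pow, abs_neg, abs_one, one_pow, one_mul, abs_div, abs_pow, hn]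

/-- The successive approximations to the Volterra system
`y b = c b + r b ∫_{x₀}^x (r b)⁻¹ w b y (!b)`. -/
noncomputable def volterraIter (x₀ : ℝ) (r : Bool → ℝ → ℂ) (w c : Bool → ℝ → ℂ → ℂ) :
    ℕ → Bool → ℝ → ℂ → ℂ
  | 0, b, x, z => c b x z
  | n + 1, b, x, z => r b x * ∫ t in x₀..x, (r b t)⁻¹ * w b t z * volterraIter x₀ r w c n (!b) t z

/-- The solution of the Volterra system. -/
noncomputable def volterraSol (x₀ : ℝ) (r : Bool → ℝ → ℂ) (w c : Bool → ℝ → ℂ → ℂ)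
    (b : Bool) (x : ℝ) (z : ℂ) : ℂ := ∑' n, volterraIter x₀ r w c n b x z

/-- The hypotheses under which the Volterra system is solved on `D`. -/
structure IsVolterra (x₀ : ℝ) (D : Set ℝ) (β : ℝ → ℝ) (r : Bool → ℝ → ℂ)
    (w c : Bool → ℝ → ℂ → ℂ) (C : ℝ → ℝ) : Prop where
  sub : ∀ x ∈ D, uIoc x₀ x ⊆ D
  nhds : ∀ x ∈ D, ∃ X ∈ D, uIcc x₀ X ∈ 𝓝[D] x
  β_nonneg : ∀ t, 0 ≤ β t
  β_int : ∀ x ∈ D, IntervalIntegrable β volume x₀ x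
  r_cont : ∀ b, ContinuousOn (r b) D
  r_ne : ∀ b, ∀ x ∈ D, r b x ≠ 0
  r_le : ∀ b, ∀ x ∈ D, ∀ t ∈ uIoc x₀ x, ‖r b x‖ ≤ ‖r b t‖
  w_le : ∀ b t z, ‖w b t z‖ ≤ (1 + ‖z‖) * β t
  w_meas : ∀ b z, ∀ x ∈ D, AEStronglyMeasurable (fun t => w b t z) (volume.restrict (uIoc x₀ x))
  w_diff : ∀ b t, Differentiable ℂ (w b t)
  c_cont : ∀ b z, ContinuousOn (fun x => c b x z) D
  c_diff : ∀ b x, Differentiable ℂ (c b x)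
  c_le : ∀ b, ∀ x ∈ D, ∀ (R : ℝ) (z : ℂ), ‖z‖ ≤ R → ‖c b x z‖ ≤ C R

namespace IsVolterra

variable {x₀ : ℝ} {D : Set ℝ} {β : ℝ → ℝ} {r : Bool → ℝ → ℂ} {w c : Bool → ℝ → ℂ → ℂ} {C : ℝ → ℝ}

theorem aestronglyMeasurable (H : IsVolterra x₀ D β r w c C) (b : Bool) (z : ℂ) {x : ℝ}
    (hx : x ∈ D) {y : ℝ → ℂ} (hy : ContinuousOn y D) :
    AEStronglyMeasurable (fun t => (r b t)⁻¹ * w b t z * y t) (volume.restrict (uIoc x₀ x)) := by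
  have h1 : ContinuousOn (fun t => (r b t)⁻¹) D := (H.r_cont b).inv₀ (H.r_ne b)
  exact (((h1.mono (H.sub x hx)).aestronglyMeasurable measurableSet_uIoc).mul
    (H.w_meas b z x hx)).mul ((hy.mono (H.sub x hx)).aestronglyMeasurable measurableSet_uIoc)

/-- Because `r` does not grow in norm away from `x₀`, one has `|r(x) / r(t)| ≤ 1`: the singular
powers of `x` hidden in `r` cost nothing, and only the integrable weight `β` survives. -/
theorem norm_kernel_le (H : IsVolterra x₀ D β r w c C) (b : Bool) {z : ℂ} {R : ℝ} (hz : ‖z‖ ≤ R)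
    {x t : ℝ} (hx : x ∈ D) (ht : t ∈ uIoc x₀ x) :
    ‖(r b t)⁻¹ * w b t z‖ ≤ ‖r b x‖⁻¹ * ((1 + R) * β t) := by
  rw [norm_mul, norm_inv]
  refine mul_le_mul ?_ ((H.w_le b t z).trans ?_) (norm_nonneg _) (by positivity)
  · exact inv_anti₀ (norm_pos_iff.2 (H.r_ne b x hx)) (H.r_le b x hx t ht)
  · exact mul_le_mul_of_nonneg_right (by linarith) (H.β_nonneg t)

theorem intervalIntegrable (H : IsVolterra x₀ D β r w c C) (b : Bool) (z : ℂ) {x : ℝ}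
    (hx : x ∈ D) {y : ℝ → ℂ} (hy : ContinuousOn y D) {M : ℝ} (hM : ∀ t ∈ uIoc x₀ x, ‖y t‖ ≤ M) :
    IntervalIntegrable (fun t => (r b t)⁻¹ * w b t z * y t) volume x₀ x := by
  refine IntervalIntegrable.mono_fun' (((H.β_int x hx).const_mul (1 + ‖z‖)).const_mul
    ‖r b x‖⁻¹ |>.mul_const M) (H.aestronglyMeasurable b z hx hy) ?_
  filter_upwards [ae_restrict_mem measurableSet_uIoc] with t ht
  rw [norm_mul]
  exact mul_le_mul (H.norm_kernel_le b le_rfl hx ht) (hM t ht) (norm_nonneg _)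
    (mul_nonneg (by positivity) (mul_nonneg (by positivity) (H.β_nonneg t)))

theorem C_nonneg (H : IsVolterra x₀ D β r w c C) {x : ℝ} (hx : x ∈ D) {R : ℝ} (hR : 0 ≤ R) :
    0 ≤ C R :=
  (norm_nonneg _).trans (H.c_le true x hx R 0 (by simpa))

/-- Picard's factorial estimate. In the induction step the outer factor `‖r b x‖` cancels the
inverse from `norm_kernel_le`, and integrating `β |B|^n` supplies the next factor `1 / (n + 1)`. -/
theorem norm_iter_le (H : IsVolterra x₀ D β r w c C) (n : ℕ) (b : Bool) {x : ℝ} (hx : x ∈ D)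
    {R : ℝ} {z : ℂ} (hz : ‖z‖ ≤ R) :
    ‖volterraIter x₀ r w c n b x z‖ ≤
      C R * (((1 + R) * |∫ s in x₀..x, β s|) ^ n / n.factorial) := by
  have hR : 0 ≤ R := (norm_nonneg z).trans hz
  induction n generalizing b x with
  | zero => simpa [volterraIter] using H.c_le b x hx R z hz
  | succ n ih =>
    have hC := H.C_nonneg hx hR
    rw [volterraIter, ← intervalIntegral.integral_const_mul]
    have hle : ∀ᵐ t ∂volume.restrict (uIoc x₀ x),
        ‖r b x * ((r b t)⁻¹ * w b t z * volterraIter x₀ r w c n (!b) t z)‖ ≤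
        C R * ((1 + R) ^ (n + 1) / n.factorial) * (β t * |∫ s in x₀..t, β s| ^ n) := by
      filter_upwards [ae_restrict_mem measurableSet_uIoc] with t ht
      rw [norm_mul, norm_mul]
      have h1 := H.norm_kernel_le b hz hx ht
      have h2 := ih (!b) (H.sub x hx ht)
      have h3 : 0 < ‖r b x‖ := norm_pos_iff.2 (H.r_ne b x hx)
      calc ‖r b x‖ * (‖(r b t)⁻¹ * w b t z‖ * ‖volterraIter x₀ r w c n (!b) t z‖)
          ≤ ‖r b x‖ * ((‖r b x‖⁻¹ * ((1 + R) * β t)) *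
            (C R * (((1 + R) * |∫ s in x₀..t, β s|) ^ n / n.factorial))) := by
            have := H.β_nonneg t
            gcongr
        _ = _ := by
            rw [mul_pow, pow_succ]
            field_simp
    refine (intervalIntegral.norm_integral_le_abs_of_norm_le hle ?_).trans (le_of_eq ?_)
    · refine IntervalIntegrable.const_mul ?_ _
      refine (H.β_int x hx).mul_continuousOn (ContinuousOn.pow (ContinuousOn.abs ?_) n)
      exact intervalIntegral.continuousOn_primitive_interval' (H.β_int x hx) left_mem_uIcc
    · rw [intervalIntegral.integral_const_mul, abs_mul,
        abs_integral_mul_abs_primitive_pow H.β_nonneg (H.β_int x hx), abs_of_nonneg (by positivity),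
        Nat.factorial_succ, mul_pow]
      push_cast
      field_simp

/-- Freezing the bound at the far endpoint makes it uniform in `t`, as needed for uniform
convergence in `t` and for dominated convergence. -/
theorem norm_iter_le' (H : IsVolterra x₀ D β r w c C) (n : ℕ) (b : Bool) {x t : ℝ} (hx : x ∈ D)
    (htD : t ∈ D) (ht : t ∈ uIcc x₀ x) {R : ℝ} {z : ℂ} (hz : ‖z‖ ≤ R) :
    ‖volterraIter x₀ r w c n b t z‖ ≤
      C R * (((1 + R) * |∫ s in x₀..x, β s|) ^ n / n.factorial) := by
  have hR : 0 ≤ R := (norm_nonneg z).trans hz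
  refine (H.norm_iter_le n b htD hz).trans ?_
  have := H.C_nonneg hx hR
  have := abs_integral_le_of_mem_uIoc H.β_nonneg (H.β_int x hx) ht
  gcongr

/-- The base point need not belong to `D` (for the regular solution it is `0`), so continuity at `x`
is taken from an interval between `x₀` and a farther point of `D`. -/
theorem continuousOn_of_primitive (H : IsVolterra x₀ D β r w c C) {g : ℝ → ℂ}
    (hg : ∀ x ∈ D, IntervalIntegrable g volume x₀ x) :
    ContinuousOn (fun x => ∫ t in x₀..x, g t) D := by
  intro x hx
  obtain ⟨X, hX, hn⟩ := H.nhds x hx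
  have h1 := intervalIntegral.continuousOn_primitive_interval' (hg X hX) left_mem_uIcc
  exact (h1 x (mem_of_mem_nhdsWithin hx hn)).mono_of_mem_nhdsWithin hn

theorem continuousOn_iter (H : IsVolterra x₀ D β r w c C) (n : ℕ) (b : Bool) (z : ℂ) :
    ContinuousOn (fun x => volterraIter x₀ r w c n b x z) D := by
  induction n generalizing b with
  | zero => exact H.c_cont b z
  | succ n ih =>
    refine (H.r_cont b).mul (H.continuousOn_of_primitive fun x hx => ?_)
    exact H.intervalIntegrable b z hx (ih (!b)) fun t ht =>
      H.norm_iter_le' n (!b) hx (H.sub x hx ht) (uIoc_subset_uIcc ht) le_rfl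

theorem differentiable_iter (H : IsVolterra x₀ D β r w c C) (n : ℕ) (b : Bool) {x : ℝ}
    (hx : x ∈ D) : Differentiable ℂ (volterraIter x₀ r w c n b x) := by
  induction n generalizing b x with
  | zero => exact H.c_diff b x
  | succ n ih =>
    change Differentiable ℂ (fun z => r b x * ∫ t in x₀..x, (r b t)⁻¹ * w b t z *
      volterraIter x₀ r w c n (!b) t z)
    refine Differentiable.const_mul ?_ _
    simp only [intervalIntegral.intervalIntegral_eq_integral_uIoc]
    refine Differentiable.const_smul ?_ _
    rw [← differentiableOn_univ]
    refine differentiableOn_integral_of_dominated isOpen_univ (fun z _ =>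
      H.aestronglyMeasurable b z hx (H.continuousOn_iter n (!b) z)) ?_ fun z₀ _ => ?_
    · filter_upwards [ae_restrict_mem measurableSet_uIoc] with t ht
      exact (((H.w_diff b t).const_mul _).mul (ih (!b) (H.sub x hx ht))).differentiableOn
    · refine ⟨Metric.ball z₀ 1, Metric.ball_mem_nhds _ one_pos, fun t => ‖r b x‖⁻¹ *
        ((1 + (‖z₀‖ + 1)) * β t) * (C (‖z₀‖ + 1) * (((1 + (‖z₀‖ + 1)) * |∫ s in x₀..x, β s|) ^ n /
          n.factorial)), ?_, ?_⟩
      · exact ((((H.β_int x hx).def'.const_mul _).const_mul _).mul_const _)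
      · filter_upwards [ae_restrict_mem measurableSet_uIoc] with t ht z hz
        have hz' : ‖z‖ ≤ ‖z₀‖ + 1 := by
          rw [Metric.mem_ball, dist_eq_norm] at hz
          linarith [norm_le_norm_add_norm_sub z₀ z, norm_sub_rev z z₀]
        rw [norm_mul]
        exact mul_le_mul (H.norm_kernel_le b hz' hx ht)
          (H.norm_iter_le' n (!b) hx (H.sub x hx ht) (uIoc_subset_uIcc ht) hz') (norm_nonneg _)
          (mul_nonneg (by positivity) (mul_nonneg (by positivity) (H.β_nonneg t)))

theorem summable_bound (A E : ℝ) : Summable fun n : ℕ => A * (E ^ n / n.factorial) :=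
  (Real.summable_pow_div_factorial E).mul_left A

theorem hasSum_sol (H : IsVolterra x₀ D β r w c C) (b : Bool) {x : ℝ} (hx : x ∈ D) (z : ℂ) :
    HasSum (fun n => volterraIter x₀ r w c n b x z) (volterraSol x₀ r w c b x z) :=
  (Summable.of_norm_bounded (summable_bound _ _) fun n => H.norm_iter_le n b hx le_rfl).hasSum

theorem norm_sol_le (H : IsVolterra x₀ D β r w c C) (b : Bool) {x : ℝ} (hx : x ∈ D)
    {R : ℝ} {z : ℂ} (hz : ‖z‖ ≤ R) :
    ‖volterraSol x₀ r w c b x z‖ ≤ C R * Real.exp ((1 + R) * |∫ s in x₀..x, β s|) := by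
  refine tsum_of_norm_bounded ?_ fun n => H.norm_iter_le n b hx hz
  refine HasSum.mul_left _ ?_
  rw [Real.exp_eq_exp_ℝ]
  exact NormedSpace.expSeries_div_hasSum_exp _

theorem continuousOn_sol (H : IsVolterra x₀ D β r w c C) (b : Bool) (z : ℂ) :
    ContinuousOn (fun x => volterraSol x₀ r w c b x z) D := by
  intro x hx
  obtain ⟨X, hX, hn⟩ := H.nhds x hx
  have h1 : ContinuousOn (fun x => volterraSol x₀ r w c b x z) (D ∩ uIcc x₀ X) := by
    refine continuousOn_tsum (u := fun n : ℕ => C ‖z‖ * (((1 + ‖z‖) *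
      |∫ s in x₀..X, β s|) ^ n / n.factorial)) (fun n => (H.continuousOn_iter n b z).mono
      inter_subset_left) (summable_bound _ _) fun n t ht =>
      H.norm_iter_le' n b hX ht.1 ht.2 le_rfl
  exact (h1 x ⟨hx, mem_of_mem_nhdsWithin hx hn⟩).mono_of_mem_nhdsWithin
    (inter_mem self_mem_nhdsWithin hn)

theorem differentiable_sol (H : IsVolterra x₀ D β r w c C) (b : Bool) {x : ℝ} (hx : x ∈ D) :
    Differentiable ℂ (volterraSol x₀ r w c b x) := by
  intro z₀
  have h1 : DifferentiableOn ℂ (volterraSol x₀ r w c b x) (Metric.ball 0 (‖z₀‖ + 1)) := by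
    refine Complex.differentiableOn_tsum_of_summable_norm (u := fun n : ℕ => C (‖z₀‖ + 1) *
      (((1 + (‖z₀‖ + 1)) * |∫ s in x₀..x, β s|) ^ n / n.factorial)) (summable_bound _ _)
      (fun n => (H.differentiable_iter n b hx).differentiableOn) Metric.isOpen_ball
      fun n z hz => H.norm_iter_le n b hx ?_
    rw [mem_ball_zero_iff] at hz
    exact hz.le
  exact h1.differentiableAt (Metric.isOpen_ball.mem_nhds (by simp))

theorem sol_intervalIntegrable (H : IsVolterra x₀ D β r w c C) (b : Bool) (z : ℂ) {x : ℝ}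
    (hx : x ∈ D) : IntervalIntegrable (fun t => (r b t)⁻¹ * w b t z *
      volterraSol x₀ r w c (!b) t z) volume x₀ x := by
  refine H.intervalIntegrable b z hx (H.continuousOn_sol (!b) z) (M := C ‖z‖ *
    Real.exp ((1 + ‖z‖) * |∫ s in x₀..x, β s|)) fun t ht => ?_
  refine (H.norm_sol_le (!b) (H.sub x hx ht) le_rfl).trans ?_
  have := H.C_nonneg hx (norm_nonneg z)
  have := abs_integral_le_of_mem_uIoc H.β_nonneg (H.β_int x hx) (uIoc_subset_uIcc ht)
  gcongr

/-- Summing the recursion over `n`: the series may be integrated term by term by dominated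
convergence, and the shift of the index leaves the zeroth term `c`. -/
theorem sol_eq (H : IsVolterra x₀ D β r w c C) (b : Bool) (z : ℂ) {x : ℝ} (hx : x ∈ D) :
    volterraSol x₀ r w c b x z = c b x z +
      r b x * ∫ t in x₀..x, (r b t)⁻¹ * w b t z * volterraSol x₀ r w c (!b) t z := by
  have h1 := H.hasSum_sol b hx z
  have hb : ∀ n t, t ∈ uIoc x₀ x → ‖(r b t)⁻¹ * w b t z * volterraIter x₀ r w c n (!b) t z‖ ≤
      ‖r b x‖⁻¹ * ((1 + ‖z‖) * β t) *
        (C ‖z‖ * (((1 + ‖z‖) * |∫ s in x₀..x, β s|) ^ n / n.factorial)) := by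
    intro n t ht
    rw [norm_mul]
    exact mul_le_mul (H.norm_kernel_le b le_rfl hx ht)
      (H.norm_iter_le' n (!b) hx (H.sub x hx ht) (uIoc_subset_uIcc ht) le_rfl) (norm_nonneg _)
      (mul_nonneg (by positivity) (mul_nonneg (by positivity) (H.β_nonneg t)))
  have h2 := intervalIntegral.hasSum_integral_of_dominated_convergence (μ := volume) (a := x₀)
    (b := x) (F := fun n t => (r b t)⁻¹ * w b t z * volterraIter x₀ r w c n (!b) t z)
    (f := fun t => (r b t)⁻¹ * w b t z * volterraSol x₀ r w c (!b) t z)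
    (bound := fun n t => ‖r b x‖⁻¹ * ((1 + ‖z‖) * β t) *
        (C ‖z‖ * (((1 + ‖z‖) * |∫ s in x₀..x, β s|) ^ n / n.factorial)))
    (fun n => H.aestronglyMeasurable b z hx (H.continuousOn_iter n (!b) z))
    (fun n => Eventually.of_forall (hb n))
    (Eventually.of_forall fun t _ => (summable_bound _ _).mul_left _)
    (by
      simp only [tsum_mul_left]
      exact (((H.β_int x hx).const_mul _).const_mul _).mul_const _)
    (Eventually.of_forall fun t ht => (H.hasSum_sol (!b) (H.sub x hx ht) z).mul_left _)
  have h3 := (hasSum_nat_add_iff' 1).2 h1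
  have h4 := h3.unique (h2.mul_left (r b x))
  rw [Finset.sum_range_one] at h4
  rw [← h4]
  change _ = c b x z + (_ - c b x z)
  ring

/-- Real data give real iterates. Ultimately this makes the Jost function real on the gap, where
sign arguments are used. -/
theorem conj_iter {z : ℂ} (hr : ∀ b t, starRingEnd ℂ (r b t) = r b t)
    (hw : ∀ b t, starRingEnd ℂ (w b t z) = w b t z) (hc : ∀ b t, starRingEnd ℂ (c b t z) = c b t z)
    (n : ℕ) (b : Bool) (x : ℝ) :
    starRingEnd ℂ (volterraIter x₀ r w c n b x z) = volterraIter x₀ r w c n b x z := by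
  induction n generalizing b x with
  | zero => exact hc b x
  | succ n ih =>
    rw [volterraIter, map_mul, hr, intervalIntegral.intervalIntegral_eq_integral_uIoc]
    congr 1
    rw [Complex.real_smul, map_mul, Complex.conj_ofReal, ← integral_conj]
    congr 2
    funext t
    rw [map_mul, map_mul, map_inv₀, hr, hw, ih]

theorem conj_sol {z : ℂ} (hr : ∀ b t, starRingEnd ℂ (r b t) = r b t)
    (hw : ∀ b t, starRingEnd ℂ (w b t z) = w b t z) (hc : ∀ b t, starRingEnd ℂ (c b t z) = c b t z)
    (b : Bool) (x : ℝ) :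
    starRingEnd ℂ (volterraSol x₀ r w c b x z) = volterraSol x₀ r w c b x z := by
  rw [volterraSol, Complex.conj_tsum]
  exact tsum_congr fun n => conj_iter hr hw hc n b x

end IsVolterra

/-! ### Coefficients of the Dirac system and its integral form -/

namespace RadialDirac

/-- The off-diagonal coefficients `m - v + z` and `m + v - z` of the Dirac system. -/
noncomputable def weight (m : ℝ) (v : ℝ → ℝ) : Bool → ℝ → ℂ → ℂ
  | true, t, z => (m - v t : ℝ) + z
  | false, t, z => (m + v t : ℝ) - z

/-- The dominating function of the coefficients. -/
noncomputable def weightBound (m : ℝ) (v : ℝ → ℝ) (t : ℝ) : ℝ := 1 + |m| + |v t|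

section

variable {m : ℝ} {κ : ℕ} {v : ℝ → ℝ} {γ : ℝ} {z : ℂ}

theorem weightBound_pos (t : ℝ) : 0 < weightBound m v t := by
  unfold weightBound; positivity

theorem norm_weight_le (b : Bool) (t : ℝ) (z : ℂ) :
    ‖weight m v b t z‖ ≤ (1 + ‖z‖) * weightBound m v t := by
  have h : |m| + |v t| + ‖z‖ ≤ (1 + ‖z‖) * weightBound m v t := by
    unfold weightBound
    nlinarith [abs_nonneg m, abs_nonneg (v t), norm_nonneg z,
      mul_nonneg (norm_nonneg z) (abs_nonneg m), mul_nonneg (norm_nonneg z) (abs_nonneg (v t))]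
  refine le_trans ?_ h
  cases b
  · refine (norm_sub_le _ _).trans ?_
    rw [Complex.norm_real]
    gcongr
    exact abs_add_le _ _
  · refine (norm_add_le _ _).trans ?_
    rw [Complex.norm_real]
    gcongr
    exact abs_sub _ _

theorem differentiable_weight (b : Bool) (t : ℝ) : Differentiable ℂ (weight m v b t) := by
  cases b
  · exact (differentiable_const _).sub differentiable_id
  · exact (differentiable_const _).add differentiable_id

theorem conj_weight {z : ℂ} (hz : starRingEnd ℂ z = z) (b : Bool) (t : ℝ) :
    starRingEnd ℂ (weight m v b t z) = weight m v b t z := by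
  cases b
  · rw [weight, map_sub, hz, Complex.conj_ofReal]
  · rw [weight, map_add, hz, Complex.conj_ofReal]

theorem intervalIntegrable_of_integrableOn_Ioc {E : Type*} [NormedAddCommGroup E] {g : ℝ → E}
    (hg : ∀ X, IntegrableOn g (Ioc 0 X)) {a b : ℝ} (ha : 0 ≤ a) (hb : 0 ≤ b) :
    IntervalIntegrable g volume a b := by
  rw [intervalIntegrable_iff]
  refine (hg (max a b)).mono_set ?_
  rw [uIoc]
  exact Ioc_subset_Ioc_left (le_min ha hb)

theorem intervalIntegrable_weightBound (hv : ∀ X, IntegrableOn v (Ioc 0 X)) {a b : ℝ}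
    (ha : 0 ≤ a) (hb : 0 ≤ b) : IntervalIntegrable (weightBound m v) volume a b := by
  have := (intervalIntegrable_of_integrableOn_Ioc hv ha hb).abs
  exact (intervalIntegrable_const (c := 1 + |m|)).add this

theorem aestronglyMeasurable_weight (hv : ∀ X, IntegrableOn v (Ioc 0 X)) (b : Bool) (z : ℂ)
    {a c : ℝ} (ha : 0 ≤ a) (hc : 0 ≤ c) :
    AEStronglyMeasurable (fun t => weight m v b t z) (volume.restrict (uIoc a c)) := by
  have h1 : AEStronglyMeasurable v (volume.restrict (uIoc a c)) :=
    (intervalIntegrable_iff.1 (intervalIntegrable_of_integrableOn_Ioc hv ha hc)).aestronglyMeasurable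
  cases b
  · exact (Complex.continuous_ofReal.comp_aestronglyMeasurable
      (aestronglyMeasurable_const.add h1)).sub aestronglyMeasurable_const
  · exact (Complex.continuous_ofReal.comp_aestronglyMeasurable
      (aestronglyMeasurable_const.sub h1)).add aestronglyMeasurable_const

theorem intervalIntegrable_weight_mul (hv : ∀ X, IntegrableOn v (Ioc 0 X)) (b : Bool) (z : ℂ)
    {y : ℝ → ℂ} (hy : ContinuousOn y (Ioi 0)) {a c : ℝ} (ha : 0 < a) (hc : 0 < c) :
    IntervalIntegrable (fun t => weight m v b t z * y t) volume a c := by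
  refine IntervalIntegrable.mul_continuousOn ?_ (hy.mono (uIcc_subset_Ioi ha hc))
  refine IntervalIntegrable.mono_fun' ((intervalIntegrable_weightBound (m := m) hv ha.le
    hc.le).const_mul (1 + ‖z‖)) (aestronglyMeasurable_weight hv b z ha.le hc.le) ?_
  exact Eventually.of_forall fun t => norm_weight_le b t z

theorem absolutelyContinuousOnInterval_primitive {g : ℝ → ℂ} {x₀ : ℝ} (hx₀ : 0 < x₀)
    (hg : ∀ a b, 0 < a → 0 < b → IntervalIntegrable g volume a b) {a b : ℝ} (ha : 0 < a)
    (hb : 0 < b) : AbsolutelyContinuousOnInterval (fun x => ∫ t in x₀..x, g t) a b := by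
  have h1 := (hg (min (min a b) x₀) (max (max a b) x₀) (lt_min (lt_min ha hb) hx₀)
    (lt_max_of_lt_right hx₀)).complex_absolutelyContinuousOnInterval (c := x₀)
    (by rw [uIcc_of_le (by simp)]; simp)
  refine h1.mono ?_
  have hle : min (min a b) x₀ ≤ max (max a b) x₀ := by simp
  rw [uIcc_of_le hle, uIcc]
  exact Icc_subset_Icc (min_le_left _ _) (le_max_left _ _)

theorem ae_hasDerivAt_primitive {g : ℝ → ℂ} {x₀ : ℝ} (hx₀ : 0 < x₀)
    (hg : ∀ a b, 0 < a → 0 < b → IntervalIntegrable g volume a b) :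
    ∀ᵐ x : ℝ, 0 < x → HasDerivAt (fun x => ∫ t in x₀..x, g t) (g x) x := by
  refine ae_pos_of_forall_ae_Icc fun a b ha hb => ?_
  filter_upwards [(hg (min (min a b) x₀) (max (max a b) x₀) (lt_min (lt_min ha hb) hx₀)
    (lt_max_of_lt_right hx₀)).ae_hasDerivAt_integral] with x hx hm
  have hle : min (min a b) x₀ ≤ max (max a b) x₀ := by simp
  rw [uIcc_of_le hle] at hx
  exact hx ⟨(min_le_left _ _).trans hm.1, hm.2.trans (le_max_left _ _)⟩ x₀ ⟨by simp, by simp⟩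

/-- Solutions of the Dirac system from the integral equations. -/
theorem IsSol.of_integral (hv : ∀ X, IntegrableOn v (Ioc 0 X)) {f₁ f₂ : ℝ → ℂ}
    (hc1 : ContinuousOn f₁ (Ioi 0)) (hc2 : ContinuousOn f₂ (Ioi 0)) {x₀ : ℝ} (hx₀ : 0 < x₀)
    {A₁ A₂ : ℂ}
    (h1 : ∀ x > 0, f₁ x = (x : ℂ) ^ (-κ : ℤ) *
      (A₁ + ∫ t in x₀..x, weight m v true t z * ((t : ℂ) ^ (κ : ℤ) * f₂ t)))
    (h2 : ∀ x > 0, f₂ x = (x : ℂ) ^ (κ : ℤ) *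
      (A₂ + ∫ t in x₀..x, weight m v false t z * ((t : ℂ) ^ (-κ : ℤ) * f₁ t))) :
    IsSol m κ v z 0 0 f₁ f₂ := by
  have i1 : ∀ a b : ℝ, 0 < a → 0 < b → IntervalIntegrable (fun t => weight m v true t z *
      ((t : ℂ) ^ (κ : ℤ) * f₂ t)) volume a b := fun a b ha hb =>
    intervalIntegrable_weight_mul hv true z ((continuousOn_ofReal_zpow κ).mul hc2) ha hb
  have i2 : ∀ a b : ℝ, 0 < a → 0 < b → IntervalIntegrable (fun t => weight m v false t z *
      ((t : ℂ) ^ (-κ : ℤ) * f₁ t)) volume a b := fun a b ha hb =>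
    intervalIntegrable_weight_mul hv false z ((continuousOn_ofReal_zpow (-κ)).mul hc1) ha hb
  have cst : ∀ (A : ℂ) (a b : ℝ), AbsolutelyContinuousOnInterval (fun _ : ℝ => A) a b :=
    fun A a b => (LipschitzWith.const A).lipschitzOnWith.absolutelyContinuousOnInterval
  refine ⟨fun a b ha hb => ?_, fun a b ha hb => ?_, ?_, ?_⟩
  · exact ((absolutelyContinuousOnInterval_ofReal_zpow (-κ) ha hb).complex_mul
      ((cst A₁ a b).add (absolutelyContinuousOnInterval_primitive hx₀ i1 ha hb))).congr
      fun x hx => (h1 x (uIcc_subset_Ioi ha hb hx)).symm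
  · exact ((absolutelyContinuousOnInterval_ofReal_zpow κ ha hb).complex_mul
      ((cst A₂ a b).add (absolutelyContinuousOnInterval_primitive hx₀ i2 ha hb))).congr
      fun x hx => (h2 x (uIcc_subset_Ioi ha hb hx)).symm
  · filter_upwards [ae_hasDerivAt_primitive hx₀ i1] with x hx h0
    have hx0 : (x : ℂ) ≠ 0 := by exact_mod_cast h0.ne'
    have hd := (hasDerivAt_ofReal_zpow (-κ) h0).mul ((hx h0).const_add A₁)
    have he : f₁ =ᶠ[𝓝 x] _ := (eventually_gt_nhds h0).mono h1
    refine (hd.congr_of_eventuallyEq he).congr_deriv ?_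
    rw [h1 x h0]
    generalize (∫ t in x₀..x, _ : ℂ) = J
    simp only [weight, zpow_neg, zpow_natCast, Pi.zero_apply]
    push_cast
    field_simp
    ring
  · filter_upwards [ae_hasDerivAt_primitive hx₀ i2] with x hx h0
    have hx0 : (x : ℂ) ≠ 0 := by exact_mod_cast h0.ne'
    have hd := (hasDerivAt_ofReal_zpow κ h0).mul ((hx h0).const_add A₂)
    have he : f₂ =ᶠ[𝓝 x] _ := (eventually_gt_nhds h0).mono h2
    refine (hd.congr_of_eventuallyEq he).congr_deriv ?_
    rw [h2 x h0]
    generalize (∫ t in x₀..x, _ : ℂ) = J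
    simp only [weight, zpow_neg, zpow_natCast, Pi.zero_apply]
    push_cast
    field_simp
    ring

/-! ### The solution regular at the origin -/

/-- The ratios in the Volterra system of the regular solution. -/
noncomputable def regRatio (κ : ℕ) : Bool → ℝ → ℂ
  | true, x => (x : ℂ) ^ (-(2 * κ) : ℤ)
  | false, _ => 1

/-- The free term in the Volterra system of the regular solution. -/
noncomputable def regInit : Bool → ℝ → ℂ → ℂ
  | true, _, _ => 0
  | false, _, _ => 1

/-- Writing `f = x^κ y`, the integral equations become `y₁ = x^{-2κ} ∫ t^{2κ} (m - v + z) y₂` and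
`y₂ = 1 + ∫ (m + v - z) y₁`, both over `(0, x)`. The ratio `x^{-2κ}` is singular at `0` but
decreases away from it, which is all the scheme requires. -/
theorem isVolterra_reg (hv : ∀ X, IntegrableOn v (Ioc 0 X)) :
    IsVolterra 0 (Ioi 0) (weightBound m v) (regRatio κ) (weight m v) regInit (fun _ => 1) where
  sub x hx := by
    rw [uIoc_of_le (le_of_lt hx)]
    exact Ioc_subset_Ioi_self
  nhds x hx := by
    have hx : 0 < x := hx
    refine ⟨x + 1, by simp only [mem_Ioi]; linarith, mem_nhdsWithin_of_mem_nhds ?_⟩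
    rw [uIcc_of_le (by linarith)]
    exact Icc_mem_nhds hx (by linarith)
  β_nonneg t := (weightBound_pos t).le
  β_int x hx := intervalIntegrable_weightBound hv le_rfl (le_of_lt hx)
  r_cont b := by
    cases b
    · exact continuousOn_const
    · exact continuousOn_ofReal_zpow _
  r_ne b x hx := by
    cases b
    · exact one_ne_zero
    · exact zpow_ne_zero _ (by exact_mod_cast (ne_of_gt hx))
  r_le b x hx t ht := by
    cases b
    · exact le_rfl
    · rw [uIoc_of_le (le_of_lt hx)] at ht
      simp only [regRatio]
      rw [norm_zpow, norm_zpow, Complex.norm_real, Complex.norm_real, Real.norm_of_nonneg ht.1.le,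
        Real.norm_of_nonneg (le_of_lt hx), zpow_neg, zpow_neg]
      refine inv_anti₀ (zpow_pos ht.1 _) ?_
      exact zpow_le_zpow_left₀ (by positivity) ht.1.le ht.2
  w_le := norm_weight_le
  w_meas b z x hx := aestronglyMeasurable_weight hv b z le_rfl (le_of_lt hx)
  w_diff := differentiable_weight
  c_cont b z := by cases b <;> exact continuousOn_const
  c_diff b x := by cases b <;> exact differentiable_const _
  c_le b x _ R z _ := by cases b <;> simp [regInit]

/-- The solution regular at the origin, `φ ~ x^κ (0, 1)`; the Boolean `true` selects the first
component. -/
noncomputable def phi (m : ℝ) (κ : ℕ) (v : ℝ → ℝ) (b : Bool) (x : ℝ) (z : ℂ) : ℂ :=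
  (x : ℂ) ^ (κ : ℤ) * volterraSol 0 (regRatio κ) (weight m v) regInit b x z

theorem holFamily_phi (hv : ∀ X, IntegrableOn v (Ioc 0 X)) (b : Bool) :
    HolFamily univ (phi m κ v b) := by
  have H := isVolterra_reg (m := m) (κ := κ) hv
  refine HolFamily.mul (HolFamily.of_continuous (continuousOn_ofReal_zpow _)) ⟨fun z _ =>
    H.continuousOn_sol b z, fun x hx => (H.differentiable_sol b hx).differentiableOn,
    fun z₀ _ a c ha => ?_⟩
  refine ⟨1 * Real.exp ((1 + (‖z₀‖ + 1)) * |∫ s in (0:ℝ)..c, weightBound m v s|),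
    Metric.ball z₀ 1, Metric.ball_mem_nhds _ one_pos, fun x hx z hz => ?_⟩
  have hz' : ‖z‖ ≤ ‖z₀‖ + 1 := by
    rw [Metric.mem_ball, dist_eq_norm] at hz
    linarith [norm_le_norm_add_norm_sub z₀ z, norm_sub_rev z z₀]
  have hx0 : 0 < x := ha.trans_le hx.1
  refine (H.norm_sol_le b hx0 hz').trans ?_
  have := abs_integral_le_of_mem_uIoc H.β_nonneg (H.β_int c (hx0.trans_le hx.2))
    (t := x) (by rw [uIcc_of_le (hx0.le.trans hx.2)]; exact ⟨hx0.le, hx.2⟩)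
  gcongr

theorem isSol_phi (hv : ∀ X, IntegrableOn v (Ioc 0 X)) (z : ℂ) :
    IsSol m κ v z 0 0 (fun x => phi m κ v true x z) (fun x => phi m κ v false x z) := by
  have H := isVolterra_reg (m := m) (κ := κ) hv
  -- `IsSol.of_integral` needs a positive base point, so it is moved from `0` to `1`; the constants
  -- `A₁`, `A₂` collect the contribution of `(0, 1)` and the free term.
  refine IsSol.of_integral hv ((holFamily_phi hv true).cont z trivial)
    ((holFamily_phi hv false).cont z trivial) one_pos
    (A₁ := ∫ t in (0 : ℝ)..1, (regRatio κ true t)⁻¹ * weight m v true t z *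
      volterraSol 0 (regRatio κ) (weight m v) regInit false t z)
    (A₂ := 1 + ∫ t in (0 : ℝ)..1, (regRatio κ false t)⁻¹ * weight m v false t z *
      volterraSol 0 (regRatio κ) (weight m v) regInit true t z) (fun x hx => ?_) fun x hx => ?_
  · have hx0 : (x : ℂ) ≠ 0 := by exact_mod_cast hx.ne'
    have e : ∫ t in (1 : ℝ)..x, weight m v true t z * ((t : ℂ) ^ (κ : ℤ) * phi m κ v false t z) =
        ∫ t in (1 : ℝ)..x, (regRatio κ true t)⁻¹ * weight m v true t z *
          volterraSol 0 (regRatio κ) (weight m v) regInit false t z := by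
      refine intervalIntegral.integral_congr fun t ht => ?_
      have ht0 : (t : ℂ) ≠ 0 := by exact_mod_cast (ne_of_gt (uIcc_subset_Ioi one_pos hx ht))
      simp only [phi, regRatio]
      rw [zpow_neg, inv_inv, two_mul, zpow_add₀ ht0]
      ring
    have ha := intervalIntegral.integral_add_adjacent_intervals
      (H.sol_intervalIntegrable true z (x := 1) (by simp))
      ((H.sol_intervalIntegrable true z (x := 1) (by simp)).symm.trans
        (H.sol_intervalIntegrable true z (x := x) hx))
    simp only [Bool.not_true] at ha
    rw [e, ha, phi, H.sol_eq true z hx]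
    simp only [regInit, regRatio, Bool.not_true, zero_add]
    rw [← mul_assoc, ← zpow_add₀ hx0]
    congr 2
    ring
  · have e : ∫ t in (1 : ℝ)..x, weight m v false t z * ((t : ℂ) ^ (-κ : ℤ) * phi m κ v true t z) =
        ∫ t in (1 : ℝ)..x, (regRatio κ false t)⁻¹ * weight m v false t z *
          volterraSol 0 (regRatio κ) (weight m v) regInit true t z := by
      refine intervalIntegral.integral_congr fun t ht => ?_
      have ht0 : (t : ℂ) ≠ 0 := by exact_mod_cast (ne_of_gt (uIcc_subset_Ioi one_pos hx ht))
      simp only [phi, regRatio]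
      rw [← mul_assoc ((t : ℂ) ^ (-κ : ℤ)), ← zpow_add₀ ht0]
      simp
    have ha := intervalIntegral.integral_add_adjacent_intervals
      (H.sol_intervalIntegrable false z (x := 1) (by simp))
      ((H.sol_intervalIntegrable false z (x := 1) (by simp)).symm.trans
        (H.sol_intervalIntegrable false z (x := x) hx))
    simp only [Bool.not_false] at ha
    rw [e, add_assoc, ha, phi, H.sol_eq false z hx]
    simp [regInit, regRatio]

theorem conj_phi {z : ℂ} (hz : starRingEnd ℂ z = z) (b : Bool) (x : ℝ) :
    starRingEnd ℂ (phi m κ v b x z) = phi m κ v b x z := by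
  rw [phi, map_mul, map_zpow₀, Complex.conj_ofReal, IsVolterra.conj_sol]
  · intro b t
    cases b <;> simp [regRatio]
  · exact conj_weight hz
  · intro b t
    cases b <;> simp [regInit]

theorem exists_norm_phi_le (hv : ∀ X, IntegrableOn v (Ioc 0 X)) (z : ℂ) :
    ∃ C, ∀ b, ∀ x ∈ Ioc (0 : ℝ) 1, ‖phi m κ v b x z‖ ≤ C * x ^ κ := by
  have H := isVolterra_reg (m := m) (κ := κ) hv
  refine ⟨1 * Real.exp ((1 + ‖z‖) * |∫ s in (0 : ℝ)..1, weightBound m v s|), fun b x hx => ?_⟩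
  rw [phi, norm_mul, mul_comm, zpow_natCast, norm_pow, Complex.norm_real,
    Real.norm_of_nonneg hx.1.le]
  refine mul_le_mul_of_nonneg_right ((H.norm_sol_le b hx.1 le_rfl).trans ?_)
    (pow_nonneg hx.1.le _)
  have := abs_integral_le_of_mem_uIoc H.β_nonneg (H.β_int 1 (by simp))
    (t := x) (by rw [uIcc_of_le zero_le_one]; exact ⟨hx.1.le, hx.2⟩)
  gcongr

/-- The factor `x^κ` with `κ ≥ 1` forces both components to vanish at the origin, so `phi` meets the
boundary condition. -/
theorem tendsto_phi (hv : ∀ X, IntegrableOn v (Ioc 0 X)) (hκ : 1 ≤ κ) (z : ℂ) (b : Bool) :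
    Tendsto (fun x => phi m κ v b x z) (𝓝[>] 0) (𝓝 0) := by
  obtain ⟨C, hC⟩ := exists_norm_phi_le (m := m) (κ := κ) hv z
  have h1 : Tendsto (fun x : ℝ => C * x ^ κ) (𝓝[>] 0) (𝓝 0) := by
    have : Tendsto (fun x : ℝ => C * x ^ κ) (𝓝 0) (𝓝 (C * 0 ^ κ)) :=
      (continuous_const.mul (continuous_pow κ)).tendsto 0
    rw [zero_pow (by omega), mul_zero] at this
    exact this.mono_left nhdsWithin_le_nhds
  refine squeeze_zero_norm' ?_ h1
  filter_upwards [Ioc_mem_nhdsGT zero_lt_one] with x hx using hC b x hx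

/-- The regular solution does not vanish identically. -/
theorem exists_phi_ne_zero (hv : ∀ X, IntegrableOn v (Ioc 0 X)) (z : ℂ) :
    ∃ x > 0, phi m κ v false x z ≠ 0 := by
  have H := isVolterra_reg (m := m) (κ := κ) hv
  by_contra! hne
  -- If the second component vanished, the first equation would make the first component vanish too,
  -- and then the second equation would read `0 = 1`.
  have h0 : ∀ x > 0, volterraSol 0 (regRatio κ) (weight m v) regInit false x z = 0 := by
    intro x hx
    have hx0 : (x : ℂ) ≠ 0 := by exact_mod_cast hx.ne'
    exact (mul_eq_zero.1 (hne x hx)).resolve_left (zpow_ne_zero _ hx0)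
  have h1 : ∀ x > 0, volterraSol 0 (regRatio κ) (weight m v) regInit true x z = 0 := by
    intro x hx
    rw [H.sol_eq true z hx]
    have : ∫ t in (0 : ℝ)..x, (regRatio κ true t)⁻¹ * weight m v true t z *
        volterraSol 0 (regRatio κ) (weight m v) regInit (!true) t z = ∫ t in (0 : ℝ)..x, 0 := by
      refine intervalIntegral.integral_congr_ae (Eventually.of_forall fun t ht => ?_)
      rw [uIoc_of_le hx.le] at ht
      rw [Bool.not_true, h0 t ht.1, mul_zero]
    rw [this]
    simp [regInit]
  have h2 := H.sol_eq false z (x := 1) (by simp)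
  have : ∫ t in (0 : ℝ)..1, (regRatio κ false t)⁻¹ * weight m v false t z *
      volterraSol 0 (regRatio κ) (weight m v) regInit (!false) t z = ∫ t in (0 : ℝ)..1, 0 := by
    refine intervalIntegral.integral_congr_ae (Eventually.of_forall fun t ht => ?_)
    rw [uIoc_of_le zero_le_one] at ht
    rw [Bool.not_false, h1 t ht.1, mul_zero]
  rw [this, h0 1 one_pos] at h2
  simp [regInit] at h2

end

end RadialDirac

/-! ### Substitutions in holomorphic families -/

theorem HolFamily.comp_left {U : Set ℂ} {f : ℝ → ℂ → ℂ} (hf : HolFamily U f) {ρ : ℝ → ℝ}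
    (hρ : Continuous ρ) (hpos : ∀ x > 0, 0 < ρ x) : HolFamily U (fun x z => f (ρ x) z) where
  cont z hz := (hf.cont z hz).comp hρ.continuousOn fun x hx => hpos x hx
  diff x hx := hf.diff _ (hpos x hx)
  bdd z₀ hz₀ a b ha := by
    rcases le_or_gt a b with hab | hab
    · obtain ⟨p, hp, hmin⟩ := isCompact_Icc.exists_isMinOn (nonempty_Icc.2 hab) hρ.continuousOn
      obtain ⟨q, hq, hmax⟩ := isCompact_Icc.exists_isMaxOn (nonempty_Icc.2 hab) hρ.continuousOn
      obtain ⟨C, V, hV, hC⟩ := hf.bdd z₀ hz₀ (ρ p) (ρ q) (hpos p (ha.trans_le hp.1))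
      exact ⟨C, V, hV, fun x hx => hC _ ⟨hmin hx, hmax hx⟩⟩
    · exact ⟨0, univ, univ_mem, fun x hx => absurd (hx.1.trans hx.2) (not_le.2 hab)⟩

theorem HolFamily.comp_right {U : Set ℂ} {f : ℝ → ℂ → ℂ} (hf : HolFamily univ f) {τ : ℂ → ℂ}
    (hU : IsOpen U) (hτ : DifferentiableOn ℂ τ U) : HolFamily U (fun x z => f x (τ z)) where
  cont z _ := hf.cont (τ z) trivial
  diff x hx := (hf.diff x hx).comp hτ fun _ _ => trivial
  bdd z₀ hz₀ a b ha := by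
    obtain ⟨C, V, hV, hC⟩ := hf.bdd (τ z₀) trivial a b ha
    exact ⟨C, τ ⁻¹' V, (hτ.differentiableAt (hU.mem_nhds hz₀)).continuousAt hV,
      fun x hx z hz => hC x hx _ hz⟩

theorem HolFamily.of_continuous_uncurry {f : ℝ → ℂ → ℂ}
    (hc : Continuous (Function.uncurry f)) (hd : ∀ x, Differentiable ℂ (f x)) :
    HolFamily univ f where
  cont z _ := (hc.comp (by fun_prop : Continuous fun x : ℝ => (x, z))).continuousOn
  diff x _ := (hd x).differentiableOn
  bdd z₀ _ a b _ := by
    obtain ⟨C, hC⟩ := (isCompact_Icc.prod (isCompact_closedBall z₀ 1)).exists_bound_of_continuousOn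
      (s := Icc a b ×ˢ Metric.closedBall z₀ 1) hc.continuousOn
    exact ⟨C, _, Metric.closedBall_mem_nhds z₀ one_pos, fun x hx z hz => hC (x, z) ⟨hx, hz⟩⟩

/-! ### Solutions on `(0, γ]` with prescribed data at `γ` -/

namespace RadialDirac

/-- The ratios in the Volterra system on `(0, γ]`. -/
noncomputable def leftRatio (κ : ℕ) : Bool → ℝ → ℂ
  | true, _ => 1
  | false, x => (x : ℂ) ^ (2 * κ : ℤ)

/-- The free term in the Volterra system on `(0, γ]`. -/
noncomputable def leftInit (κ : ℕ) (A : Bool → ℂ) : Bool → ℝ → ℂ → ℂ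
  | true, _, _ => A true
  | false, x, _ => (x : ℂ) ^ (2 * κ : ℤ) * A false

/-- The initial data at `γ` of the basis of solutions on `(0, γ]`. -/
noncomputable def leftCoef (κ : ℕ) (γ : ℝ) : Bool → Bool → ℂ
  | true, true => (γ : ℂ) ^ (κ : ℤ)
  | false, false => (γ : ℂ) ^ (-κ : ℤ)
  | _, _ => 0

/-- The basis of solutions of the Dirac system on `(0, γ]` with unit data at `γ`, continued by
constants to `(γ, ∞)`. -/
noncomputable def leftSol (m : ℝ) (κ : ℕ) (v : ℝ → ℝ) (γ : ℝ) (i b : Bool) (x : ℝ) (z : ℂ) : ℂ :=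
  ((min x γ : ℝ) : ℂ) ^ (-κ : ℤ) *
    volterraSol γ (leftRatio κ) (weight m v) (leftInit κ (leftCoef κ γ i)) b (min x γ) z

section

variable {m : ℝ} {κ : ℕ} {v : ℝ → ℝ} {γ : ℝ} {z : ℂ}

/-- Now `f = x^{-κ} y`, because a general solution may be singular at the origin; the ratio of the
second equation becomes `x^{2κ}`. Integration runs from `γ` down to `x`, and in this direction
`x^{2κ}` decreases. -/
theorem isVolterra_left (hv : ∀ X, IntegrableOn v (Ioc 0 X)) (A : Bool → ℂ) :
    IsVolterra γ (Ioc 0 γ) (weightBound m v) (leftRatio κ) (weight m v) (leftInit κ A)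
      (fun _ => ‖A true‖ + γ ^ (2 * κ : ℤ) * ‖A false‖) where
  sub x hx := by
    rw [uIoc_of_ge hx.2]
    exact Ioc_subset_Ioc_left hx.1.le
  nhds x hx := by
    refine ⟨x / 2, ⟨by linarith [hx.1], by linarith [hx.1, hx.2]⟩, ?_⟩
    rw [uIcc_of_ge (by linarith [hx.1, hx.2])]
    refine mem_of_superset (inter_mem self_mem_nhdsWithin (mem_nhdsWithin_of_mem_nhds
      (Ioi_mem_nhds (show x / 2 < x by linarith [hx.1])))) fun y hy => ⟨le_of_lt hy.2, hy.1.2⟩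
  β_nonneg t := (weightBound_pos t).le
  β_int x hx := intervalIntegrable_weightBound hv (hx.1.le.trans hx.2) hx.1.le
  r_cont b := by
    cases b
    · exact (continuousOn_ofReal_zpow _).mono fun x hx => hx.1
    · exact continuousOn_const
  r_ne b x hx := by
    cases b
    · exact zpow_ne_zero _ (by exact_mod_cast (ne_of_gt hx.1))
    · exact one_ne_zero
  r_le b x hx t ht := by
    cases b
    · rw [uIoc_of_ge hx.2] at ht
      simp only [leftRatio]
      rw [norm_zpow, norm_zpow, Complex.norm_real, Complex.norm_real,
        Real.norm_of_nonneg (hx.1.le.trans ht.1.le), Real.norm_of_nonneg hx.1.le]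
      exact zpow_le_zpow_left₀ (by positivity) hx.1.le ht.1.le
    · exact le_rfl
  w_le := norm_weight_le
  w_meas b z x hx := aestronglyMeasurable_weight hv b z (hx.1.le.trans hx.2) hx.1.le
  w_diff := differentiable_weight
  c_cont b z := by
    cases b
    · exact ((continuousOn_ofReal_zpow _).mono fun x hx => hx.1).mul continuousOn_const
    · exact continuousOn_const
  c_diff b x := by cases b <;> exact differentiable_const _
  c_le b x hx R z _ := by
    have hγ : 0 < γ := hx.1.trans_le hx.2
    cases b
    · simp only [leftInit]
      rw [norm_mul, norm_zpow, Complex.norm_real, Real.norm_of_nonneg hx.1.le]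
      refine le_trans ?_ (le_add_of_nonneg_left (norm_nonneg _))
      exact mul_le_mul_of_nonneg_right (zpow_le_zpow_left₀ (by positivity) hx.1.le hx.2)
        (norm_nonneg _)
    · simp only [leftInit]
      exact le_add_of_nonneg_right (by positivity)

theorem holFamily_leftSol (hv : ∀ X, IntegrableOn v (Ioc 0 X)) (hγ : 0 < γ) (i b : Bool) :
    HolFamily univ (leftSol m κ v γ i b) := by
  have H := isVolterra_left (m := m) (κ := κ) (γ := γ) hv (leftCoef κ γ i)
  have hmem : ∀ x > 0, min x γ ∈ Ioc 0 γ := fun x hx => ⟨lt_min hx hγ, min_le_right _ _⟩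
  have hc : Continuous fun x : ℝ => min x γ := continuous_id.min continuous_const
  refine HolFamily.mul (HolFamily.of_continuous ((continuousOn_ofReal_zpow _).comp
    hc.continuousOn fun x hx => (hmem x hx).1)) ⟨fun z _ =>
    (H.continuousOn_sol b z).comp hc.continuousOn fun x hx => hmem x hx,
    fun x hx => (H.differentiable_sol b (hmem x hx)).differentiableOn, fun z₀ _ a c ha => ?_⟩
  refine ⟨(‖leftCoef κ γ i true‖ + γ ^ (2 * κ : ℤ) * ‖leftCoef κ γ i false‖) *
    Real.exp ((1 + (‖z₀‖ + 1)) * |∫ s in γ..(min a γ), weightBound m v s|),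
    Metric.ball z₀ 1, Metric.ball_mem_nhds _ one_pos, fun x hx z hz => ?_⟩
  have hz' : ‖z‖ ≤ ‖z₀‖ + 1 := by
    rw [Metric.mem_ball, dist_eq_norm] at hz
    linarith [norm_le_norm_add_norm_sub z₀ z, norm_sub_rev z z₀]
  have hx0 : 0 < x := ha.trans_le hx.1
  refine (H.norm_sol_le b (hmem x hx0) hz').trans ?_
  have := abs_integral_le_of_mem_uIoc H.β_nonneg (H.β_int _ (hmem a ha))
    (t := min x γ) (by
      rw [uIcc_of_ge (min_le_right _ _)]
      exact ⟨min_le_min_right _ hx.1, min_le_right _ _⟩)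
  gcongr

theorem leftSol_self (hv : ∀ X, IntegrableOn v (Ioc 0 X)) (hγ : 0 < γ) (i b : Bool) {x : ℝ}
    (hx : γ ≤ x) : leftSol m κ v γ i b x z = if i = b then 1 else 0 := by
  have H := isVolterra_left (m := m) (κ := κ) (γ := γ) hv (leftCoef κ γ i)
  have h0 : (γ : ℂ) ≠ 0 := by exact_mod_cast hγ.ne'
  rw [leftSol, min_eq_right hx, H.sol_eq b z ⟨hγ, le_rfl⟩, intervalIntegral.integral_same]
  cases i <;> cases b <;> simp [leftInit, leftCoef, h0]
  field_simp
  ring_nf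
  norm_cast

theorem leftSol_fst (hv : ∀ X, IntegrableOn v (Ioc 0 X)) (i : Bool) {x : ℝ}
    (hx : 0 < x) (hxγ : x ≤ γ) : leftSol m κ v γ i true x z = (x : ℂ) ^ (-κ : ℤ) *
      (leftCoef κ γ i true + ∫ t in γ..x, weight m v true t z *
        ((t : ℂ) ^ (κ : ℤ) * leftSol m κ v γ i false t z)) := by
  have H := isVolterra_left (m := m) (κ := κ) (γ := γ) hv (leftCoef κ γ i)
  rw [leftSol, min_eq_left hxγ, H.sol_eq true z ⟨hx, hxγ⟩]
  simp only [leftInit, leftRatio, one_mul, inv_one, Bool.not_true]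
  congr 2
  refine intervalIntegral.integral_congr fun t ht => ?_
  rw [uIcc_of_ge hxγ] at ht
  have ht0 : (t : ℂ) ≠ 0 := by exact_mod_cast (hx.trans_le ht.1).ne'
  simp only [leftSol]
  rw [min_eq_left ht.2, ← mul_assoc ((t : ℂ) ^ (κ : ℤ)), ← zpow_add₀ ht0]
  simp

theorem leftSol_snd (hv : ∀ X, IntegrableOn v (Ioc 0 X)) (i : Bool) {x : ℝ}
    (hx : 0 < x) (hxγ : x ≤ γ) : leftSol m κ v γ i false x z = (x : ℂ) ^ (κ : ℤ) *
      (leftCoef κ γ i false + ∫ t in γ..x, weight m v false t z *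
        ((t : ℂ) ^ (-κ : ℤ) * leftSol m κ v γ i true t z)) := by
  have H := isVolterra_left (m := m) (κ := κ) (γ := γ) hv (leftCoef κ γ i)
  have hx0 : (x : ℂ) ≠ 0 := by exact_mod_cast hx.ne'
  rw [leftSol, min_eq_left hxγ, H.sol_eq false z ⟨hx, hxγ⟩]
  simp only [leftInit, leftRatio, Bool.not_false]
  rw [← mul_add, ← mul_assoc, ← zpow_add₀ hx0]
  congr 1
  · congr 1
    ring
  · congr 1
    refine intervalIntegral.integral_congr fun t ht => ?_
    rw [uIcc_of_ge hxγ] at ht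
    have ht0 : (t : ℂ) ≠ 0 := by exact_mod_cast (hx.trans_le ht.1).ne'
    simp only [leftSol]
    rw [min_eq_left ht.2, two_mul, zpow_add₀ ht0, zpow_neg, mul_inv]
    ring

/-! ### Free solutions -/

/-- The exponentially weighted Bessel polynomials: `freeBessel l x τ` is the solution of
`-g'' + l (l + 1) x⁻² g = -τ² g` proportional to `e^{-τ x} (1 + o(1))` at infinity. -/
noncomputable def freeBessel : ℕ → ℝ → ℂ → ℂ
  | 0, x, τ => Complex.exp (-(τ * x))
  | 1, x, τ => (τ + (x : ℂ)⁻¹) * Complex.exp (-(τ * x))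
  | l + 2, x, τ => (2 * l + 3) * (x : ℂ)⁻¹ * freeBessel (l + 1) x τ + τ ^ 2 * freeBessel l x τ

theorem freeBessel_add_two (l : ℕ) (x : ℝ) (τ : ℂ) : freeBessel (l + 2) x τ =
    (2 * l + 3) * (x : ℂ)⁻¹ * freeBessel (l + 1) x τ + τ ^ 2 * freeBessel l x τ := rfl

/-- The raising relation `g_{l+1} = ((l + 1) / x) g_l - g_l'`. It propagates through the three-term
recurrence by two-step induction. -/
theorem hasDerivAt_freeBessel (l : ℕ) {x : ℝ} (hx : 0 < x) (τ : ℂ) :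
    HasDerivAt (fun y => freeBessel l y τ)
      ((l + 1) * (x : ℂ)⁻¹ * freeBessel l x τ - freeBessel (l + 1) x τ) x := by
  have h0 : (x : ℂ) ≠ 0 := by exact_mod_cast hx.ne'
  have hinv : HasDerivAt (fun y : ℝ => (y : ℂ)⁻¹) (-((x : ℂ) ^ 2)⁻¹) x :=
    (hasDerivAt_inv h0).comp_ofReal
  have hexp : HasDerivAt (fun y : ℝ => Complex.exp (-(τ * y)))
      (Complex.exp (-(τ * x)) * (-(τ * 1))) x :=
    (((hasDerivAt_id (x : ℂ)).const_mul τ).neg.cexp).comp_ofReal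
  induction l using Nat.twoStepInduction with
  | zero =>
    refine hexp.congr_deriv ?_
    simp only [freeBessel]
    push_cast
    ring
  | one =>
    refine ((hinv.const_add τ).mul hexp).congr_deriv ?_
    simp only [freeBessel]
    push_cast
    field_simp
    ring
  | more l ih1 ih2 =>
    refine (((hinv.const_mul (2 * (l : ℂ) + 3)).mul ih2).add (ih1.const_mul (τ ^ 2))).congr_deriv ?_
    rw [freeBessel_add_two (l + 1), freeBessel_add_two l]
    push_cast
    field_simp
    ring

/-- The lowering relation, obtained by eliminating `g_{l+2}` with the recurrence. With the raising
relation it forms the free Dirac system for `κ = l + 1`. -/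
theorem hasDerivAt_freeBessel_succ (l : ℕ) {x : ℝ} (hx : 0 < x) (τ : ℂ) :
    HasDerivAt (fun y => freeBessel (l + 1) y τ)
      (-((l + 1) * (x : ℂ)⁻¹) * freeBessel (l + 1) x τ - τ ^ 2 * freeBessel l x τ) x := by
  refine (hasDerivAt_freeBessel (l + 1) hx τ).congr_deriv ?_
  rw [freeBessel_add_two]
  push_cast
  ring

theorem holFamily_freeBessel (l : ℕ) : HolFamily univ (freeBessel l) := by
  have hexp : HolFamily univ (freeBessel 0) :=
    HolFamily.of_continuous_uncurry
      (by simp only [freeBessel, Function.uncurry_def]; fun_prop)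
      (fun x => by
        change Differentiable ℂ fun τ : ℂ => Complex.exp (-(τ * x))
        fun_prop)
  have hinv : HolFamily univ (fun x _ => (x : ℂ)⁻¹) := HolFamily.of_continuous
    (by simpa using continuousOn_ofReal_zpow (-1))
  have hid : HolFamily univ (fun _ τ => τ) :=
    HolFamily.of_differentiableOn isOpen_univ differentiableOn_id
  induction l using Nat.twoStepInduction with
  | zero => exact hexp
  | one => exact (hid.add hinv).mul hexp
  | more l ih1 ih2 =>
    exact (((HolFamily.of_continuous (f := fun _ => 2 * (l : ℂ) + 3) continuousOn_const).mul
      hinv).mul ih2).add ((HolFamily.of_differentiableOn isOpen_univ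
        (f := fun τ => τ ^ 2) (differentiableOn_id.pow 2)).mul ih1)

theorem exists_norm_freeBessel_le (l : ℕ) (τ : ℂ) {a : ℝ} (ha : 0 < a) :
    ∃ C, ∀ x ≥ a, ‖freeBessel l x τ‖ ≤ C * Real.exp (-(τ.re * x)) := by
  have hexp : ∀ x : ℝ, ‖freeBessel 0 x τ‖ = Real.exp (-(τ.re * x)) := fun x => by
    rw [freeBessel, Complex.norm_exp]
    simp
  have hinv : ∀ x ≥ a, ‖(x : ℂ)⁻¹‖ ≤ a⁻¹ := fun x hx => by
    rw [norm_inv, Complex.norm_real, Real.norm_of_nonneg (ha.le.trans hx)]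
    exact inv_anti₀ ha hx
  induction l using Nat.twoStepInduction with
  | zero => exact ⟨1, fun x _ => by rw [hexp, one_mul]⟩
  | one =>
    refine ⟨‖τ‖ + a⁻¹, fun x hx => ?_⟩
    rw [← hexp]
    change ‖(τ + (x : ℂ)⁻¹) * freeBessel 0 x τ‖ ≤ _
    rw [norm_mul]
    refine mul_le_mul_of_nonneg_right ?_ (norm_nonneg _)
    exact (norm_add_le _ _).trans (add_le_add_right (hinv x hx) _)
  | more l ih1 ih2 =>
    obtain ⟨C, hC⟩ := ih1
    obtain ⟨D, hD⟩ := ih2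
    refine ⟨‖2 * (l : ℂ) + 3‖ * a⁻¹ * D + ‖τ ^ 2‖ * C, fun x hx => ?_⟩
    rw [freeBessel_add_two, add_mul (‖2 * (l : ℂ) + 3‖ * a⁻¹ * D)]
    refine (norm_add_le _ _).trans (add_le_add ?_ ?_)
    · rw [norm_mul, norm_mul, mul_assoc _ D]
      exact mul_le_mul (mul_le_mul_of_nonneg_left (hinv x hx) (norm_nonneg _)) (hD x hx)
        (norm_nonneg _) (by positivity)
    · rw [norm_mul, mul_assoc]
      exact mul_le_mul_of_nonneg_left (hC x hx) (norm_nonneg _)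

/-- In passing from `l` to `l + 1` the `1 / x` terms of the recurrence cancel and a factor `-τ²`
comes out; the case `l = 0` is `2τ`. -/
theorem freeBessel_wronskian (l : ℕ) {x : ℝ} (τ : ℂ) :
    freeBessel (l + 1) x τ * freeBessel l x (-τ) - freeBessel (l + 1) x (-τ) * freeBessel l x τ =
      2 * τ * (-τ ^ 2) ^ l := by
  induction l with
  | zero =>
    have : Complex.exp (-(τ * x)) * Complex.exp (-(-τ * x)) = 1 := by
      rw [← Complex.exp_add]
      simp
    simp only [freeBessel]
    linear_combination (2 * τ) * this
  | succ l ih =>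
    rw [freeBessel_add_two, freeBessel_add_two, pow_succ]
    linear_combination (-τ ^ 2) * ih

theorem conj_freeBessel (l : ℕ) (x : ℝ) {τ : ℂ} (hτ : starRingEnd ℂ τ = τ) :
    starRingEnd ℂ (freeBessel l x τ) = freeBessel l x τ := by
  induction l using Nat.twoStepInduction with
  | zero => simp [freeBessel, ← Complex.exp_conj, hτ]
  | one => simp [freeBessel, ← Complex.exp_conj, hτ]
  | more l ih1 ih2 => simp [freeBessel_add_two, ih1, ih2, hτ, Complex.conj_ofNat]

end

end RadialDirac

/-- A continuous function on `(0, ∞)`, bounded near `0` and exponentially decaying at infinity, is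
square integrable. -/
theorem memLp_two_of_exp_decay {f : ℝ → ℂ} (hf : ContinuousOn f (Ioi 0)) {C₀ : ℝ}
    (h0 : ∀ᶠ x in 𝓝[>] 0, ‖f x‖ ≤ C₀) {X C δ : ℝ} (hδ : 0 < δ)
    (hC : ∀ x ≥ X, ‖f x‖ ≤ C * Real.exp (-(δ * x))) : MemLp f 2 RadialDirac.halfLine := by
  obtain ⟨ε, hε, hle⟩ := mem_nhdsGT_iff_exists_Ioc_subset.1 h0
  have hε : 0 < ε := hε
  obtain ⟨C₁, hC₁⟩ := isCompact_Icc.exists_bound_of_continuousOn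
    (hf.mono fun x (hx : x ∈ Icc ε (max ε X)) => lt_of_lt_of_le hε hx.1)
  -- The factor `exp (δ * max ε X)` compensates for the decay on `(0, X]`, so one exponential bound
  -- holds on the whole half-line.
  set K := max C (max C₀ C₁ * Real.exp (δ * max ε X)) with hK
  have hbound : ∀ x > 0, ‖f x‖ ≤ K * Real.exp (-(δ * x)) := by
    intro x hx
    rcases le_total X x with h | h
    · exact (hC x h).trans (mul_le_mul_of_nonneg_right (le_max_left _ _) (Real.exp_pos _).le)
    · have h1 : ‖f x‖ ≤ max C₀ C₁ := by
        rcases le_total x ε with h' | h'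
        · exact (hle ⟨hx, h'⟩).trans (le_max_left _ _)
        · exact (hC₁ x ⟨h', h.trans (le_max_right _ _)⟩).trans (le_max_right _ _)
      have h2 : (1 : ℝ) ≤ Real.exp (δ * max ε X) * Real.exp (-(δ * x)) := by
        rw [← Real.exp_add, Real.one_le_exp_iff]
        nlinarith [h.trans (le_max_right ε X)]
      calc ‖f x‖ ≤ max C₀ C₁ * 1 := by rwa [mul_one]
        _ ≤ max C₀ C₁ * (Real.exp (δ * max ε X) * Real.exp (-(δ * x))) :=
          mul_le_mul_of_nonneg_left h2 ((norm_nonneg _).trans h1)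
        _ ≤ K * Real.exp (-(δ * x)) := by
          rw [← mul_assoc]
          exact mul_le_mul_of_nonneg_right (le_max_right _ _) (Real.exp_pos _).le
  have hm : AEStronglyMeasurable f (volume.restrict (Ioi 0)) :=
    hf.aestronglyMeasurable measurableSet_Ioi
  rw [memLp_two_iff_integrable_sq_norm hm]
  have hi : IntegrableOn (fun x => K ^ 2 * Real.exp (-(2 * δ) * x)) (Ioi 0) :=
    (exp_neg_integrableOn_Ioi 0 (by positivity : 0 < 2 * δ)).const_mul _
  refine Integrable.mono' hi (hm.norm.pow 2) ?_
  filter_upwards [ae_restrict_mem measurableSet_Ioi] with x hx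
  rw [Real.norm_of_nonneg (by positivity)]
  refine (pow_le_pow_left₀ (norm_nonneg _) (hbound x hx) 2).trans (le_of_eq ?_)
  rw [mul_pow, ← Real.exp_nat_mul]
  congr 2
  push_cast
  ring

/-! ### Jost solutions, the Jost function and the connection formula -/

namespace RadialDirac

/-- The free Jost solution with exponent `τ`, `τ² = m² - z²`. -/
noncomputable def freeSol (m : ℝ) (κ : ℕ) : Bool → ℝ → ℂ → ℂ → ℂ
  | true, x, _, τ => freeBessel κ x τ
  | false, x, z, τ => (z - m) * freeBessel (κ - 1) x τ

/-- The Jost solution, equal to the free one on `[γ, ∞)`. -/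
noncomputable def psi (m : ℝ) (κ : ℕ) (v : ℝ → ℝ) (γ : ℝ) (b : Bool) (x : ℝ) (z τ : ℂ) : ℂ :=
  freeSol m κ b (max x γ) z τ - freeSol m κ b γ z τ +
    (freeSol m κ true γ z τ * leftSol m κ v γ true b x z +
      freeSol m κ false γ z τ * leftSol m κ v γ false b x z)

/-- The Jost function, the Wronskian of the regular solution and the Jost solution. -/
noncomputable def jost (m : ℝ) (κ : ℕ) (v : ℝ → ℝ) (γ : ℝ) (z τ : ℂ) : ℂ :=
  phi m κ v true γ z * freeSol m κ false γ z τ - phi m κ v false γ z * freeSol m κ true γ z τ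

section

variable {m : ℝ} {κ : ℕ} {v : ℝ → ℝ} {γ : ℝ} {z τ : ℂ}

theorem holFamily_freeSol {U : Set ℂ} (hU : IsOpen U) {τ : ℂ → ℂ} (hτ : DifferentiableOn ℂ τ U)
    (b : Bool) : HolFamily U (fun x z => freeSol m κ b x z (τ z)) := by
  cases b
  · exact (HolFamily.of_differentiableOn hU (f := fun z => z - m)
      (differentiableOn_id.sub_const _)).mul ((holFamily_freeBessel (κ - 1)).comp_right hU hτ)
  · exact (holFamily_freeBessel κ).comp_right hU hτ

/-- Here the relation between `τ` and `z` enters: `-τ² = (m + z)(z - m)`, and the factor `z - m` is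
the normalization of the second component. -/
theorem hasDerivAt_freeSol_fst (hκ : 1 ≤ κ) (hτ : τ ^ 2 = m ^ 2 - z ^ 2) {x : ℝ} (hx : 0 < x) :
    HasDerivAt (fun y => freeSol m κ true y z τ)
      (-(κ * (x : ℂ)⁻¹) * freeSol m κ true x z τ + (m + z) * freeSol m κ false x z τ) x := by
  obtain ⟨l, rfl⟩ := Nat.exists_eq_add_of_le' hκ
  refine (hasDerivAt_freeBessel_succ l hx τ).congr_deriv ?_
  simp only [freeSol, Nat.add_sub_cancel]
  push_cast
  rw [hτ]
  ring

theorem hasDerivAt_freeSol_snd (hκ : 1 ≤ κ) {x : ℝ} (hx : 0 < x) :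
    HasDerivAt (fun y => freeSol m κ false y z τ)
      (κ * (x : ℂ)⁻¹ * freeSol m κ false x z τ + (m - z) * freeSol m κ true x z τ) x := by
  obtain ⟨l, rfl⟩ := Nat.exists_eq_add_of_le' hκ
  refine ((hasDerivAt_freeBessel l hx τ).const_mul (z - m)).congr_deriv ?_
  simp only [freeSol, Nat.add_sub_cancel]
  push_cast
  ring

theorem psi_of_le (hv : ∀ X, IntegrableOn v (Ioc 0 X)) (hγ : 0 < γ) (b : Bool) {x : ℝ}
    (hx : γ ≤ x) : psi m κ v γ b x z τ = freeSol m κ b x z τ := by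
  rw [psi, max_eq_left hx, leftSol_self hv hγ _ _ hx, leftSol_self hv hγ _ _ hx]
  cases b <;> simp

theorem psi_of_ge (b : Bool) {x : ℝ} (hx : x ≤ γ) : psi m κ v γ b x z τ =
    freeSol m κ true γ z τ * leftSol m κ v γ true b x z +
      freeSol m κ false γ z τ * leftSol m κ v γ false b x z := by
  rw [psi, max_eq_right hx, sub_self, zero_add]

/-- The single formula for `psi` spares a gluing argument. Below `γ` the first two terms cancel
because of `max x γ`, above `γ` the basis is frozen at its unit data, and every ingredient is a
holomorphic family on all of `(0, ∞)`. -/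
theorem holFamily_psi (hv : ∀ X, IntegrableOn v (Ioc 0 X)) (hγ : 0 < γ) {U : Set ℂ}
    (hU : IsOpen U) {τ : ℂ → ℂ} (hτ : DifferentiableOn ℂ τ U) (b : Bool) :
    HolFamily U (fun x z => psi m κ v γ b x z (τ z)) := by
  have hfree := fun b => holFamily_freeSol (m := m) (κ := κ) hU hτ b
  have hcst := fun b => (hfree b).comp_left (ρ := fun _ => γ) continuous_const (fun _ _ => hγ)
  have hmax := (hfree b).comp_left (ρ := fun x => max x γ) (continuous_id.max continuous_const)
    (fun _ _ => lt_max_of_lt_right hγ)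
  have hleft := fun i => (holFamily_leftSol (m := m) (κ := κ) hv hγ i b).mono (subset_univ U)
  have h1 := (hmax.add (hcst b).neg).add
    (((hcst true).mul (hleft true)).add ((hcst false).mul (hleft false)))
  simpa only [psi, sub_eq_add_neg] using h1

theorem continuousOn_psi (hv : ∀ X, IntegrableOn v (Ioc 0 X)) (hγ : 0 < γ) (b : Bool) :
    ContinuousOn (fun x => psi m κ v γ b x z τ) (Ioi 0) :=
  (holFamily_psi hv hγ isOpen_univ (τ := fun _ => τ) (differentiableOn_const _) b).cont z trivial

theorem continuousOn_leftSol (hv : ∀ X, IntegrableOn v (Ioc 0 X)) (hγ : 0 < γ) (i b : Bool) :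
    ContinuousOn (fun x => leftSol m κ v γ i b x z) (Ioi 0) :=
  (holFamily_leftSol hv hγ i b).cont z trivial

/-- The integral equations based at `γ` hold on both sides: on `(0, γ]` by linearity from those of
`leftSol`, on `[γ, ∞)` because `v` vanishes there and the free system, multiplied by `x^{±κ}`,
integrates exactly. -/
theorem isSol_psi (hv : ∀ X, IntegrableOn v (Ioc 0 X)) (hγ : 0 < γ)
    (hv0 : ∀ᵐ x : ℝ, γ < x → v x = 0) (hκ : 1 ≤ κ) (hτ : τ ^ 2 = m ^ 2 - z ^ 2) :
    IsSol m κ v z 0 0 (fun x => psi m κ v γ true x z τ) (fun x => psi m κ v γ false x z τ) := by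
  have hγ0 : (γ : ℂ) ≠ 0 := by exact_mod_cast hγ.ne'
  refine IsSol.of_integral hv (continuousOn_psi hv hγ true) (continuousOn_psi hv hγ false) hγ
    (A₁ := (γ : ℂ) ^ (κ : ℤ) * freeSol m κ true γ z τ)
    (A₂ := (γ : ℂ) ^ (-κ : ℤ) * freeSol m κ false γ z τ) (fun x hx => ?_) fun x hx => ?_
  · have hx0 : (x : ℂ) ≠ 0 := by exact_mod_cast hx.ne'
    rcases le_total x γ with hxγ | hxγ
    · have e : ∫ t in γ..x, weight m v true t z * ((t : ℂ) ^ (κ : ℤ) * psi m κ v γ false t z τ) =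
          freeSol m κ true γ z τ * (∫ t in γ..x, weight m v true t z *
            ((t : ℂ) ^ (κ : ℤ) * leftSol m κ v γ true false t z)) +
          freeSol m κ false γ z τ * (∫ t in γ..x, weight m v true t z *
            ((t : ℂ) ^ (κ : ℤ) * leftSol m κ v γ false false t z)) := by
        rw [← intervalIntegral.integral_const_mul, ← intervalIntegral.integral_const_mul,
          ← intervalIntegral.integral_add]
        · refine intervalIntegral.integral_congr fun t ht => ?_
          rw [uIcc_of_ge hxγ] at ht
          simp only [psi_of_ge _ ht.2]
          ring
        all_goals
          exact (intervalIntegrable_weight_mul hv true z ((continuousOn_ofReal_zpow κ).mul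
            (continuousOn_leftSol hv hγ _ false)) hγ hx).const_mul _
      rw [e, psi_of_ge _ hxγ, leftSol_fst hv true hx hxγ, leftSol_fst hv false hx hxγ]
      simp only [leftCoef]
      ring
    · have e : ∫ t in γ..x, weight m v true t z * ((t : ℂ) ^ (κ : ℤ) * psi m κ v γ false t z τ) =
          ∫ t in γ..x, (t : ℂ) ^ (κ : ℤ) * ((m + z) * freeSol m κ false t z τ) := by
        refine intervalIntegral.integral_congr_ae ?_
        filter_upwards [hv0] with t ht hm
        rw [uIoc_of_le hxγ] at hm
        rw [psi_of_le hv hγ _ hm.1.le, weight, ht hm.1, sub_zero]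
        ring
      have hd : ∀ t ∈ uIcc γ x, HasDerivAt (fun t : ℝ => (t : ℂ) ^ (κ : ℤ) * freeSol m κ true t z τ)
          ((t : ℂ) ^ (κ : ℤ) * ((m + z) * freeSol m κ false t z τ)) t := fun t ht => by
        have ht0 := uIcc_subset_Ioi hγ hx ht
        refine ((hasDerivAt_ofReal_zpow κ ht0).mul
          (hasDerivAt_freeSol_fst hκ hτ ht0)).congr_deriv ?_
        push_cast
        ring
      rw [e, intervalIntegral.integral_eq_sub_of_hasDerivAt hd, psi_of_le hv hγ _ hxγ]
      · rw [add_sub_cancel, ← mul_assoc, ← zpow_add₀ hx0]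
        simp
      · refine ContinuousOn.intervalIntegrable (((continuousOn_ofReal_zpow κ).mul
          (continuousOn_const.mul ?_)).mono (uIcc_subset_Ioi hγ hx))
        exact (holFamily_freeSol isOpen_univ (τ := fun _ => τ) (differentiableOn_const _)
          false).cont z trivial
  · have hx0 : (x : ℂ) ≠ 0 := by exact_mod_cast hx.ne'
    rcases le_total x γ with hxγ | hxγ
    · have e : ∫ t in γ..x, weight m v false t z * ((t : ℂ) ^ (-κ : ℤ) * psi m κ v γ true t z τ) =
          freeSol m κ true γ z τ * (∫ t in γ..x, weight m v false t z *
            ((t : ℂ) ^ (-κ : ℤ) * leftSol m κ v γ true true t z)) +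
          freeSol m κ false γ z τ * (∫ t in γ..x, weight m v false t z *
            ((t : ℂ) ^ (-κ : ℤ) * leftSol m κ v γ false true t z)) := by
        rw [← intervalIntegral.integral_const_mul, ← intervalIntegral.integral_const_mul,
          ← intervalIntegral.integral_add]
        · refine intervalIntegral.integral_congr fun t ht => ?_
          rw [uIcc_of_ge hxγ] at ht
          simp only [psi_of_ge _ ht.2]
          ring
        all_goals
          exact (intervalIntegrable_weight_mul hv false z ((continuousOn_ofReal_zpow (-κ)).mul
            (continuousOn_leftSol hv hγ _ true)) hγ hx).const_mul _
      rw [e, psi_of_ge _ hxγ, leftSol_snd hv true hx hxγ, leftSol_snd hv false hx hxγ]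
      simp only [leftCoef]
      ring
    · have e : ∫ t in γ..x, weight m v false t z * ((t : ℂ) ^ (-κ : ℤ) * psi m κ v γ true t z τ) =
          ∫ t in γ..x, (t : ℂ) ^ (-κ : ℤ) * ((m - z) * freeSol m κ true t z τ) := by
        refine intervalIntegral.integral_congr_ae ?_
        filter_upwards [hv0] with t ht hm
        rw [uIoc_of_le hxγ] at hm
        rw [psi_of_le hv hγ _ hm.1.le, weight, ht hm.1, add_zero]
        ring
      have hd : ∀ t ∈ uIcc γ x, HasDerivAt
          (fun t : ℝ => (t : ℂ) ^ (-κ : ℤ) * freeSol m κ false t z τ)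
          ((t : ℂ) ^ (-κ : ℤ) * ((m - z) * freeSol m κ true t z τ)) t := fun t ht => by
        have ht0 := uIcc_subset_Ioi hγ hx ht
        refine ((hasDerivAt_ofReal_zpow (-κ) ht0).mul
          (hasDerivAt_freeSol_snd hκ ht0)).congr_deriv ?_
        push_cast
        ring
      rw [e, intervalIntegral.integral_eq_sub_of_hasDerivAt hd, psi_of_le hv hγ _ hxγ]
      · rw [add_sub_cancel, ← mul_assoc, ← zpow_add₀ hx0]
        simp
      · refine ContinuousOn.intervalIntegrable (((continuousOn_ofReal_zpow (-κ)).mul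
          (continuousOn_const.mul ?_)).mono (uIcc_subset_Ioi hγ hx))
        exact (holFamily_freeSol isOpen_univ (τ := fun _ => τ) (differentiableOn_const _)
          true).cont z trivial

theorem conj_freeSol (hz : starRingEnd ℂ z = z) (hτ : starRingEnd ℂ τ = τ) (b : Bool) (x : ℝ) :
    starRingEnd ℂ (freeSol m κ b x z τ) = freeSol m κ b x z τ := by
  cases b <;> simp [freeSol, conj_freeBessel _ _ hτ, hz]

theorem exists_norm_psi_le (hv : ∀ X, IntegrableOn v (Ioc 0 X)) (hγ : 0 < γ) (z τ : ℂ) (b : Bool) :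
    ∃ C, ∀ x ≥ γ, ‖psi m κ v γ b x z τ‖ ≤ C * Real.exp (-(τ.re * x)) := by
  cases b
  · obtain ⟨C, hC⟩ := exists_norm_freeBessel_le (κ - 1) τ hγ
    refine ⟨‖z - m‖ * C, fun x hx => ?_⟩
    rw [psi_of_le hv hγ _ hx, freeSol, norm_mul, mul_assoc]
    exact mul_le_mul_of_nonneg_left (hC x hx) (norm_nonneg _)
  · obtain ⟨C, hC⟩ := exists_norm_freeBessel_le κ τ hγ
    refine ⟨C, fun x hx => ?_⟩
    rw [psi_of_le hv hγ _ hx]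
    exact hC x hx

/-- The Wronskian of the two Jost solutions. -/
theorem wronskian_psi (hv : ∀ X, IntegrableOn v (Ioc 0 X)) (hγ : 0 < γ)
    (hv0 : ∀ᵐ x : ℝ, γ < x → v x = 0) (hκ : 1 ≤ κ) (hτ : τ ^ 2 = m ^ 2 - z ^ 2) {x : ℝ}
    (hx : 0 < x) : psi m κ v γ true x z τ * psi m κ v γ false x z (-τ) -
      psi m κ v γ false x z τ * psi m κ v γ true x z (-τ) =
      (z - m) * (2 * τ * (-τ ^ 2) ^ (κ - 1)) := by
  rw [(isSol_psi hv hγ hv0 hκ hτ).wronskian_const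
    (isSol_psi hv hγ hv0 hκ (τ := -τ) (by rw [neg_sq, hτ])) hγ hx]
  simp only [psi_of_le hv hγ _ le_rfl]
  obtain ⟨l, rfl⟩ := Nat.exists_eq_add_of_le' hκ
  simp only [freeSol, Nat.add_sub_cancel]
  rw [← freeBessel_wronskian l (x := γ) τ]
  ring

theorem wronskian_phi_psi (hv : ∀ X, IntegrableOn v (Ioc 0 X)) (hγ : 0 < γ)
    (hv0 : ∀ᵐ x : ℝ, γ < x → v x = 0) (hκ : 1 ≤ κ) (hτ : τ ^ 2 = m ^ 2 - z ^ 2) {x : ℝ}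
    (hx : 0 < x) : phi m κ v true x z * psi m κ v γ false x z τ -
      phi m κ v false x z * psi m κ v γ true x z τ = jost m κ v γ z τ := by
  rw [(isSol_phi hv z).wronskian_const (isSol_psi hv hγ hv0 hκ hτ) hγ hx]
  simp only [psi_of_le hv hγ _ le_rfl, jost]

/-- The connection formula between the regular solution and the two Jost solutions. -/
theorem connection (hv : ∀ X, IntegrableOn v (Ioc 0 X)) (hγ : 0 < γ)
    (hv0 : ∀ᵐ x : ℝ, γ < x → v x = 0) (hκ : 1 ≤ κ) (hτ : τ ^ 2 = m ^ 2 - z ^ 2) (b : Bool) {x : ℝ}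
    (hx : 0 < x) : (z - m) * (2 * τ * (-τ ^ 2) ^ (κ - 1)) * phi m κ v b x z =
      jost m κ v γ z (-τ) * psi m κ v γ b x z τ - jost m κ v γ z τ * psi m κ v γ b x z (-τ) := by
  -- All three Wronskians are constant, so they may be evaluated at the point `x` itself; what
  -- remains is Cramer's rule for vectors in the plane.
  rw [← wronskian_psi hv hγ hv0 hκ hτ hx, ← wronskian_phi_psi hv hγ hv0 hκ hτ hx,
    ← wronskian_phi_psi hv hγ hv0 hκ (τ := -τ) (by rw [neg_sq, hτ]) hx]
  cases b <;> ring

/-- The only factor not visibly nonzero is `z - m`, and `z = m` would force `τ = 0`. -/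
theorem wronskian_ne_zero (hτ : τ ^ 2 = m ^ 2 - z ^ 2) (hτ0 : τ ≠ 0) :
    (z - m) * (2 * τ * (-τ ^ 2) ^ (κ - 1)) ≠ 0 := by
  have hz : z - m ≠ 0 := fun h => hτ0 (by
    rw [sub_eq_zero.1 h, sub_self] at hτ
    exact pow_eq_zero_iff (two_ne_zero) |>.1 hτ)
  exact mul_ne_zero hz (mul_ne_zero (mul_ne_zero two_ne_zero hτ0)
    (pow_ne_zero _ (neg_ne_zero.2 (pow_ne_zero _ hτ0))))

/-- Not both Jost functions vanish. -/
theorem jost_neg_ne_zero (hv : ∀ X, IntegrableOn v (Ioc 0 X)) (hγ : 0 < γ)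
    (hv0 : ∀ᵐ x : ℝ, γ < x → v x = 0) (hκ : 1 ≤ κ) (hτ : τ ^ 2 = m ^ 2 - z ^ 2) (hτ0 : τ ≠ 0)
    (h : jost m κ v γ z τ = 0) : jost m κ v γ z (-τ) ≠ 0 := by
  intro h'
  obtain ⟨x, hx, hne⟩ := exists_phi_ne_zero (m := m) (κ := κ) hv z
  have := connection hv hγ hv0 hκ hτ false hx
  rw [h, h', zero_mul, zero_mul, sub_zero] at this
  exact (mul_ne_zero (wronskian_ne_zero hτ hτ0) hne) this

/-- At a zero, `connection` makes `phi` a multiple of the decaying Jost solution. It would then be a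
square integrable solution with the boundary condition at a nonreal `z`, hence zero, contradicting
`exists_phi_ne_zero`. -/
theorem jost_ne_zero (hv : ∀ X, IntegrableOn v (Ioc 0 X)) (hγ : 0 < γ)
    (hv0 : ∀ᵐ x : ℝ, γ < x → v x = 0) (hκ : 1 ≤ κ) (hτ : τ ^ 2 = m ^ 2 - z ^ 2) (hτr : 0 < τ.re)
    (hz : 0 < z.im) : jost m κ v γ z τ ≠ 0 := by
  intro h
  have hτ0 : τ ≠ 0 := fun h0 => by simp [h0] at hτr
  have hW := wronskian_ne_zero (κ := κ) hτ hτ0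
  have hphi : ∀ b, ∀ x > 0, phi m κ v b x z = ((z - m) * (2 * τ * (-τ ^ 2) ^ (κ - 1)))⁻¹ *
      jost m κ v γ z (-τ) * psi m κ v γ b x z τ := fun b x hx => by
    have := connection hv hγ hv0 hκ hτ b hx
    rw [h, zero_mul, sub_zero] at this
    rw [mul_assoc, ← this, inv_mul_cancel_left₀ hW]
  have hLp : ∀ b, MemLp (fun x => phi m κ v b x z) 2 halfLine := fun b => by
    obtain ⟨C, hC⟩ := exists_norm_psi_le (m := m) (κ := κ) hv hγ z τ b
    refine memLp_two_of_exp_decay ((holFamily_phi hv b).cont z trivial) (C₀ := 1) (X := γ) ?_ hτr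
      (C := ‖((z - m) * (2 * τ * (-τ ^ 2) ^ (κ - 1)))⁻¹ * jost m κ v γ z (-τ)‖ * C)
      fun x hx => ?_
    · have ht := (tendsto_phi (m := m) hv hκ z b).norm
      rw [norm_zero] at ht
      filter_upwards [ht.eventually_lt_const one_pos] with x hx using hx.le
    · rw [hphi b x (hγ.trans_le hx), norm_mul, mul_assoc _ C]
      exact mul_le_mul_of_nonneg_left (hC x hx) (norm_nonneg _)
  have hL : IntegrableOn (fun x => ‖phi m κ v true x z‖ ^ 2 + ‖phi m κ v false x z‖ ^ 2) (Ioi 0) :=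
    ((memLp_two_iff_integrable_sq_norm (hLp true).1).1 (hLp true)).add
      ((memLp_two_iff_integrable_sq_norm (hLp false).1).1 (hLp false))
  obtain ⟨x, hx, hne⟩ := exists_phi_ne_zero (m := m) (κ := κ) hv z
  exact hne ((isSol_phi hv z).eq_zero_of_im_pos hv (tendsto_phi hv hκ z true) hL hz hx).2

end

end RadialDirac

/-! ### The Green function and the quadratic form of the resolvent -/

namespace RadialDirac

/-- Variation of constants: the homogeneous parts cancel, and the terms with `α'` and `β'` combine
through the Wronskian `F` into exactly the source. -/
theorem IsSol.variation {m : ℝ} {κ : ℕ} {v : ℝ → ℝ} {z : ℂ} {f₁ f₂ g₁ g₂ h₁ h₂ α β : ℝ → ℂ}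
    (hf : IsSol m κ v z 0 0 f₁ f₂) (hg : IsSol m κ v z 0 0 g₁ g₂) {F : ℂ} (hF : F ≠ 0)
    (hW : ∀ x > 0, f₁ x * g₂ x - f₂ x * g₁ x = F)
    (hh1 : ContinuousOn h₁ (Ioi 0)) (hh2 : ContinuousOn h₂ (Ioi 0))
    (hα : ∀ x > 0, HasDerivAt α (f₁ x * h₁ x + f₂ x * h₂ x) x)
    (hβ : ∀ x > 0, HasDerivAt β (-(g₁ x * h₁ x + g₂ x * h₂ x)) x) :
    IsSol m κ v z h₁ h₂ (fun x => -F⁻¹ * (g₁ x * α x + f₁ x * β x))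
      (fun x => -F⁻¹ * (g₂ x * α x + f₂ x * β x)) := by
  have aα : ∀ a b : ℝ, 0 < a → 0 < b → AbsolutelyContinuousOnInterval α a b := fun a b ha hb =>
    absolutelyContinuousOnInterval_of_hasDerivAt (fun x hx => hα x (uIcc_subset_Ioi ha hb hx))
      (((hf.continuousOn_fst.mul hh1).add (hf.continuousOn_snd.mul hh2)).mono
        (uIcc_subset_Ioi ha hb))
  have aβ : ∀ a b : ℝ, 0 < a → 0 < b → AbsolutelyContinuousOnInterval β a b := fun a b ha hb =>
    absolutelyContinuousOnInterval_of_hasDerivAt (fun x hx => hβ x (uIcc_subset_Ioi ha hb hx))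
      (((hg.continuousOn_fst.mul hh1).add (hg.continuousOn_snd.mul hh2)).neg.mono
        (uIcc_subset_Ioi ha hb))
  refine ⟨fun a b ha hb => ?_, fun a b ha hb => ?_, ?_, ?_⟩
  · exact (((hg.absCont_fst a b ha hb).complex_mul (aα a b ha hb)).add
      ((hf.absCont_fst a b ha hb).complex_mul (aβ a b ha hb))).const_smul (-F⁻¹)
  · exact (((hg.absCont_snd a b ha hb).complex_mul (aα a b ha hb)).add
      ((hf.absCont_snd a b ha hb).complex_mul (aβ a b ha hb))).const_smul (-F⁻¹)
  · filter_upwards [hf.deriv_fst, hg.deriv_fst] with x h1 h2 h0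
    refine ((((h2 h0).mul (hα x h0)).add ((h1 h0).mul (hβ x h0))).const_mul (-F⁻¹)).congr_deriv ?_
    have e : h₂ x = F⁻¹ * (f₁ x * g₂ x - f₂ x * g₁ x) * h₂ x := by
      rw [hW x h0, inv_mul_cancel₀ hF, one_mul]
    simp only [Pi.zero_apply]
    linear_combination -e
  · filter_upwards [hf.deriv_snd, hg.deriv_snd] with x h1 h2 h0
    refine ((((h2 h0).mul (hα x h0)).add ((h1 h0).mul (hβ x h0))).const_mul (-F⁻¹)).congr_deriv ?_
    have e : h₁ x = F⁻¹ * (f₁ x * g₂ x - f₂ x * g₁ x) * h₁ x := by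
      rw [hW x h0, inv_mul_cancel₀ hF, one_mul]
    simp only [Pi.zero_apply]
    linear_combination e

/-- The integral of the regular solution against `h` over `(a, x)`. -/
noncomputable def regInt (m : ℝ) (κ : ℕ) (v : ℝ → ℝ) (a : ℝ) (h : ℝ → Spinor) (x : ℝ) (z : ℂ) : ℂ :=
  ∫ t in a..x, (phi m κ v true t z * h t 0 + phi m κ v false t z * h t 1)

/-- The integral of the Jost solution against `h` over `(x, c)`. -/
noncomputable def jostInt (m : ℝ) (κ : ℕ) (v : ℝ → ℝ) (γ c : ℝ) (h : ℝ → Spinor) (x : ℝ)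
    (z τ : ℂ) : ℂ :=
  -∫ t in c..x, (psi m κ v γ true t z τ * h t 0 + psi m κ v γ false t z τ * h t 1)

/-- The components of `-F (H - z)⁻¹ h`, where `F` is the Jost function. -/
noncomputable def green (m : ℝ) (κ : ℕ) (v : ℝ → ℝ) (γ a c : ℝ) (h : ℝ → Spinor) (b : Bool) (x : ℝ)
    (z τ : ℂ) : ℂ :=
  psi m κ v γ b x z τ * regInt m κ v a h x z + phi m κ v b x z * jostInt m κ v γ c h x z τ

/-- The numerator `F Φ_h` of the quadratic form of the resolvent. -/
noncomputable def resolventNum (m : ℝ) (κ : ℕ) (v : ℝ → ℝ) (γ a c : ℝ) (h : ℝ → Spinor)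
    (z τ : ℂ) : ℂ :=
  -∫ x in a..c, (starRingEnd ℂ (h x 0) * green m κ v γ a c h true x z τ +
    starRingEnd ℂ (h x 1) * green m κ v γ a c h false x z τ)

section

variable {m : ℝ} {κ : ℕ} {v : ℝ → ℝ} {γ a c : ℝ} {z τ : ℂ} {h : ℝ → Spinor}

theorem IsTestFunction.continuous_coord (hh : IsTestFunction h) (i : Fin 2) :
    Continuous fun x => h x i :=
  (lipschitzWith_coord i).continuous.comp hh.continuous

theorem holFamily_phi_dot (hv : ∀ X, IntegrableOn v (Ioc 0 X)) (hh : IsTestFunction h) :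
    HolFamily univ (fun t z => phi m κ v true t z * h t 0 + phi m κ v false t z * h t 1) :=
  ((holFamily_phi hv true).mul (HolFamily.of_continuous (hh.continuous_coord 0).continuousOn)).add
    ((holFamily_phi hv false).mul (HolFamily.of_continuous (hh.continuous_coord 1).continuousOn))

theorem holFamily_psi_dot (hv : ∀ X, IntegrableOn v (Ioc 0 X)) (hγ : 0 < γ)
    (hh : IsTestFunction h) {U : Set ℂ} (hU : IsOpen U) {τ : ℂ → ℂ}
    (hτ : DifferentiableOn ℂ τ U) : HolFamily U
      (fun t z => psi m κ v γ true t z (τ z) * h t 0 + psi m κ v γ false t z (τ z) * h t 1) :=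
  ((holFamily_psi hv hγ hU hτ true).mul
    (HolFamily.of_continuous (hh.continuous_coord 0).continuousOn)).add
    ((holFamily_psi hv hγ hU hτ false).mul
    (HolFamily.of_continuous (hh.continuous_coord 1).continuousOn))

theorem holFamily_green (hv : ∀ X, IntegrableOn v (Ioc 0 X)) (hγ : 0 < γ) (hh : IsTestFunction h)
    (ha : 0 < a) (hc : 0 < c) {U : Set ℂ} (hU : IsOpen U) {τ : ℂ → ℂ}
    (hτ : DifferentiableOn ℂ τ U) (b : Bool) :
    HolFamily U (fun x z => green m κ v γ a c h b x z (τ z)) :=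
  ((holFamily_psi hv hγ hU hτ b).mul
    (((holFamily_phi_dot hv hh).mono (subset_univ U)).primitive hU ha)).add
    (((holFamily_phi hv b).mono (subset_univ U)).mul
      ((holFamily_psi_dot hv hγ hh hU hτ).primitive hU hc).neg)

theorem differentiableOn_resolventNum (hv : ∀ X, IntegrableOn v (Ioc 0 X)) (hγ : 0 < γ)
    (hh : IsTestFunction h) (ha : 0 < a) (hc : 0 < c) {U : Set ℂ} (hU : IsOpen U) {τ : ℂ → ℂ}
    (hτ : DifferentiableOn ℂ τ U) :
    DifferentiableOn ℂ (fun z => resolventNum m κ v γ a c h z (τ z)) U := by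
  have hcj : ∀ i : Fin 2, HolFamily U (fun x _ => starRingEnd ℂ (h x i)) := fun i =>
    HolFamily.of_continuous (Complex.continuous_conj.comp (hh.continuous_coord i)).continuousOn
  exact ((((hcj 0).mul (holFamily_green hv hγ hh ha hc hU hτ true)).add
    ((hcj 1).mul (holFamily_green hv hγ hh ha hc hU hτ false))).differentiableOn_integral
      hU ha hc).neg

theorem differentiableOn_jost (hv : ∀ X, IntegrableOn v (Ioc 0 X)) (hγ : 0 < γ) {U : Set ℂ}
    (hU : IsOpen U) {τ : ℂ → ℂ} (hτ : DifferentiableOn ℂ τ U) :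
    DifferentiableOn ℂ (fun z => jost m κ v γ z (τ z)) U :=
  ((((holFamily_phi hv true).diff γ hγ).mono (subset_univ U)).mul
    ((holFamily_freeSol hU hτ false).diff γ hγ)).sub
  ((((holFamily_phi hv false).diff γ hγ).mono (subset_univ U)).mul
    ((holFamily_freeSol hU hτ true).diff γ hγ))

/-- Outside the support of `h` one of the two integrals vanishes. Near the origin `green` is a
multiple of `phi`, which gives the boundary condition; beyond `c` it is a multiple of `psi`, which
decays because `Re τ > 0`. -/
theorem isResolventAt_green (hv : ∀ X, IntegrableOn v (Ioc 0 X)) (hγ : 0 < γ)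
    (hv0 : ∀ᵐ x : ℝ, γ < x → v x = 0) (hκ : 1 ≤ κ) (hτ : τ ^ 2 = m ^ 2 - z ^ 2) (hτr : 0 < τ.re)
    (hF : jost m κ v γ z τ ≠ 0) (hh : IsTestFunction h) (ha : 0 < a) (hγc : γ < c)
    (hsupp : ∀ x, x ∉ Icc a c → h x = 0) :
    IsResolventAt m κ v z h (fun x => !₂[-(jost m κ v γ z τ)⁻¹ * green m κ v γ a c h true x z τ,
      -(jost m κ v γ z τ)⁻¹ * green m κ v γ a c h false x z τ]) := by
  have hc : 0 < c := hγ.trans hγc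
  have hφd := (holFamily_phi_dot (m := m) (κ := κ) hv hh).cont z trivial
  have hψd := (holFamily_psi_dot (m := m) (κ := κ) hv hγ hh isOpen_univ (τ := fun _ => τ)
    (differentiableOn_const _)).cont z trivial
  have prim : ∀ {g : ℝ → ℂ}, ContinuousOn g (Ioi 0) → ∀ {p : ℝ}, 0 < p → ∀ x > 0,
      HasDerivAt (fun x => ∫ t in p..x, g t) (g x) x := fun {g} hg {p} hp x hx =>
    intervalIntegral.integral_hasDerivAt_right
      (hg.mono (uIcc_subset_Ioi hp hx)).intervalIntegrable
      (hg.stronglyMeasurableAtFilter isOpen_Ioi x hx) (hg.continuousAt (Ioi_mem_nhds hx))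
  have hsol := (isSol_phi (m := m) (κ := κ) hv z).variation (isSol_psi hv hγ hv0 hκ hτ) hF
    (fun x hx => wronskian_phi_psi hv hγ hv0 hκ hτ hx) (h₁ := fun x => h x 0)
    (h₂ := fun x => h x 1) (hh.continuous_coord 0).continuousOn (hh.continuous_coord 1).continuousOn
    (α := fun x => regInt m κ v a h x z) (β := fun x => jostInt m κ v γ c h x z τ)
    (fun x hx => prim hφd ha x hx) (fun x hx => (prim hψd hc x hx).neg)
  have hvan : ∀ (i : Fin 2) x, x ∉ Icc a c → h x i = 0 := fun i x hx => by
    rw [hsupp x hx]; rfl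
  have hnear : ∀ b, ∀ x ∈ Ioo 0 (min a c), green m κ v γ a c h b x z τ =
      phi m κ v b x z * jostInt m κ v γ c h a z τ := fun b x hx => by
    have hxa : x < a := hx.2.trans_le (min_le_left _ _)
    have e1 : regInt m κ v a h x z = 0 := by
      rw [regInt, intervalIntegral.integral_symm, neg_eq_zero]
      refine intervalIntegral.integral_zero_ae ?_
      filter_upwards [Measure.ae_ne volume a] with t hta ht
      rw [uIoc_of_le hxa.le] at ht
      have ht' : t ∉ Icc a c := fun h' => hta (le_antisymm ht.2 h'.1)
      rw [hvan 0 t ht', hvan 1 t ht', mul_zero, mul_zero, add_zero]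
    have e2 : jostInt m κ v γ c h x z τ = jostInt m κ v γ c h a z τ := by
      have h0 : ∫ t in x..a, (psi m κ v γ true t z τ * h t 0 + psi m κ v γ false t z τ * h t 1)
          = 0 := by
        refine intervalIntegral.integral_zero_ae ?_
        filter_upwards [Measure.ae_ne volume a] with t hta ht
        rw [uIoc_of_le hxa.le] at ht
        have ht' : t ∉ Icc a c := fun h' => hta (le_antisymm ht.2 h'.1)
        rw [hvan 0 t ht', hvan 1 t ht', mul_zero, mul_zero, add_zero]
      have h1 := intervalIntegral.integral_add_adjacent_intervals (μ := volume)
        (hψd.mono (uIcc_subset_Ioi hc hx.1)).intervalIntegrable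
        (hψd.mono (uIcc_subset_Ioi hx.1 ha)).intervalIntegrable
      rw [jostInt, jostInt, ← h1, h0, add_zero]
    rw [green, e1, e2, mul_zero, zero_add]
  have hfar : ∀ b, ∀ x ≥ c, green m κ v γ a c h b x z τ =
      psi m κ v γ b x z τ * regInt m κ v a h c z := fun b x hx => by
    have hz : ∀ (f₁ f₂ : ℝ → ℂ), ∫ t in c..x, (f₁ t * h t 0 + f₂ t * h t 1) = 0 := fun f₁ f₂ => by
      refine intervalIntegral.integral_zero_ae (Eventually.of_forall fun t ht => ?_)
      rw [uIoc_of_le hx] at ht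
      have ht' : t ∉ Icc a c := fun h' => not_le.2 ht.1 h'.2
      rw [hvan 0 t ht', hvan 1 t ht', mul_zero, mul_zero, add_zero]
    have e1 : jostInt m κ v γ c h x z τ = 0 := by rw [jostInt, hz, neg_zero]
    have e2 : regInt m κ v a h x z = regInt m κ v a h c z := by
      have h1 := intervalIntegral.integral_add_adjacent_intervals (μ := volume)
        (hφd.mono (uIcc_subset_Ioi ha hc)).intervalIntegrable
        (hφd.mono (uIcc_subset_Ioi hc (hc.trans_le hx))).intervalIntegrable
      rw [regInt, regInt, ← h1, hz, add_zero]
    rw [green, e1, e2, mul_zero, add_zero]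
  have hlim : ∀ b, Tendsto (fun x => -(jost m κ v γ z τ)⁻¹ * green m κ v γ a c h b x z τ)
      (𝓝[>] 0) (𝓝 0) := fun b => by
    have h1 := ((tendsto_phi (m := m) hv hκ z b).mul_const (jostInt m κ v γ c h a z τ)).const_mul
      (-(jost m κ v γ z τ)⁻¹)
    rw [zero_mul, mul_zero] at h1
    refine h1.congr' ?_
    filter_upwards [Ioo_mem_nhdsGT (lt_min ha hc)] with x hx
    rw [hnear b x hx]
  have hLp : ∀ b, ContinuousOn (fun x => -(jost m κ v γ z τ)⁻¹ * green m κ v γ a c h b x z τ)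
      (Ioi 0) → MemLp (fun x => -(jost m κ v γ z τ)⁻¹ * green m κ v γ a c h b x z τ) 2 halfLine :=
    fun b hcont => by
      obtain ⟨C, hC⟩ := exists_norm_psi_le (m := m) (κ := κ) hv hγ z τ b
      refine memLp_two_of_exp_decay hcont (C₀ := 1) (X := c) ?_ hτr
        (C := ‖(jost m κ v γ z τ)⁻¹ * regInt m κ v a h c z‖ * C) fun x hx => ?_
      · have ht := (hlim b).norm
        rw [norm_zero] at ht
        filter_upwards [ht.eventually_lt_const one_pos] with x hx using hx.le
      · rw [hfar b x hx, show -(jost m κ v γ z τ)⁻¹ * (psi m κ v γ b x z τ * regInt m κ v a h c z) =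
          -((jost m κ v γ z τ)⁻¹ * regInt m κ v a h c z * psi m κ v γ b x z τ) by ring, norm_neg,
          norm_mul, mul_assoc _ C]
        exact mul_le_mul_of_nonneg_left (hC x (hγc.le.trans hx)) (norm_nonneg _)
  exact hsol.isResolventAt hh.memLp (hLp true hsol.continuousOn_fst)
    (hLp false hsol.continuousOn_snd) (hlim true)

theorem pairing_green (hac : a < c) (ha : 0 < a) (hsupp : ∀ x, x ∉ Icc a c → h x = 0) :
    pairing (fun x => !₂[-(jost m κ v γ z τ)⁻¹ * green m κ v γ a c h true x z τ,
      -(jost m κ v γ z τ)⁻¹ * green m κ v γ a c h false x z τ]) h =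
      resolventNum m κ v γ a c h z τ / jost m κ v γ z τ := by
  have e : ∀ g : ℝ → ℂ, (∀ x, x ∉ Icc a c → g x = 0) → ∫ x in Ioi 0, g x = ∫ x in a..c, g x := by
    intro g hg
    rw [intervalIntegral.integral_of_le hac.le, ← integral_Icc_eq_integral_Ioc,
      setIntegral_eq_integral_of_forall_compl_eq_zero hg]
    exact setIntegral_eq_integral_of_forall_compl_eq_zero fun x hx =>
      hg x fun h' => hx (ha.trans_le h'.1)
  rw [pairing_eq, e]
  · rw [resolventNum, div_eq_mul_inv, neg_mul, ← intervalIntegral.integral_mul_const,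
      ← intervalIntegral.integral_neg]
    refine intervalIntegral.integral_congr fun x _ => ?_
    simp
    ring
  · intro x hx
    rw [hsupp x hx]
    simp

/-- If `ψ = d φ` on `(0, ∞)`, the numerator is a product of two integrals of `φ` against `h`. -/
theorem resolventNum_of_proportional (hv : ∀ X, IntegrableOn v (Ioc 0 X)) (hh : IsTestFunction h)
    (ha : 0 < a) (hac : a < c) {d : ℂ}
    (hd : ∀ b, ∀ x > 0, psi m κ v γ b x z τ = d * phi m κ v b x z) :
    resolventNum m κ v γ a c h z τ = -d * ((∫ x in a..c, (starRingEnd ℂ (h x 0) *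
      phi m κ v true x z + starRingEnd ℂ (h x 1) * phi m κ v false x z)) *
      ∫ x in a..c, (phi m κ v true x z * h x 0 + phi m κ v false x z * h x 1)) := by
  have hφd := (holFamily_phi_dot (m := m) (κ := κ) hv hh).cont z trivial
  have hc : 0 < c := ha.trans hac
  rw [resolventNum, ← intervalIntegral.integral_mul_const, neg_mul,
    ← intervalIntegral.integral_const_mul]
  congr 1
  refine intervalIntegral.integral_congr fun x hx => ?_
  have hx := uIcc_subset_Ioi ha hc hx
  -- With `ψ = d φ` the integrals over `(a, x)` and `(x, c)` involve the same function, so they join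
  -- to an integral independent of `x`.
  have e1 : jostInt m κ v γ c h x z τ = d * ∫ t in x..c,
      (phi m κ v true t z * h t 0 + phi m κ v false t z * h t 1) := by
    rw [jostInt, ← intervalIntegral.integral_symm, ← intervalIntegral.integral_const_mul]
    refine intervalIntegral.integral_congr fun t ht => ?_
    have ht := uIcc_subset_Ioi hx hc ht
    simp only
    rw [hd _ t ht, hd _ t ht]
    ring
  have h1 := intervalIntegral.integral_add_adjacent_intervals (μ := volume)
        (hφd.mono (uIcc_subset_Ioi ha hx)).intervalIntegrable
        (hφd.mono (uIcc_subset_Ioi hx hc)).intervalIntegrable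
  simp only [green]
  rw [e1, hd _ x hx, hd _ x hx, ← h1, regInt]
  ring

/-- For real `z` there is a test function not orthogonal to the regular solution. -/
theorem exists_testFunction (hv : ∀ X, IntegrableOn v (Ioc 0 X)) {μ : ℝ} :
    ∃ h : ℝ → Spinor, IsTestFunction h ∧ ∀ a c, 0 < a → a < c → (∀ x, x ∉ Icc a c → h x = 0) →
      ∃ r : ℝ, r ≠ 0 ∧
      (∫ x in a..c, (starRingEnd ℂ (h x 0) * phi m κ v true x μ +
        starRingEnd ℂ (h x 1) * phi m κ v false x μ)) = r ∧
      (∫ x in a..c, (phi m κ v true x μ * h x 0 + phi m κ v false x μ * h x 1)) = r := by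
  obtain ⟨x₀, hx₀, hne⟩ := exists_phi_ne_zero (m := m) (κ := κ) hv μ
  have hconj := fun b x => conj_phi (m := m) (κ := κ) (v := v) (z := (μ : ℂ))
    (Complex.conj_ofReal μ) b x
  have hcont := fun b => (holFamily_phi (m := m) (κ := κ) hv b).cont μ trivial
  set χ : ℝ → ℝ := fun x => max 0 (x₀ / 2 - |x - x₀|) with hχ
  have hχc : Continuous χ := by fun_prop
  have hχ0 : ∀ x, x ∉ Icc (x₀ / 2) (2 * x₀) → χ x = 0 := by
    intro x hx
    refine max_eq_left ?_
    by_contra! hlt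
    have := abs_lt.1 (show |x - x₀| < x₀ / 2 by linarith)
    exact hx ⟨by linarith, by linarith⟩
  -- A tent function times the regular solution. As `phi` is real at real `μ`, both pairings, with
  -- and without conjugation, equal `∫ χ |φ|²`.
  set h : ℝ → Spinor := fun x => (χ x : ℂ) • !₂[phi m κ v true x μ, phi m κ v false x μ] with hh
  have h0 : ∀ x, h x 0 = χ x * phi m κ v true x μ := fun x => by simp [hh]
  have h1 : ∀ x, h x 1 = χ x * phi m κ v false x μ := fun x => by simp [hh]
  have hz : ∀ x, x ∉ Icc (x₀ / 2) (2 * x₀) → h x = 0 := fun x hx => by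
    simp only [hh]
    rw [hχ0 x hx, Complex.ofReal_zero, zero_smul]
  have hts : tsupport h ⊆ Icc (x₀ / 2) (2 * x₀) :=
    closure_minimal (fun x hx => by_contra fun h' => hx (hz x h')) isClosed_Icc
  have htest : IsTestFunction h := by
    refine ⟨?_, isCompact_Icc.of_isClosed_subset (isClosed_tsupport h) hts,
      hts.trans fun x hx => lt_of_lt_of_le (by positivity) hx.1⟩
    rw [continuous_iff_continuousAt]
    intro x
    rcases le_or_gt x 0 with hx | hx
    · have : h =ᶠ[𝓝 x] fun _ => 0 := by
        filter_upwards [Iio_mem_nhds (show x < x₀ / 2 by linarith)] with y hy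
        exact hz y fun h' => not_le.2 hy h'.1
      exact continuousAt_const.congr this.symm
    · have : ContinuousOn h (Ioi 0) := by
        refine ContinuousOn.smul (Complex.continuous_ofReal.comp hχc).continuousOn ?_
        refine (PiLp.continuous_toLp 2 _).comp_continuousOn (continuousOn_pi.2 fun i => ?_)
        fin_cases i
        exacts [hcont true, hcont false]
      exact this.continuousAt (Ioi_mem_nhds hx)
  refine ⟨h, htest, fun a c ha hac hsupp => ?_⟩
  have hc : 0 < c := ha.trans hac
  set ρ : ℝ → ℝ := fun x => χ x * (‖phi m κ v true x μ‖ ^ 2 + ‖phi m κ v false x μ‖ ^ 2) with hρ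
  have hρc : ContinuousOn ρ (Ioi 0) :=
    hχc.continuousOn.mul (((hcont true).norm.pow 2).add ((hcont false).norm.pow 2))
  have hρ0 : ∀ x, 0 ≤ ρ x := fun x => mul_nonneg (le_max_left _ _) (by positivity)
  have hρx : 0 < ρ x₀ := by
    refine mul_pos ?_ ?_
    · simp only [hχ, sub_self, abs_zero, sub_zero]
      exact lt_max_of_lt_right (by positivity)
    · have := norm_pos_iff.2 hne
      positivity
  have hsq : ∀ b x, phi m κ v b x μ * phi m κ v b x μ = ((‖phi m κ v b x μ‖ ^ 2 : ℝ) : ℂ) := by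
    intro b x
    have := Complex.mul_conj' (phi m κ v b x μ)
    rw [hconj] at this
    rw [this]
    push_cast
    ring
  refine ⟨∫ x in a..c, ρ x, ?_, ?_, ?_⟩
  -- The interval is arbitrary here: positivity of `ρ` near `x₀` forces a neighbourhood of `x₀` into
  -- `[a, c]`, so the integral is positive.
  · have hx0 : x₀ ∈ Ioo a c := by
      have hnh : ∀ x, ρ x ≠ 0 → x ∈ Icc a c := fun x hx => by
        by_contra h'
        apply hx
        have e0 := hsupp x h'
        have f0 := h0 x
        have f1 := h1 x
        rw [e0] at f0 f1
        have g0 : (χ x : ℂ) * phi m κ v true x μ = 0 := f0.symm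
        have g1 : (χ x : ℂ) * phi m κ v false x μ = 0 := f1.symm
        simp only [hρ]
        rcases mul_eq_zero.1 g0 with g | g
        · rw [Complex.ofReal_eq_zero.1 g, zero_mul]
        · rcases mul_eq_zero.1 g1 with g' | g'
          · rw [Complex.ofReal_eq_zero.1 g', zero_mul]
          · simp [g, g']
      have hev : ∀ᶠ x in 𝓝 x₀, x ∈ Icc a c := by
        have := (hρc.continuousAt (Ioi_mem_nhds hx₀)).eventually_ne hρx.ne'
        exact this.mono hnh
      rw [← interior_Icc]
      exact mem_interior_iff_mem_nhds.2 hev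
    refine ne_of_gt (intervalIntegral.integral_pos hac (hρc.mono fun x hx => ha.trans_le hx.1)
      (fun x _ => hρ0 x) ⟨x₀, Ioo_subset_Icc_self hx0, hρx⟩)
  · rw [← intervalIntegral.integral_ofReal]
    refine intervalIntegral.integral_congr fun x _ => ?_
    simp only [h0, h1, map_mul, Complex.conj_ofReal, hconj, mul_assoc, hsq, hρ]
    push_cast
    ring
  · rw [← intervalIntegral.integral_ofReal]
    refine intervalIntegral.integral_congr fun x _ => ?_
    simp only [h0, h1, mul_left_comm _ (χ x : ℂ), hsq, hρ]
    push_cast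
    ring

end

end RadialDirac

/-! ### Identity theorem and the branches of `√(m² - z²)` -/

/-- The identity theorem for meromorphic functions on a preconnected set. -/
theorem MeromorphicOn.eventuallyEq_of_isPreconnected {f g : ℂ → ℂ} {U : Set ℂ}
    (hf : MeromorphicOn f U) (hg : MeromorphicOn g U) (hU : IsPreconnected U) {x y : ℂ}
    (hx : x ∈ U) (hy : y ∈ U) (h : f =ᶠ[𝓝[≠] x] g) : f =ᶠ[𝓝[≠] y] g := by
  have h1 : meromorphicOrderAt (f - g) x = ⊤ := by
    rw [meromorphicOrderAt_eq_top_iff]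
    filter_upwards [h] with z hz
    simp [hz]
  have h2 : meromorphicOrderAt (f - g) y = ⊤ := by
    by_contra hne
    exact (hf.sub hg).meromorphicOrderAt_ne_top_of_isPreconnected hU hy hx hne h1
  rw [meromorphicOrderAt_eq_top_iff] at h2
  filter_upwards [h2] with z hz
  simpa [sub_eq_zero] using hz

theorem Complex.re_cpow_inv_two_pos {w : ℂ} (hw : w ∈ slitPlane) : 0 < (w ^ (2⁻¹ : ℂ)).re := by
  rw [cpow_inv_two_re]
  refine Real.sqrt_pos.2 (div_pos ?_ two_pos)
  rcases hw with h | h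
  · positivity
  · have := abs_re_lt_norm.2 h
    linarith [neg_abs_le w.re]

theorem Complex.eq_of_sq_eq_of_re_pos {a b : ℂ} (h : a ^ 2 = b ^ 2) (ha : 0 < a.re)
    (hb : 0 < b.re) : a = b := by
  rcases sq_eq_sq_iff_eq_or_eq_neg.1 h with h | h
  · exact h
  · rw [h, neg_re] at ha
    linarith

namespace RadialDirac

variable {m : ℝ}

/-- The branch of `√(m² - z²)` with positive real part on the sheet. -/
noncomputable def gapRoot (m : ℝ) (z : ℂ) : ℂ := ((m : ℂ) ^ 2 - z ^ 2) ^ (2⁻¹ : ℂ)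

/-- The branch of `√(m² - z²)` on `ℂ \ [-m, m]` that agrees with `gapRoot` on the upper
half-plane. -/
noncomputable def cutRoot (m : ℝ) (z : ℂ) : ℂ :=
  -Complex.I * z * (1 - (m : ℂ) ^ 2 / z ^ 2) ^ (2⁻¹ : ℂ)

theorem isOpen_sheet (m : ℝ) : IsOpen (sheet m) := by
  have : IsClosed {z : ℂ | z.im = 0 ∧ m ≤ |z.re|} :=
    (isClosed_eq Complex.continuous_im continuous_const).inter
      (isClosed_le continuous_const Complex.continuous_re.abs)
  exact this.isOpen_compl

theorem isOpen_cutPlane (m : ℝ) : IsOpen (cutPlane m) := by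
  have : IsClosed {z : ℂ | z.im = 0 ∧ |z.re| ≤ m} :=
    (isClosed_eq Complex.continuous_im continuous_const).inter
      (isClosed_le Complex.continuous_re.abs continuous_const)
  exact this.isOpen_compl

theorem mem_sheet_of_im_ne_zero {z : ℂ} (hz : z.im ≠ 0) : z ∈ sheet m := fun h => hz h.1

theorem mem_cutPlane_of_im_ne_zero {z : ℂ} (hz : z.im ≠ 0) : z ∈ cutPlane m := fun h => hz h.1

theorem mem_sheet_of_mem_Ioo {μ : ℝ} (hμ : μ ∈ Ioo (-m) m) : (μ : ℂ) ∈ sheet m := fun h =>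
  not_le.2 (abs_lt.2 hμ) (by simpa using h.2)

theorem isPreconnected_sheet (hm : 0 < m) : IsPreconnected (sheet m) := by
  have h0 : (0 : ℂ) ∈ sheet m := fun h => by simp at h; linarith
  have hs : StarConvex ℝ (0 : ℂ) (sheet m) := by
    rw [starConvex_zero_iff]
    rintro z hz t ht0 ht1 ⟨h1, h2⟩
    simp only [Complex.real_smul, Complex.mul_im, Complex.ofReal_re, Complex.ofReal_im, zero_mul,
      add_zero, Complex.mul_re, sub_zero, abs_mul, abs_of_nonneg ht0] at h1 h2
    rcases mul_eq_zero.1 h1 with h | h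
    · rw [h, zero_mul] at h2
      linarith
    · exact hz ⟨h, h2.trans (mul_le_of_le_one_left (abs_nonneg _) ht1)⟩
  exact (hs.isPathConnected h0).isConnected.isPreconnected

/-- The cut plane is a chain of open half-planes (above, right, below, left), each convex and
meeting the union of its predecessors. -/
theorem isPreconnected_cutPlane : IsPreconnected (cutPlane m) := by
  have c1 : IsPreconnected {z : ℂ | 0 < z.im} := (convex_halfSpace_im_gt 0).isPreconnected
  have c2 : IsPreconnected {z : ℂ | m < z.re} := (convex_halfSpace_re_gt m).isPreconnected
  have c3 : IsPreconnected {z : ℂ | z.im < 0} := (convex_halfSpace_im_lt 0).isPreconnected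
  have c4 : IsPreconnected {z : ℂ | z.re < -m} := (convex_halfSpace_re_lt (-m)).isPreconnected
  have e : cutPlane m = (({z : ℂ | 0 < z.im} ∪ {z : ℂ | m < z.re}) ∪ {z : ℂ | z.im < 0}) ∪
      {z : ℂ | z.re < -m} := by
    ext z
    simp only [cutPlane, mem_ofPred_eq, mem_union, not_and_or, not_le, lt_abs]
    constructor
    · rintro (h | h | h)
      · rcases lt_or_gt_of_ne h with h | h <;> tauto
      · tauto
      · right; linarith
    · rintro (((h | h) | h) | h)
      · exact Or.inl h.ne'
      · tauto
      · exact Or.inl h.ne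
      · right; right; linarith
  rw [e]
  have i1 : ((m + 1 : ℝ) + Complex.I : ℂ) ∈ {z : ℂ | 0 < z.im} ∩ {z : ℂ | m < z.re} := by simp
  refine IsPreconnected.union (-(m + 1 : ℝ) + Complex.I : ℂ) (Or.inl (Or.inl (by simp)))
    (by simp) ?_ c4
  refine IsPreconnected.union ((m + 1 : ℝ) - Complex.I : ℂ) (Or.inr (by simp)) (by simp) ?_ c3
  exact IsPreconnected.union _ i1.1 i1.2 c1 c2

theorem sub_sq_mem_slitPlane {z : ℂ} (hz : z ∈ sheet m) :
    (m : ℂ) ^ 2 - z ^ 2 ∈ Complex.slitPlane := by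
  rw [Complex.mem_slitPlane_iff]
  simp only [Complex.sub_re, Complex.sub_im, Complex.ofReal_re,
    Complex.ofReal_im, sq, Complex.mul_re, Complex.mul_im]
  rcases eq_or_ne z.im 0 with h | h
  · left
    have h1 : |z.re| < m := not_le.1 fun h' => hz ⟨h, h'⟩
    have := abs_lt.1 h1
    rw [h]
    nlinarith
  · rcases eq_or_ne z.re 0 with h' | h'
    · left
      rw [h']
      have : 0 < z.im * z.im := mul_self_pos.2 h
      nlinarith
    · right
      intro h0
      have : z.re * z.im = 0 := by linarith
      exact (mul_ne_zero h' h) this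

theorem differentiableOn_gapRoot : DifferentiableOn ℂ (gapRoot m) (sheet m) :=
  ((differentiableOn_const _).sub (differentiableOn_id.pow 2)).cpow_const
    fun _ hz => sub_sq_mem_slitPlane hz

theorem gapRoot_sq (z : ℂ) : gapRoot m z ^ 2 = m ^ 2 - z ^ 2 :=
  Complex.cpow_ofNat_inv_pow _ 2

theorem gapRoot_re_pos {z : ℂ} (hz : z ∈ sheet m) : 0 < (gapRoot m z).re :=
  Complex.re_cpow_inv_two_pos (sub_sq_mem_slitPlane hz)

theorem gapRoot_neg (z : ℂ) : gapRoot m (-z) = gapRoot m z := by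
  simp only [gapRoot, neg_sq]

theorem cutRoot_neg (z : ℂ) : cutRoot m (-z) = -cutRoot m z := by
  simp only [cutRoot, neg_sq]
  ring

theorem ne_zero_of_mem_cutPlane (hm : 0 < m) {z : ℂ} (hz : z ∈ cutPlane m) : z ≠ 0 := by
  rintro rfl
  exact hz ⟨rfl, by simpa using hm.le⟩

/-- If `1 - m² / z²` were real and nonpositive, then `z²` would lie in `(0, m²]`, so `z` would be in
the removed segment. This is why the factored form of `cutRoot` is holomorphic across the spectrum.
-/
theorem one_sub_div_mem_slitPlane (hm : 0 < m) {z : ℂ} (hz : z ∈ cutPlane m) :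
    1 - (m : ℂ) ^ 2 / z ^ 2 ∈ Complex.slitPlane := by
  have hz0 := ne_zero_of_mem_cutPlane hm hz
  by_contra hq
  rw [Complex.mem_slitPlane_iff, not_or, not_lt, not_not] at hq
  set q := 1 - (m : ℂ) ^ 2 / z ^ 2 with hqdef
  obtain ⟨r, hr⟩ : ∃ r : ℝ, q = r := ⟨q.re, Complex.ext rfl (by simp [hq.2])⟩
  have hr0 : r ≤ 0 := by simpa [hr] using hq.1
  have h1 : z ^ 2 * (1 - r) = m ^ 2 := by
    rw [← hr, hqdef]
    field_simp
    ring
  have hre := congrArg Complex.re h1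
  have him := congrArg Complex.im h1
  simp only [← Complex.ofReal_pow, ← Complex.ofReal_one, ← Complex.ofReal_sub, Complex.re_mul_ofReal,
    Complex.im_mul_ofReal, Complex.ofReal_re, Complex.ofReal_im] at hre him
  simp only [sq, Complex.mul_re, Complex.mul_im] at hre him
  have h2 : z.re * z.im = 0 := by
    rcases mul_eq_zero.1 him with h | h <;> linarith
  have hi : z.im = 0 := by
    rcases mul_eq_zero.1 h2 with h | h
    · exfalso
      rw [h] at hre
      nlinarith [mul_nonneg (mul_self_nonneg z.im) (by linarith : 0 ≤ 1 - r), mul_pos hm hm]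
    · exact h
  refine hz ⟨hi, ?_⟩
  rw [hi] at hre
  refine abs_le_of_sq_le_sq ?_ hm.le
  nlinarith [mul_nonneg (mul_self_nonneg z.re) (by linarith : 0 ≤ -r)]

theorem differentiableOn_cutRoot (hm : 0 < m) : DifferentiableOn ℂ (cutRoot m) (cutPlane m) := by
  refine (differentiableOn_id.const_mul _).mul (DifferentiableOn.cpow_const
    ((differentiableOn_const _).sub ((differentiableOn_const _).div (differentiableOn_id.pow 2)
    fun z hz => pow_ne_zero 2 (ne_zero_of_mem_cutPlane hm hz)))
    fun _ hz => one_sub_div_mem_slitPlane hm hz)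

theorem cutRoot_sq (hm : 0 < m) {z : ℂ} (hz : z ∈ cutPlane m) :
    cutRoot m z ^ 2 = m ^ 2 - z ^ 2 := by
  have hz0 := ne_zero_of_mem_cutPlane hm hz
  rw [cutRoot, mul_pow, mul_pow, Complex.cpow_ofNat_inv_pow _ 2, neg_sq, Complex.I_sq]
  field_simp
  ring

/-- Both functions have the same square, so it suffices that `Re cutRoot > 0`, that is, `Im p > 0`
for `p = z w`. From `p² = z² - m²` follows `Re p Im p = Re z Im z`, and `Re w > 0` gives `Re (p z̄)
> 0`; these are incompatible with `Im p ≤ 0` when `Im z > 0`. -/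
theorem cutRoot_of_im_pos (hm : 0 < m) {z : ℂ} (hz : 0 < z.im) : cutRoot m z = gapRoot m z := by
  have hzc : z ∈ cutPlane m := mem_cutPlane_of_im_ne_zero hz.ne'
  refine Complex.eq_of_sq_eq_of_re_pos ((cutRoot_sq hm hzc).trans (gapRoot_sq z).symm) ?_
    (gapRoot_re_pos (mem_sheet_of_im_ne_zero hz.ne'))
  have hw := Complex.re_cpow_inv_two_pos (one_sub_div_mem_slitPlane hm hzc)
  have hz0 := ne_zero_of_mem_cutPlane hm hzc
  have hsq := Complex.cpow_ofNat_inv_pow (1 - (m : ℂ) ^ 2 / z ^ 2) 2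
  rw [cutRoot]
  set w := (1 - (m : ℂ) ^ 2 / z ^ 2) ^ (2⁻¹ : ℂ) with hwdef
  have hp : (z * w) ^ 2 = z ^ 2 - m ^ 2 := by
    rw [mul_pow, hsq]
    field_simp
  have him := congrArg Complex.im hp
  rw [← Complex.ofReal_pow, Complex.sub_im, Complex.ofReal_im] at him
  have hzw : z * w * starRingEnd ℂ z = (Complex.normSq z : ℂ) * w := by
    rw [← Complex.mul_conj]
    ring
  have hre := congrArg Complex.re hzw
  rw [Complex.re_ofReal_mul] at hre
  have hpos : 0 < Complex.normSq z * w.re := mul_pos (Complex.normSq_pos.2 hz0) hw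
  rw [mul_assoc]
  set p := z * w with hpdef
  simp only [sq, Complex.mul_re, Complex.mul_im, Complex.conj_re, Complex.conj_im, Complex.neg_re,
    Complex.neg_im, Complex.I_re, Complex.I_im] at him hre ⊢
  have h1 : 0 < p.re * z.re + p.im * z.im := by linarith
  have h2 : p.re * p.im = z.re * z.im := by linarith
  by_contra! hle
  have hle : p.im ≤ 0 := by linarith
  rcases hle.lt_or_eq with h | h
  · have h3 : p.re * z.re * p.im = z.re * z.re * z.im := by linear_combination z.re * h2
    have h4 : 0 ≤ p.re * z.re * p.im := by
      rw [h3]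
      exact mul_nonneg (mul_self_nonneg z.re) hz.le
    have h5 : p.re * z.re ≤ 0 := by
      by_contra! h6
      nlinarith
    nlinarith
  · rw [h, mul_zero] at h2
    have h3 : z.re = 0 := by
      rcases mul_eq_zero.1 h2.symm with h' | h'
      · exact h'
      · exact absurd h' hz.ne'
    rw [h, h3] at h1
    simp at h1

/-- By symmetry under `z ↦ -z`: `gapRoot` is even while `cutRoot` is odd. This sign change is the
passage to the non-physical sheet. -/
theorem cutRoot_of_im_neg (hm : 0 < m) {z : ℂ} (hz : z.im < 0) :
    cutRoot m z = -gapRoot m z := by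
  rw [← gapRoot_neg, ← cutRoot_of_im_pos hm (by simpa using hz), cutRoot_neg, neg_neg]

end RadialDirac

/-! ### Poles of the continuations as zeros of the Jost functions -/

namespace RadialDirac

/-- The quadratic form of the resolvent for the branch `ρ` of `√(m² - z²)`. -/
noncomputable def resolventBranch (m : ℝ) (κ : ℕ) (v : ℝ → ℝ) (γ a c : ℝ) (h : ℝ → Spinor)
    (ρ : ℂ → ℂ) (z : ℂ) : ℂ :=
  resolventNum m κ v γ a c h z (ρ z) / jost m κ v γ z (ρ z)

section

variable {m : ℝ} {κ : ℕ} {v : ℝ → ℝ} {γ a c : ℝ} {z τ : ℂ} {h : ℝ → Spinor}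

theorem analyticAt_jost (hv : ∀ X, IntegrableOn v (Ioc 0 X)) (hγ : 0 < γ) {U : Set ℂ}
    (hU : IsOpen U) {ρ : ℂ → ℂ} (hρ : DifferentiableOn ℂ ρ U) (hz : z ∈ U) :
    AnalyticAt ℂ (fun z => jost m κ v γ z (ρ z)) z :=
  (differentiableOn_jost hv hγ hU hρ).analyticAt (hU.mem_nhds hz)

theorem analyticAt_resolventNum (hv : ∀ X, IntegrableOn v (Ioc 0 X)) (hγ : 0 < γ)
    (hh : IsTestFunction h) (ha : 0 < a) (hc : 0 < c) {U : Set ℂ} (hU : IsOpen U) {ρ : ℂ → ℂ}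
    (hρ : DifferentiableOn ℂ ρ U) (hz : z ∈ U) :
    AnalyticAt ℂ (fun z => resolventNum m κ v γ a c h z (ρ z)) z :=
  (differentiableOn_resolventNum hv hγ hh ha hc hU hρ).analyticAt (hU.mem_nhds hz)

theorem meromorphicOn_resolventBranch (hv : ∀ X, IntegrableOn v (Ioc 0 X)) (hγ : 0 < γ)
    (hh : IsTestFunction h) (ha : 0 < a) (hc : 0 < c) {U : Set ℂ} (hU : IsOpen U) {ρ : ℂ → ℂ}
    (hρ : DifferentiableOn ℂ ρ U) : MeromorphicOn (resolventBranch m κ v γ a c h ρ) U :=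
  fun _ hz => (analyticAt_resolventNum hv hγ hh ha hc hU hρ hz).meromorphicAt.div
    (analyticAt_jost hv hγ hU hρ hz).meromorphicAt

theorem isContinuation_resolventBranch (hm : 0 < m) (hv : ∀ X, IntegrableOn v (Ioc 0 X))
    (hγ : 0 < γ) (hv0 : ∀ᵐ x : ℝ, γ < x → v x = 0) (hκ : 1 ≤ κ) (hh : IsTestFunction h)
    (ha : 0 < a) (hac : a < c) (hγc : γ < c) (hsupp : ∀ x, x ∉ Icc a c → h x = 0) :
    IsContinuation m κ v h (resolventBranch m κ v γ a c h (gapRoot m))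
      (resolventBranch m κ v γ a c h (cutRoot m))
      (resolventBranch m κ v γ a c h fun z => -gapRoot m z) where
  physical := meromorphicOn_resolventBranch hv hγ hh ha (ha.trans hac) (isOpen_sheet m)
    differentiableOn_gapRoot
  cut := meromorphicOn_resolventBranch hv hγ hh ha (ha.trans hac) (isOpen_cutPlane m)
    (differentiableOn_cutRoot hm)
  nonphysical := meromorphicOn_resolventBranch hv hγ hh ha (ha.trans hac) (isOpen_sheet m)
    differentiableOn_gapRoot.neg
  resolvent z hz := by
    have hs := gapRoot_re_pos (m := m) (mem_sheet_of_im_ne_zero hz.ne')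
    exact ⟨_, isResolventAt_green hv hγ hv0 hκ (gapRoot_sq z) hs
      (jost_ne_zero hv hγ hv0 hκ (gapRoot_sq z) hs hz) hh ha hγc hsupp,
      (pairing_green hac ha hsupp).symm⟩
  upper z hz := by rw [resolventBranch, cutRoot_of_im_pos hm hz, resolventBranch]
  lower z hz := by rw [resolventBranch, cutRoot_of_im_neg hm hz, resolventBranch]

/-- The resolvent is unique in the upper half-plane, and the identity theorem carries the equality
first over the cut plane to the lower half-plane and then over the sheet. Pole orders of an
arbitrary continuation may therefore be computed on `resolventBranch`. -/
theorem IsContinuation.eventuallyEq (hm : 0 < m) (hv : ∀ X, IntegrableOn v (Ioc 0 X))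
    {P G N P' G' N' : ℂ → ℂ} (hc : IsContinuation m κ v h P G N)
    (hc' : IsContinuation m κ v h P' G' N') (hz : z ∈ sheet m) :
    P =ᶠ[𝓝[≠] z] P' ∧ N =ᶠ[𝓝[≠] z] N' := by
  have hpos : {z : ℂ | 0 < z.im} ∈ 𝓝 Complex.I :=
    (isOpen_lt continuous_const Complex.continuous_im).mem_nhds (by simp)
  have hneg : {z : ℂ | z.im < 0} ∈ 𝓝 (-Complex.I) :=
    (isOpen_lt Complex.continuous_im continuous_const).mem_nhds (by simp)
  have hP : ∀ w : ℂ, 0 < w.im → P w = P' w := by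
    intro w hw
    obtain ⟨u, hu, e⟩ := hc.resolvent w hw
    obtain ⟨u', hu', e'⟩ := hc'.resolvent w hw
    rw [e, e']
    refine setIntegral_congr_fun measurableSet_Ioi fun x hx => ?_
    simp only [hu.eqOn hv hw hu' hx]
  refine ⟨hc.physical.eventuallyEq_of_isPreconnected hc'.physical (isPreconnected_sheet hm)
    (x := Complex.I) (mem_sheet_of_im_ne_zero (by simp)) hz
    (eventually_nhdsWithin_of_eventually_nhds (eventually_of_mem hpos hP)), ?_⟩
  have hG : G =ᶠ[𝓝[≠] (-Complex.I)] G' :=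
    hc.cut.eventuallyEq_of_isPreconnected hc'.cut isPreconnected_cutPlane
    (x := Complex.I) (mem_cutPlane_of_im_ne_zero (by simp)) (mem_cutPlane_of_im_ne_zero (by simp))
    (eventually_nhdsWithin_of_eventually_nhds (eventually_of_mem hpos fun w hw => by
      rw [hc.upper w hw, hc'.upper w hw, hP w hw]))
  refine hc.nonphysical.eventuallyEq_of_isPreconnected hc'.nonphysical (isPreconnected_sheet hm)
    (x := -Complex.I) (mem_sheet_of_im_ne_zero (by simp)) hz ?_
  filter_upwards [hG, eventually_nhdsWithin_of_eventually_nhds hneg] with w hw hi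
  rw [← hc.lower w hi, ← hc'.lower w hi, hw]

/-- An analytic numerator can only lower the pole order below the order of the zero of the Jost
function, and does not lower it if it is nonzero at the point. -/
theorem meromorphicOrderAt_resolventBranch (hv : ∀ X, IntegrableOn v (Ioc 0 X)) (hγ : 0 < γ)
    (hh : IsTestFunction h) (ha : 0 < a) (hc : 0 < c) {U : Set ℂ} (hU : IsOpen U) {ρ : ℂ → ℂ}
    (hρ : DifferentiableOn ℂ ρ U) (hz : z ∈ U) {n : ℕ}
    (hn : analyticOrderAt (fun z => jost m κ v γ z (ρ z)) z = n) :
    ((-(n : ℤ) : ℤ) : WithTop ℤ) ≤ meromorphicOrderAt (resolventBranch m κ v γ a c h ρ) z ∧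
    (resolventNum m κ v γ a c h z (ρ z) ≠ 0 →
      meromorphicOrderAt (resolventBranch m κ v γ a c h ρ) z = ((-(n : ℤ) : ℤ) : WithTop ℤ)) := by
  have hA := analyticAt_resolventNum (m := m) (κ := κ) hv hγ hh ha hc hU hρ hz
  have hF := analyticAt_jost (m := m) (κ := κ) hv hγ hU hρ hz
  have e : meromorphicOrderAt (resolventBranch m κ v γ a c h ρ) z =
      meromorphicOrderAt (fun z => resolventNum m κ v γ a c h z (ρ z)) z + ((-(n : ℤ) : ℤ) : WithTop ℤ) := by
    have := meromorphicOrderAt_mul hA.meromorphicAt hF.meromorphicAt.inv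
    rw [meromorphicOrderAt_inv, hF.meromorphicOrderAt_eq, hn] at this
    exact this
  rw [e]
  refine ⟨?_, fun h0 => ?_⟩
  · simpa using add_le_add_left hA.meromorphicOrderAt_nonneg ((-(n : ℤ) : ℤ) : WithTop ℤ)
  · rw [hA.meromorphicOrderAt_eq, hA.analyticOrderAt_eq_zero.2 h0]
    simp

/-- At a zero of `F(τ)` the connection formula leaves `ψ = d φ`, with `d` the Wronskian divided by
`F(-τ)`, and the numerator becomes `-d r²`. The explicit constant is kept because its sign decides
the parity statement. -/
theorem exists_resolventNum_eq (hv : ∀ X, IntegrableOn v (Ioc 0 X)) (hγ : 0 < γ)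
    (hv0 : ∀ᵐ x : ℝ, γ < x → v x = 0) (hκ : 1 ≤ κ) {μ : ℝ} (hτ : τ ^ 2 = m ^ 2 - (μ : ℂ) ^ 2)
    (hτ0 : τ ≠ 0) (hF : jost m κ v γ μ τ = 0) :
    ∃ h, IsTestFunction h ∧ ∀ a c, 0 < a → a < c → (∀ x, x ∉ Icc a c → h x = 0) →
      ∃ r : ℝ, r ≠ 0 ∧ resolventNum m κ v γ a c h μ τ =
        -((μ - m) * (2 * τ * (-τ ^ 2) ^ (κ - 1)) / jost m κ v γ μ (-τ)) * r ^ 2 := by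
  obtain ⟨h, hh, H⟩ := exists_testFunction (m := m) (κ := κ) hv (μ := μ)
  refine ⟨h, hh, fun a c ha hac hs => ?_⟩
  obtain ⟨r, hr, e1, e2⟩ := H a c ha hac hs
  refine ⟨r, hr, ?_⟩
  have hF' := jost_neg_ne_zero hv hγ hv0 hκ hτ hτ0 hF
  rw [resolventNum_of_proportional hv hh ha hac
    (d := (μ - m) * (2 * τ * (-τ ^ 2) ^ (κ - 1)) / jost m κ v γ μ (-τ)) ?_, e1, e2, sq (r : ℂ)]
  intro b x hx
  have := connection hv hγ hv0 hκ hτ b hx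
  rw [hF, zero_mul, sub_zero] at this
  rw [div_mul_eq_mul_div, this]
  field_simp

end

/-- The Jost function on the physical sheet. -/
noncomputable def jostP (m : ℝ) (κ : ℕ) (v : ℝ → ℝ) (γ : ℝ) (z : ℂ) : ℂ :=
  jost m κ v γ z (gapRoot m z)

/-- The Jost function on the non-physical sheet. -/
noncomputable def jostN (m : ℝ) (κ : ℕ) (v : ℝ → ℝ) (γ : ℝ) (z : ℂ) : ℂ :=
  jost m κ v γ z (-gapRoot m z)

section

variable {m : ℝ} {κ : ℕ} {v : ℝ → ℝ} {γ : ℝ} {μ : ℝ}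

theorem gapRoot_ne_zero {z : ℂ} (hz : z ∈ sheet m) : gapRoot m z ≠ 0 := fun h => by
  have := gapRoot_re_pos hz
  simp [h] at this

theorem analyticOnNhd_jostP (hv : ∀ X, IntegrableOn v (Ioc 0 X)) (hγ : 0 < γ) :
    AnalyticOnNhd ℂ (jostP m κ v γ) (sheet m) := fun _ hz =>
  analyticAt_jost hv hγ (isOpen_sheet m) differentiableOn_gapRoot hz

theorem analyticOnNhd_jostN (hv : ∀ X, IntegrableOn v (Ioc 0 X)) (hγ : 0 < γ) :
    AnalyticOnNhd ℂ (jostN m κ v γ) (sheet m) := fun _ hz =>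
  analyticAt_jost hv hγ (isOpen_sheet m) differentiableOn_gapRoot.neg hz

theorem analyticOrderAt_jostP_ne_top (hm : 0 < m) (hv : ∀ X, IntegrableOn v (Ioc 0 X))
    (hγ : 0 < γ) (hv0 : ∀ᵐ x : ℝ, γ < x → v x = 0) (hκ : 1 ≤ κ) {z : ℂ} (hz : z ∈ sheet m) :
    analyticOrderAt (jostP m κ v γ) z ≠ ⊤ := by
  have hI : Complex.I ∈ sheet m := mem_sheet_of_im_ne_zero (by simp)
  have hA := analyticOnNhd_jostP (m := m) (κ := κ) hv hγ
  refine hA.analyticOrderAt_ne_top_of_isPreconnected (isPreconnected_sheet hm) hI hz ?_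
  rw [((hA _ hI).analyticOrderAt_eq_zero).2
    (jost_ne_zero hv hγ hv0 hκ (gapRoot_sq _) (gapRoot_re_pos hI) (by simp))]
  simp

theorem jostN_ne_zero (hv : ∀ X, IntegrableOn v (Ioc 0 X)) (hγ : 0 < γ)
    (hv0 : ∀ᵐ x : ℝ, γ < x → v x = 0) (hκ : 1 ≤ κ) {z : ℂ} (hz : z ∈ sheet m)
    (h : jostP m κ v γ z = 0) : jostN m κ v γ z ≠ 0 :=
  jost_neg_ne_zero hv hγ hv0 hκ (gapRoot_sq z) (gapRoot_ne_zero hz) h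

theorem isEigenvalue_iff (hm : 0 < m) (hv : ∀ X, IntegrableOn v (Ioc 0 X)) (hγ : 0 < γ)
    (hv0 : ∀ᵐ x : ℝ, γ < x → v x = 0) (hκ : 1 ≤ κ) :
    IsEigenvalue m κ v μ ↔ μ ∈ Ioo (-m) m ∧ jostP m κ v γ μ = 0 := by
  refine and_congr_right fun hμ => ?_
  have hμs := mem_sheet_of_mem_Ioo hμ
  have hA := analyticOnNhd_jostP (m := m) (κ := κ) hv hγ _ hμs
  obtain ⟨n, hn⟩ := ENat.ne_top_iff_exists.1
    (analyticOrderAt_jostP_ne_top (κ := κ) hm hv hγ hv0 hκ hμs)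
  constructor
  · rintro ⟨h, P, G, N, hh, hc, hP⟩
    obtain ⟨a, c, ha, hac, hγc, hs⟩ := hh.exists_Icc γ
    have hc' := isContinuation_resolventBranch hm hv hγ hv0 hκ hh ha hac hγc hs
    rw [meromorphicOrderAt_congr (hc.eventuallyEq hm hv hc' hμs).1] at hP
    by_contra h0
    have h1 : n = 0 := by
      have := hn.trans (hA.analyticOrderAt_eq_zero.2 h0)
      exact_mod_cast this
    subst h1
    have := (meromorphicOrderAt_resolventBranch hv hγ hh ha (ha.trans hac) (isOpen_sheet m)
      differentiableOn_gapRoot hμs hn.symm).1.trans_lt hP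
    simp at this
  · intro h0
    obtain ⟨h, hh, H⟩ := exists_resolventNum_eq hv hγ hv0 hκ (gapRoot_sq (m := m) μ)
      (gapRoot_ne_zero hμs) h0
    obtain ⟨a, c, ha, hac, hγc, hs⟩ := hh.exists_Icc γ
    obtain ⟨r, hr, e⟩ := H a c ha hac hs
    refine ⟨h, _, _, _, hh, isContinuation_resolventBranch hm hv hγ hv0 hκ hh ha hac hγc hs, ?_⟩
    rw [(meromorphicOrderAt_resolventBranch hv hγ hh ha (ha.trans hac) (isOpen_sheet m)
      differentiableOn_gapRoot hμs hn.symm).2]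
    · have h1 : n ≠ 0 := by
        rintro rfl
        exact (hA.analyticOrderAt_ne_zero.2 h0) hn.symm
      have : (-(n : ℤ)) < 0 := by omega
      exact_mod_cast this
    · rw [e]
      exact mul_ne_zero (neg_ne_zero.2 (div_ne_zero
        (wronskian_ne_zero (gapRoot_sq _) (gapRoot_ne_zero hμs))
        (jostN_ne_zero hv hγ hv0 hκ hμs h0))) (pow_ne_zero _ (Complex.ofReal_ne_zero.2 hr))

theorem neg_le_meromorphicOrderAt_nonphysical (hm : 0 < m)
    (hv : ∀ X, IntegrableOn v (Ioc 0 X)) (hγ : 0 < γ) (hv0 : ∀ᵐ x : ℝ, γ < x → v x = 0)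
    (hκ : 1 ≤ κ) (hμ : μ ∈ Ioo (-m) m) {n : ℕ} (hn : analyticOrderAt (jostN m κ v γ) μ = n)
    {h : ℝ → Spinor} {P G N : ℂ → ℂ} (hh : IsTestFunction h) (hc : IsContinuation m κ v h P G N) :
    ((-(n : ℤ) : ℤ) : WithTop ℤ) ≤ meromorphicOrderAt N μ := by
  have hμs := mem_sheet_of_mem_Ioo hμ
  obtain ⟨a, c, ha, hac, hγc, hs⟩ := hh.exists_Icc γ
  rw [meromorphicOrderAt_congr (hc.eventuallyEq hm hv
    (isContinuation_resolventBranch hm hv hγ hv0 hκ hh ha hac hγc hs) hμs).2]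
  exact (meromorphicOrderAt_resolventBranch hv hγ hh ha (ha.trans hac) (isOpen_sheet m)
    differentiableOn_gapRoot.neg hμs hn).1

theorem exists_meromorphicOrderAt_nonphysical (hm : 0 < m)
    (hv : ∀ X, IntegrableOn v (Ioc 0 X)) (hγ : 0 < γ) (hv0 : ∀ᵐ x : ℝ, γ < x → v x = 0)
    (hκ : 1 ≤ κ) (hμ : μ ∈ Ioo (-m) m) {n : ℕ} (hn : analyticOrderAt (jostN m κ v γ) μ = n)
    (h0 : jostN m κ v γ μ = 0) : ∃ h P G N, IsTestFunction h ∧ IsContinuation m κ v h P G N ∧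
      meromorphicOrderAt N (μ : ℂ) = ((-(n : ℤ) : ℤ) : WithTop ℤ) := by
  have hμs := mem_sheet_of_mem_Ioo hμ
  have hsq : (-gapRoot m μ) ^ 2 = m ^ 2 - (μ : ℂ) ^ 2 := by rw [neg_sq, gapRoot_sq]
  have hne : -gapRoot m μ ≠ 0 := neg_ne_zero.2 (gapRoot_ne_zero hμs)
  obtain ⟨h, hh, H⟩ := exists_resolventNum_eq hv hγ hv0 hκ hsq hne h0
  obtain ⟨a, c, ha, hac, hγc, hs⟩ := hh.exists_Icc γ
  obtain ⟨r, hr, e⟩ := H a c ha hac hs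
  refine ⟨h, _, _, _, hh, isContinuation_resolventBranch hm hv hγ hv0 hκ hh ha hac hγc hs,
    (meromorphicOrderAt_resolventBranch hv hγ hh ha (ha.trans hac) (isOpen_sheet m)
      differentiableOn_gapRoot.neg hμs hn).2 ?_⟩
  rw [Pi.neg_apply, e]
  exact mul_ne_zero (neg_ne_zero.2 (div_ne_zero (wronskian_ne_zero hsq hne)
    (jost_neg_ne_zero hv hγ hv0 hκ hsq hne h0))) (pow_ne_zero _ (Complex.ofReal_ne_zero.2 hr))

/-- The hypothesis on the order excludes identical vanishing near `μ`. On the physical sheet this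
follows from `jost_ne_zero` in the upper half-plane; on the other sheet it is supplied by an
eigenvalue, where `jostN_ne_zero` applies. -/
theorem isAntibound_iff (hm : 0 < m) (hv : ∀ X, IntegrableOn v (Ioc 0 X)) (hγ : 0 < γ)
    (hv0 : ∀ᵐ x : ℝ, γ < x → v x = 0) (hκ : 1 ≤ κ)
    (ht : analyticOrderAt (jostN m κ v γ) μ ≠ ⊤) :
    IsAntibound m κ v μ ↔ μ ∈ Ioo (-m) m ∧ jostN m κ v γ μ = 0 := by
  refine and_congr_right fun hμ => ?_
  have hA := analyticOnNhd_jostN (m := m) (κ := κ) hv hγ _ (mem_sheet_of_mem_Ioo hμ)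
  obtain ⟨n, hn⟩ := ENat.ne_top_iff_exists.1 ht
  constructor
  · rintro ⟨h, P, G, N, hh, hc, hN⟩
    by_contra h0
    have h1 : n = 0 := by
      have := hn.trans (hA.analyticOrderAt_eq_zero.2 h0)
      exact_mod_cast this
    subst h1
    have := (neg_le_meromorphicOrderAt_nonphysical hm hv hγ hv0 hκ hμ hn.symm hh hc).trans_lt hN
    simp at this
  · intro h0
    obtain ⟨h, P, G, N, hh, hc, hN⟩ :=
      exists_meromorphicOrderAt_nonphysical hm hv hγ hv0 hκ hμ hn.symm h0
    refine ⟨h, P, G, N, hh, hc, ?_⟩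
    have h1 : n ≠ 0 := by
      rintro rfl
      exact (hA.analyticOrderAt_ne_zero.2 h0) hn.symm
    have : (-(n : ℤ)) < 0 := by omega
    rw [hN]
    exact_mod_cast this

/-- The order of the zero bounds the pole order for every `h`, and the cutoff of the regular
solution attains it. -/
theorem antiboundMultiplicity_eq (hm : 0 < m) (hv : ∀ X, IntegrableOn v (Ioc 0 X)) (hγ : 0 < γ)
    (hv0 : ∀ᵐ x : ℝ, γ < x → v x = 0) (hκ : 1 ≤ κ) (hμ : μ ∈ Ioo (-m) m)
    (ht : analyticOrderAt (jostN m κ v γ) μ ≠ ⊤) (h0 : jostN m κ v γ μ = 0) :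
    antiboundMultiplicity m κ v μ = analyticOrderAt (jostN m κ v γ) μ := by
  obtain ⟨n, hn⟩ := ENat.ne_top_iff_exists.1 ht
  rw [← hn]
  refine le_antisymm (sSup_le ?_) (le_sSup ⟨n, rfl,
    exists_meromorphicOrderAt_nonphysical hm hv hγ hv0 hκ hμ hn.symm h0⟩)
  rintro _ ⟨k, rfl, h, P, G, N, hh, hc, hN⟩
  have := neg_le_meromorphicOrderAt_nonphysical hm hv hγ hv0 hκ hμ hn.symm hh hc
  rw [hN, WithTop.coe_le_coe] at this
  exact_mod_cast (by omega : k ≤ n)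

theorem IsEigenvalue.not_isAntibound (hm : 0 < m) (hv : ∀ X, IntegrableOn v (Ioc 0 X))
    (hγ : 0 < γ) (hv0 : ∀ᵐ x : ℝ, γ < x → v x = 0) (hκ : 1 ≤ κ) (h : IsEigenvalue m κ v μ) :
    ¬ IsAntibound m κ v μ := by
  obtain ⟨hμ, h0⟩ := (isEigenvalue_iff hm hv hγ hv0 hκ).1 h
  have hμs := mem_sheet_of_mem_Ioo hμ
  have h1 := jostN_ne_zero hv hγ hv0 hκ hμs h0
  have hA := analyticOnNhd_jostN (m := m) (κ := κ) hv hγ _ hμs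
  rw [isAntibound_iff hm hv hγ hv0 hκ (by simp [hA.analyticOrderAt_eq_zero.2 h1])]
  exact fun h' => h1 h'.2

end

end RadialDirac

/-! ### Zeros, residues and parity -/

/-- An analytic function which does not vanish identically has finitely many zeros in a compact
set. -/
theorem AnalyticOnNhd.finite_inter_zeros {f : ℂ → ℂ} {U K : Set ℂ} (hf : AnalyticOnNhd ℂ f U)
    (hU : IsPreconnected U) (hK : IsCompact K) (hKU : K ⊆ U) {z₀ : ℂ} (hz₀ : z₀ ∈ U)
    (h0 : f z₀ ≠ 0) : {z ∈ K | f z = 0}.Finite := by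
  by_contra hinf
  obtain ⟨x, hx, hacc⟩ := Set.Infinite.exists_accPt_of_subset_isCompact hinf hK fun z hz => hz.1
  rw [accPt_iff_frequently_nhdsNE] at hacc
  exact h0 (hf.eqOn_zero_of_preconnected_of_frequently_eq_zero hU (hKU hx)
    (hacc.mono fun z hz => hz.2) hz₀)

/-- A function with nonnegative imaginary part on the upper half-plane has at most simple poles on
the real line, and its residues are negative. -/
theorem Complex.residue_neg_of_im_nonneg {Φ : ℂ → ℂ} (hΦ : ∀ z : ℂ, 0 < z.im → 0 ≤ (Φ z).im)
    {μ B : ℝ} (hB : B ≠ 0) {n : ℕ} (hn : n ≠ 0)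
    (hlim : Tendsto (fun z : ℂ => (z - μ) ^ n * Φ z) (𝓝[≠] (μ : ℂ)) (𝓝 B)) : n = 1 ∧ B < 0 := by
  -- Approach `μ` along the ray of angle `θ` in the upper half-plane: there `t^n Φ` tends to
  -- `e^{-inθ} B`, whose imaginary part must be nonnegative.
  have key : ∀ θ ∈ Ioo 0 Real.pi, B * Real.sin (n * θ) ≤ 0 := by
    intro θ hθ
    have hsin : 0 < Real.sin θ := Real.sin_pos_of_pos_of_lt_pi hθ.1 hθ.2
    have hp : Tendsto (fun t : ℝ => (μ : ℂ) + t * exp (θ * I)) (𝓝[>] 0) (𝓝[≠] (μ : ℂ)) := by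
      refine tendsto_nhdsWithin_iff.2 ⟨?_, ?_⟩
      · have : Continuous fun t : ℝ => (μ : ℂ) + t * exp (θ * I) := by fun_prop
        have := this.tendsto 0
        rw [ofReal_zero, zero_mul, add_zero] at this
        exact this.mono_left nhdsWithin_le_nhds
      · filter_upwards [self_mem_nhdsWithin] with t ht
        have : (t : ℂ) ≠ 0 := ofReal_ne_zero.2 (ne_of_gt ht)
        simp [this, exp_ne_zero]
    have h1 := (hlim.comp hp).const_mul (exp (-(n * θ : ℝ) * I))
    have h2 : 0 ≤ (exp (-(n * θ : ℝ) * I) * B).im := by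
      refine ge_of_tendsto ((continuous_im.tendsto _).comp h1) ?_
      filter_upwards [self_mem_nhdsWithin] with t ht
      have ht : 0 < t := ht
      have hpos : 0 < ((μ : ℂ) + t * exp (θ * I)).im := by
        rw [add_im, ofReal_im, zero_add, im_ofReal_mul, exp_ofReal_mul_I_im]
        exact mul_pos ht hsin
      have e : exp (-(n * θ : ℝ) * I) * (((μ : ℂ) + t * exp (θ * I) - μ) ^ n *
          Φ (μ + t * exp (θ * I))) = ((t ^ n : ℝ) : ℂ) * Φ (μ + t * exp (θ * I)) := by
        rw [add_sub_cancel_left, mul_pow, ← exp_nat_mul]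
        have : exp (-(n * θ : ℝ) * I) * exp (n * (θ * I)) = 1 := by
          rw [← exp_add, ← exp_zero]
          congr 1
          push_cast
          ring
        push_cast
        push_cast at this
        linear_combination (t : ℂ) ^ n * Φ (μ + t * exp (θ * I)) * this
      simp only [Function.comp_apply]
      rw [e, im_ofReal_mul]
      exact mul_nonneg (pow_nonneg ht.le _) (hΦ _ hpos)
    rw [im_mul_ofReal, ← ofReal_neg, exp_ofReal_mul_I_im, Real.sin_neg] at h2
    linarith
  have hn0 : (0 : ℝ) < n := by exact_mod_cast Nat.pos_of_ne_zero hn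
  have hn1 : (1 : ℝ) ≤ n := by exact_mod_cast Nat.one_le_iff_ne_zero.2 hn
  have hpi := Real.pi_pos
  have hneg : B < 0 := by
    -- With `nθ = π / 2` the sine is `1`, which fixes the sign of `B`.
    have h := key (Real.pi / 2 / n) ⟨by positivity, by
      rw [div_lt_iff₀ hn0]
      nlinarith⟩
    rw [mul_div_cancel₀ _ hn0.ne', Real.sin_pi_div_two, mul_one] at h
    exact lt_of_le_of_ne h hB
  refine ⟨?_, hneg⟩
  by_contra hn'
  have hn2 : (2 : ℝ) ≤ n := by exact_mod_cast (by omega : 2 ≤ n)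
  -- With `nθ = 3π / 2`, an admissible angle as soon as `n ≥ 2`, the sine is `-1` and the opposite
  -- sign would follow.
  have h := key ((Real.pi / 2 + Real.pi) / n) ⟨by positivity, by
    rw [div_lt_iff₀ hn0]
    nlinarith⟩
  rw [mul_div_cancel₀ _ hn0.ne', Real.sin_add_pi, Real.sin_pi_div_two] at h
  linarith

/-- The derivatives at two consecutive simple zeros have opposite signs. -/
theorem deriv_mul_deriv_neg_of_consecutive_zeros {p : ℝ → ℝ} {a b p₁ p₂ : ℝ} (hab : a < b)
    (hc : ContinuousOn p (Ioo a b)) (h0 : ∀ x ∈ Ioo a b, p x ≠ 0) (ha : p a = 0) (hb : p b = 0)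
    (h1 : HasDerivAt p p₁ a) (h2 : HasDerivAt p p₂ b) (hp₁ : p₁ ≠ 0) (hp₂ : p₂ ≠ 0) :
    p₁ * p₂ < 0 := by
  -- One-sided difference quotients at the end points; simplicity of the zeros later makes the weak
  -- inequalities strict.
  have aux : ∀ (q : ℝ → ℝ) (q₁ q₂ : ℝ), (∀ x ∈ Ioo a b, 0 < q x) → q a = 0 → q b = 0 →
      HasDerivAt q q₁ a → HasDerivAt q q₂ b → 0 ≤ q₁ ∧ q₂ ≤ 0 := by
    intro q q₁ q₂ hq hqa hqb hd1 hd2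
    constructor
    · refine ge_of_tendsto ((hasDerivWithinAt_iff_tendsto_slope' (s := Ioi a) (by simp)).1
        hd1.hasDerivWithinAt) ?_
      filter_upwards [Ioo_mem_nhdsGT hab] with x hx
      rw [slope_def_field, hqa, sub_zero]
      exact div_nonneg (hq x hx).le (sub_nonneg.2 hx.1.le)
    · refine le_of_tendsto ((hasDerivWithinAt_iff_tendsto_slope' (s := Iio b) (by simp)).1
        hd2.hasDerivWithinAt) ?_
      filter_upwards [Ioo_mem_nhdsLT hab] with x hx
      rw [slope_def_field, hqb, sub_zero]
      exact div_nonpos_of_nonneg_of_nonpos (hq x hx).le (sub_nonpos.2 hx.2.le)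
  have hsign : (∀ x ∈ Ioo a b, 0 < p x) ∨ ∀ x ∈ Ioo a b, 0 < -p x := by
    by_contra! hcon
    obtain ⟨⟨x, hx, hpx⟩, y, hy, hpy⟩ := hcon
    obtain ⟨w, hw, hw0⟩ := isPreconnected_Ioo.intermediate_value hx hy hc
      (show (0 : ℝ) ∈ Icc (p x) (p y) from ⟨hpx, by linarith⟩)
    exact h0 w hw hw0
  rcases hsign with h | h
  · obtain ⟨i1, i2⟩ := aux p p₁ p₂ h ha hb h1 h2
    exact mul_neg_of_pos_of_neg (lt_of_le_of_ne i1 hp₁.symm) (lt_of_le_of_ne i2 hp₂)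
  · obtain ⟨i1, i2⟩ := aux (fun x => -p x) (-p₁) (-p₂) h (by simp [ha]) (by simp [hb]) h1.neg h2.neg
    exact mul_neg_of_neg_of_pos (lt_of_le_of_ne (by linarith) hp₁)
      (lt_of_le_of_ne (by linarith) hp₂.symm)

/-- The number of zeros in an interval, counted with multiplicities, of an analytic function that
is real on the interval, is even or odd according to the signs at the end points. -/
theorem Complex.neg_one_pow_sum_analyticOrderNatAt_mul_pos {a b : ℝ} (hab : a ≤ b) (S : Finset ℝ)
    {f : ℂ → ℂ} (hf : ∀ x ∈ Icc a b, AnalyticAt ℂ f (x : ℂ)) (hre : ∀ x ∈ Icc a b, (f x).im = 0)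
    (hS : ∀ x : ℝ, x ∈ S ↔ x ∈ Icc a b ∧ f x = 0)
    (ht : ∀ x ∈ S, analyticOrderAt f (x : ℂ) ≠ ⊤) (ha : f a ≠ 0) (hb : f b ≠ 0) :
    0 < (-1) ^ (∑ x ∈ S, analyticOrderNatAt f (x : ℂ)) * ((f a).re * (f b).re) := by
  induction S using Finset.induction_on generalizing f with
  | empty =>
    rw [Finset.sum_empty, pow_zero, one_mul]
    have hne : ∀ x ∈ Icc a b, (f x).re ≠ 0 := fun x hx h =>
      (Finset.notMem_empty x) ((hS x).2 ⟨hx, Complex.ext h (hre x hx)⟩)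
    have hc : ContinuousOn (fun x : ℝ => (f x).re) (Icc a b) := fun x hx =>
      (continuous_re.continuousAt.comp ((hf x hx).continuousAt.comp
        continuous_ofReal.continuousAt)).continuousWithinAt
    have hA := left_mem_Icc.2 hab
    have hB := right_mem_Icc.2 hab
    rcases lt_or_gt_of_ne (hne a hA) with h1 | h1 <;> rcases lt_or_gt_of_ne (hne b hB) with h2 | h2
    · exact mul_pos_of_neg_of_neg h1 h2
    · obtain ⟨x, hx, h⟩ := isPreconnected_Icc.intermediate_value hA hB hc
        (show (0 : ℝ) ∈ Icc _ _ from ⟨h1.le, h2.le⟩)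
      exact absurd h (hne x hx)
    · obtain ⟨x, hx, h⟩ := isPreconnected_Icc.intermediate_value hB hA hc
        (show (0 : ℝ) ∈ Icc _ _ from ⟨h2.le, h1.le⟩)
      exact absurd h (hne x hx)
    · exact mul_pos h1 h2
  | insert μ T hμT ih =>
    have hμS := (hS μ).1 (Finset.mem_insert_self μ T)
    set n := analyticOrderNatAt f (μ : ℂ) with hn
    have hnat : analyticOrderAt f (μ : ℂ) = n :=
      (Nat.cast_analyticOrderNatAt (ht μ (Finset.mem_insert_self μ T))).symm
    obtain ⟨g₀, hg₀, hg₀μ, hfg⟩ := (hf μ hμS.1).analyticOrderAt_eq_natCast.1 hnat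
    -- Divide out the zero at `μ`, filling in the removable singularity. The quotient is again
    -- analytic and real on the interval, with zeros exactly in `T` and of unchanged order.
    set g : ℂ → ℂ := Function.update (fun z => f z / (z - μ) ^ n) μ (g₀ μ) with hg
    have hgμ : g μ = g₀ μ := Function.update_self ..
    have hgne : ∀ z : ℂ, z ≠ μ → g z = f z / (z - μ) ^ n := fun z hz => Function.update_of_ne hz ..
    have hmul : ∀ z : ℂ, z ≠ μ → f z = (z - μ) ^ n * g z := fun z hz => by
      rw [hgne z hz, mul_div_cancel₀ _ (pow_ne_zero _ (sub_ne_zero.2 hz))]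
    have hgg₀ : g =ᶠ[𝓝 (μ : ℂ)] g₀ := by
      filter_upwards [hfg] with z hz
      rcases eq_or_ne z μ with rfl | hzμ
      · exact hgμ
      · rw [hgne z hzμ, hz, smul_eq_mul, mul_div_cancel_left₀ _ (pow_ne_zero _ (sub_ne_zero.2 hzμ))]
    have hloc : ∀ z : ℂ, z ≠ μ → ∀ᶠ w : ℂ in 𝓝 z, w ≠ μ := fun z hz => isOpen_ne.mem_nhds hz
    have hga : ∀ x ∈ Icc a b, AnalyticAt ℂ g (x : ℂ) := by
      intro x hx
      rcases eq_or_ne (x : ℂ) μ with h | h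
      · rw [h]
        exact hg₀.congr hgg₀.symm
      · refine ((hf x hx).div ((analyticAt_id.sub analyticAt_const).pow n)
          (pow_ne_zero _ (sub_ne_zero.2 h))).congr ?_
        filter_upwards [hloc _ h] with w hw
        exact (hgne w hw).symm
    have hgr : ∀ x ∈ Icc a b, (g x).im = 0 := by
      have h1 : ∀ x ∈ Icc a b, x ≠ μ → (g x).im = 0 := by
        intro x hx hne
        rw [hgne x (fun h => hne (ofReal_injective h)), ← ofReal_sub, ← ofReal_pow, div_ofReal_im,
          hre x hx, zero_div]
      intro x hx
      rcases eq_or_ne x μ with rfl | hne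
      · have hax : a < x := lt_of_le_of_ne hx.1 fun h => ha (h ▸ hμS.2)
        have hxb : x < b := lt_of_le_of_ne hx.2 fun h => hb (h ▸ hμS.2)
        have h2 : Tendsto (fun y : ℝ => (g y).im) (𝓝[≠] x) (𝓝 (g x).im) :=
          (continuous_im.continuousAt.comp ((hga x hx).continuousAt.comp
            continuous_ofReal.continuousAt)).tendsto.mono_left nhdsWithin_le_nhds
        refine tendsto_nhds_unique h2 (tendsto_const_nhds.congr' ?_)
        filter_upwards [self_mem_nhdsWithin, nhdsWithin_le_nhds (Icc_mem_nhds hax hxb)] with y h3 h4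
        exact (h1 y h4 h3).symm
      · exact h1 x hx hne
    have horder : ∀ x ∈ T, analyticOrderAt f (x : ℂ) = analyticOrderAt g (x : ℂ) := by
      intro x hx
      have hxμ : (x : ℂ) ≠ μ := fun h => hμT (ofReal_injective h ▸ hx)
      have hxI := ((hS x).1 (Finset.mem_insert_of_mem hx)).1
      have hp : AnalyticAt ℂ (fun z : ℂ => (z - μ) ^ n) x :=
        (analyticAt_id.sub analyticAt_const).pow n
      have e : f =ᶠ[𝓝 (x : ℂ)] (fun z : ℂ => (z - μ) ^ n) * g := by
        filter_upwards [hloc _ hxμ] with w hw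
        exact hmul w hw
      rw [analyticOrderAt_congr e, analyticOrderAt_mul hp (hga x hxI),
        hp.analyticOrderAt_eq_zero.2 (pow_ne_zero _ (sub_ne_zero.2 hxμ)), zero_add]
    have haμ : (a : ℂ) ≠ μ := fun h => ha (h ▸ hμS.2)
    have hbμ : (b : ℂ) ≠ μ := fun h => hb (h ▸ hμS.2)
    have key := ih hga hgr (fun x => ?_) (fun x hx => ?_) (fun h => ha (by rw [hmul a haμ, h, mul_zero]))
      (fun h => hb (by rw [hmul b hbμ, h, mul_zero]))
    · have e1 : ∑ x ∈ T, analyticOrderNatAt f (x : ℂ) = ∑ x ∈ T, analyticOrderNatAt g (x : ℂ) :=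
        Finset.sum_congr rfl fun x hx => by rw [analyticOrderNatAt, horder x hx, analyticOrderNatAt]
      rw [Finset.sum_insert hμT, e1, hmul a haμ, hmul b hbμ, ← ofReal_sub, ← ofReal_sub,
        ← ofReal_pow, ← ofReal_pow, re_ofReal_mul, re_ofReal_mul, pow_add]
      have h1 : a - μ < 0 := sub_neg.2 (lt_of_le_of_ne hμS.1.1 fun h => haμ (by rw [h]))
      have h2 : 0 < b - μ := sub_pos.2 (lt_of_le_of_ne hμS.1.2 fun h => hbμ (by rw [h]))
      have h3 : 0 < (μ - a) ^ n * (b - μ) ^ n := mul_pos (pow_pos (by linarith) _) (pow_pos h2 _)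
      -- Since `a < μ < b`, the removed factor changes the product of the end point signs by exactly
      -- `(-1)^n`.
      have h4 : (a - μ) ^ n = (-1) ^ n * (μ - a) ^ n := by rw [← mul_pow]; ring
      have h5 : ((-1 : ℝ) ^ n) * (-1) ^ n = 1 := by rw [← mul_pow]; simp
      calc 0 < ((μ - a) ^ n * (b - μ) ^ n) * _ := mul_pos h3 key
        _ = _ := by
          rw [h4]
          linear_combination (-(μ - a) ^ n * (b - μ) ^ n * ((-1) ^
            (∑ x ∈ T, analyticOrderNatAt g (x : ℂ)) * ((g a).re * (g b).re))) * h5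
    · rcases eq_or_ne x μ with rfl | hne
      · rw [hgμ]
        simp [hμT, hg₀μ]
      · have hneC : (x : ℂ) ≠ μ := fun h => hne (ofReal_injective h)
        have := hS x
        rw [Finset.mem_insert, hmul x hneC, mul_eq_zero] at this
        simpa [hne, pow_ne_zero n (sub_ne_zero.2 hneC)] using this
    · rw [← horder x hx]
      exact ht x (Finset.mem_insert_of_mem hx)

/-! ### Finiteness of eigenvalues and parity of anti-bound states -/

namespace RadialDirac

variable {m : ℝ} {κ : ℕ} {v : ℝ → ℝ} {γ : ℝ} {μ : ℝ}

theorem gapRoot_ofReal (hμ : μ ∈ Ioo (-m) m) :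
    0 < √(m ^ 2 - μ ^ 2) ∧ gapRoot m μ = (√(m ^ 2 - μ ^ 2) : ℝ) := by
  have h : 0 < m ^ 2 - μ ^ 2 := by nlinarith [hμ.1, hμ.2]
  refine ⟨Real.sqrt_pos.2 h, Complex.eq_of_sq_eq_of_re_pos ?_
    (gapRoot_re_pos (mem_sheet_of_mem_Ioo hμ)) (by simpa using h)⟩
  rw [gapRoot_sq, ← Complex.ofReal_pow √_, Real.sq_sqrt h.le]
  push_cast
  rfl

theorem jost_im {τ : ℂ} (hτ : starRingEnd ℂ τ = τ) : (jost m κ v γ μ τ).im = 0 := by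
  refine Complex.conj_eq_iff_im.1 ?_
  simp only [jost, map_sub, map_mul, conj_phi (Complex.conj_ofReal μ),
    conj_freeSol (Complex.conj_ofReal μ) hτ]

theorem jostP_im (hμ : μ ∈ Ioo (-m) m) : (jostP m κ v γ μ).im = 0 :=
  jost_im (by rw [(gapRoot_ofReal hμ).2, Complex.conj_ofReal])

theorem jostN_im (hμ : μ ∈ Ioo (-m) m) : (jostN m κ v γ μ).im = 0 :=
  jost_im (by rw [(gapRoot_ofReal hμ).2, map_neg, Complex.conj_ofReal])

/-- The Jost function is entire in the uniformizing variable `θ`, `z = m cos θ`. -/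
theorem differentiable_jost_cos_sin (hv : ∀ X, IntegrableOn v (Ioc 0 X)) (hγ : 0 < γ) :
    Differentiable ℂ fun θ : ℂ => jost m κ v γ (m * Complex.cos θ) (m * Complex.sin θ) := by
  have hphi : ∀ b, Differentiable ℂ (phi m κ v b γ) := fun b =>
    differentiableOn_univ.1 ((holFamily_phi hv b).diff γ hγ)
  have hg : ∀ l, Differentiable ℂ (freeBessel l γ) := fun l =>
    differentiableOn_univ.1 ((holFamily_freeBessel l).diff γ hγ)
  have hcos : Differentiable ℂ fun θ : ℂ => m * Complex.cos θ := Complex.differentiable_cos.const_mul _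
  have hsin : Differentiable ℂ fun θ : ℂ => m * Complex.sin θ := Complex.differentiable_sin.const_mul _
  exact (((hphi true).comp hcos).mul ((hcos.sub_const _).mul ((hg (κ - 1)).comp hsin))).sub
    (((hphi false).comp hcos).mul ((hg κ).comp hsin))

/-- A compactness argument in `z` fails at the branch points `±m`, which are not on the sheet. In
the variable `θ` they become the ordinary points `0` and `π`. -/
theorem finite_setOf_isEigenvalue (hm : 0 < m) (hv : ∀ X, IntegrableOn v (Ioc 0 X)) (hγ : 0 < γ)
    (hv0 : ∀ᵐ x : ℝ, γ < x → v x = 0) (hκ : 1 ≤ κ) : {μ : ℝ | IsEigenvalue m κ v μ}.Finite := by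
  have hE := (differentiable_jost_cos_sin (m := m) (κ := κ) hv hγ).differentiableOn (s := univ)
    |>.analyticOnNhd isOpen_univ
  have hK : IsCompact (((↑) : ℝ → ℂ) '' Icc 0 Real.pi) :=
    isCompact_Icc.image Complex.continuous_ofReal
  have hsq : ∀ θ : ℂ, (m * Complex.sin θ) ^ 2 = m ^ 2 - (m * Complex.cos θ) ^ 2 := fun θ => by
    linear_combination (m : ℂ) ^ 2 * Complex.sin_sq_add_cos_sq θ
  have hfin := hE.finite_inter_zeros isPreconnected_univ hK (subset_univ _)
    -- Here `z = i m sinh 1` lies in the upper half-plane and `τ = m cosh 1 > 0`, so the Jost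
    -- function is nonzero at this point.
    (z₀ := Real.pi / 2 - Complex.I) trivial (by
      have hc : Complex.cos (Real.pi / 2 - Complex.I) = Real.sinh 1 * Complex.I := by
        rw [Complex.cos_pi_div_two_sub, Complex.ofReal_sinh, ← Complex.sin_mul_I]
        simp
      have hs : Complex.sin (Real.pi / 2 - Complex.I) = Real.cosh 1 := by
        rw [Complex.sin_pi_div_two_sub, Complex.ofReal_cosh, ← Complex.cos_mul_I]
        simp
      refine jost_ne_zero hv hγ hv0 hκ (hsq _) ?_ ?_
      · rw [hs, ← Complex.ofReal_mul, Complex.ofReal_re]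
        exact mul_pos hm (Real.cosh_pos 1)
      · rw [hc, ← mul_assoc, ← Complex.ofReal_mul, Complex.im_ofReal_mul, Complex.I_im, mul_one]
        exact mul_pos hm (Real.sinh_pos_iff.2 one_pos))
  refine (hfin.image fun θ : ℂ => m * Real.cos θ.re).subset fun μ hμ => ?_
  obtain ⟨hμ, h0⟩ := (isEigenvalue_iff hm hv hγ hv0 hκ).1 hμ
  have h1 : -1 < μ / m := by
    rw [lt_div_iff₀ hm]
    linarith [hμ.1]
  have h2 : μ / m < 1 := (div_lt_one hm).2 hμ.2
  have hcos : m * Real.cos (Real.arccos (μ / m)) = μ := by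
    rw [Real.cos_arccos h1.le h2.le, mul_div_cancel₀ _ hm.ne']
  refine ⟨Real.arccos (μ / m), ⟨⟨_, ⟨Real.arccos_nonneg _, Real.arccos_le_pi _⟩, rfl⟩, ?_⟩, ?_⟩
  · have hz : (m : ℂ) * Complex.cos (Real.arccos (μ / m)) = μ := by
      rw [← Complex.ofReal_cos, ← Complex.ofReal_mul, hcos]
    have hs : gapRoot m μ = m * Complex.sin (Real.arccos (μ / m)) := by
      refine Complex.eq_of_sq_eq_of_re_pos (by rw [gapRoot_sq, hsq, hz])
        (gapRoot_re_pos (mem_sheet_of_mem_Ioo hμ)) ?_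
      rw [← Complex.ofReal_sin, ← Complex.ofReal_mul, Complex.ofReal_re]
      exact mul_pos hm (Real.sin_pos_of_pos_of_lt_pi (Real.arccos_pos.2 h2)
        (Real.arccos_lt_pi.2 h1))
    rw [hz, ← hs]
    exact h0
  · simpa using hcos

/-- Eigenvalues are simple zeros of the Jost function, and the sign of its derivative there is
determined by the sign of the Jost function on the other sheet. -/
theorem exists_hasDerivAt_jostP (hm : 0 < m) (hv : ∀ X, IntegrableOn v (Ioc 0 X)) (hγ : 0 < γ)
    (hv0 : ∀ᵐ x : ℝ, γ < x → v x = 0) (hκ : 1 ≤ κ) (hμ : μ ∈ Ioo (-m) m)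
    (h0 : jostP m κ v γ μ = 0) : ∃ d : ℝ, HasDerivAt (jostP m κ v γ) d μ ∧
      0 < (-1) ^ κ * (d * (jostN m κ v γ μ).re) := by
  have hμs := mem_sheet_of_mem_Ioo hμ
  have hA := analyticOnNhd_jostP (m := m) (κ := κ) hv hγ _ hμs
  have hN0 := jostN_ne_zero hv hγ hv0 hκ hμs h0
  obtain ⟨n, hn⟩ := ENat.ne_top_iff_exists.1
    (analyticOrderAt_jostP_ne_top (κ := κ) hm hv hγ hv0 hκ hμs)
  have hn0 : n ≠ 0 := by
    rintro rfl
    exact (hA.analyticOrderAt_ne_zero.2 h0) hn.symm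
  obtain ⟨g, hg, hgμ, hfg⟩ := hA.analyticOrderAt_eq_natCast.1 hn.symm
  -- On the real axis near `μ` the cofactor is a quotient of real numbers, and reality passes to the
  -- limit.
  have hgim : (g μ).im = 0 := by
    have h2 : Tendsto (fun y : ℝ => (g y).im) (𝓝[≠] μ) (𝓝 (g μ).im) :=
      (Complex.continuous_im.continuousAt.comp (hg.continuousAt.comp
        Complex.continuous_ofReal.continuousAt)).tendsto.mono_left nhdsWithin_le_nhds
    refine tendsto_nhds_unique h2 (tendsto_const_nhds.congr' ?_)
    filter_upwards [self_mem_nhdsWithin, nhdsWithin_le_nhds (Ioo_mem_nhds hμ.1 hμ.2),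
      nhdsWithin_le_nhds (Complex.continuous_ofReal.continuousAt.eventually hfg)] with y h3 h4 h5
    have h6 := jostP_im (κ := κ) (v := v) (γ := γ) h4
    rw [h5, smul_eq_mul, ← Complex.ofReal_sub, ← Complex.ofReal_pow, Complex.im_ofReal_mul] at h6
    exact ((mul_eq_zero.1 h6).resolve_left (pow_ne_zero _ (sub_ne_zero.2 h3))).symm
  obtain ⟨d, hd⟩ : ∃ d : ℝ, g μ = d := ⟨(g μ).re, Complex.ext rfl (by simp [hgim])⟩
  obtain ⟨q, hq⟩ : ∃ q : ℝ, jostN m κ v γ μ = q :=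
    ⟨(jostN m κ v γ μ).re, Complex.ext rfl (by simp [jostN_im hμ])⟩
  have hd0 : d ≠ 0 := fun h => hgμ (by rw [hd, h, Complex.ofReal_zero])
  have hq0 : q ≠ 0 := fun h => hN0 (by rw [hq, h, Complex.ofReal_zero])
  obtain ⟨hs, hsμ⟩ := gapRoot_ofReal hμ
  set s := √(m ^ 2 - μ ^ 2) with hsdef
  obtain ⟨h, hh, H⟩ := exists_resolventNum_eq hv hγ hv0 hκ (gapRoot_sq (m := m) μ)
    (gapRoot_ne_zero hμs) h0
  obtain ⟨a, c, ha, hac, hγc, hsupp⟩ := hh.exists_Icc γ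
  obtain ⟨r, hr, e⟩ := H a c ha hac hsupp
  have hcont := isContinuation_resolventBranch hm hv hγ hv0 hκ hh ha hac hγc hsupp
  set W : ℝ := (μ - m) * (2 * s * (-s ^ 2) ^ (κ - 1)) with hW
  have e' : resolventNum m κ v γ a c h μ (gapRoot m μ) = ((-(W / q) * r ^ 2 : ℝ) : ℂ) := by
    rw [e, show jost m κ v γ μ (-gapRoot m μ) = q from hq, hsμ, hW]
    push_cast
    rfl
  have hW0 : W ≠ 0 := mul_ne_zero (by linarith [hμ.2]) (mul_ne_zero (by positivity)
    (pow_ne_zero _ (neg_ne_zero.2 (by positivity))))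
  have hnum := (analyticAt_resolventNum (m := m) (κ := κ) hv hγ hh ha (ha.trans hac)
    (isOpen_sheet m) differentiableOn_gapRoot hμs).continuousAt.tendsto
  rw [e'] at hnum
  have hlim : Tendsto (fun z : ℂ => (z - μ) ^ n * resolventBranch m κ v γ a c h (gapRoot m) z)
      (𝓝[≠] (μ : ℂ)) (𝓝 ((-(W / q) * r ^ 2 / d : ℝ) : ℂ)) := by
    rw [Complex.ofReal_div, ← hd]
    refine ((hnum.div hg.continuousAt.tendsto hgμ).mono_left nhdsWithin_le_nhds).congr' ?_
    filter_upwards [self_mem_nhdsWithin, nhdsWithin_le_nhds hfg] with z hz hz'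
    have hz'' : (z - μ) ^ n ≠ 0 := pow_ne_zero _ (sub_ne_zero.2 hz)
    rw [resolventBranch, show jost m κ v γ z (gapRoot m z) = (z - μ) ^ n * g z from hz']
    rw [← mul_div_assoc, mul_div_mul_left _ _ hz'']
    rfl
  -- The limit `-(W / q) r² / d` is the leading coefficient of a Herglotz function at `μ`. This
  -- gives both the simplicity of the zero and the sign of `W / (q d)`.
  obtain ⟨rfl, hneg⟩ := Complex.residue_neg_of_im_nonneg (fun z hz => by
    obtain ⟨u, hu, hP⟩ := hcont.resolvent z hz
    rw [hP]
    exact hu.im_pairing_nonneg hv hz hh)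
    (div_ne_zero (mul_ne_zero (neg_ne_zero.2 (div_ne_zero hW0 hq0)) (pow_ne_zero 2 hr)) hd0) hn0 hlim
  refine ⟨d, ?_, ?_⟩
  · have h1 : HasDerivAt (fun z : ℂ => (z - μ) ^ 1 • g z) d μ := by
      have := ((hasDerivAt_id (μ : ℂ)).sub_const (μ : ℂ)).mul hg.differentiableAt.hasDerivAt
      refine (this.congr_deriv ?_).congr_of_eventuallyEq (Eventually.of_forall fun z => ?_)
      · simp [hd]
      · simp
    exact h1.congr_of_eventuallyEq hfg
  · rw [hq, Complex.ofReal_re]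
    obtain ⟨l, rfl⟩ := Nat.exists_eq_add_of_le' hκ
    -- The sign of `W` on the gap is `(-1)^κ`: the power contributes `(-1)^(κ - 1)` and `μ - m < 0`
    -- the remaining sign.
    have hW' : W = (-1) ^ (l + 1) * ((m - μ) * (2 * s * (s ^ 2) ^ l)) := by
      rw [hW, Nat.add_sub_cancel, neg_pow (s ^ 2)]
      ring
    have hp : 0 < (m - μ) * (2 * s * (s ^ 2) ^ l) := mul_pos (by linarith [hμ.2]) (by positivity)
    set p := (m - μ) * (2 * s * (s ^ 2) ^ l) with hpdef
    have h3 : -(W / q) * r ^ 2 / d * (d * q) ^ 2 = -(p * r ^ 2) * ((-1) ^ (l + 1) * (d * q)) := by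
      rw [hW']
      field_simp
    have h4 := mul_neg_of_neg_of_pos hneg (pow_pos (abs_pos.2 (mul_ne_zero hd0 hq0)) 2)
    rw [sq_abs, h3] at h4
    have h5 : 0 < p * r ^ 2 := by positivity
    by_contra! h6
    nlinarith

theorem odd_antibound_between (hm : 0 < m) (hv : ∀ X, IntegrableOn v (Ioc 0 X)) (hγ : 0 < γ)
    (hv0 : ∀ᵐ x : ℝ, γ < x → v x = 0) (hκ : 1 ≤ κ) {μ₁ μ₂ : ℝ} (h₁ : IsEigenvalue m κ v μ₁)
    (h₂ : IsEigenvalue m κ v μ₂) (h12 : μ₁ < μ₂)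
    (hno : ∀ μ ∈ Ioo μ₁ μ₂, ¬ IsEigenvalue m κ v μ) :
    ∃ S : Finset ℝ, (∀ μ : ℝ, μ ∈ S ↔ μ ∈ Ioo μ₁ μ₂ ∧ IsAntibound m κ v μ) ∧
      ∃ n : ℕ, Odd n ∧ ∑ μ ∈ S, antiboundMultiplicity m κ v μ = (n : ℕ∞) := by
  obtain ⟨i1, z1⟩ := (isEigenvalue_iff hm hv hγ hv0 hκ).1 h₁
  obtain ⟨i2, z2⟩ := (isEigenvalue_iff hm hv hγ hv0 hκ).1 h₂
  have hI : ∀ x ∈ Icc μ₁ μ₂, x ∈ Ioo (-m) m := fun x hx =>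
    ⟨i1.1.trans_le hx.1, hx.2.trans_lt i2.2⟩
  obtain ⟨d₁, hd₁, p₁⟩ := exists_hasDerivAt_jostP hm hv hγ hv0 hκ i1 z1
  obtain ⟨d₂, hd₂, p₂⟩ := exists_hasDerivAt_jostP hm hv hγ hv0 hκ i2 z2
  have hd₁0 : d₁ ≠ 0 := by
    rintro rfl
    simp at p₁
  have hd₂0 : d₂ ≠ 0 := by
    rintro rfl
    simp at p₂
  have hs1 := mem_sheet_of_mem_Ioo i1
  have hN1 := jostN_ne_zero hv hγ hv0 hκ hs1 z1
  have hN2 := jostN_ne_zero hv hγ hv0 hκ (mem_sheet_of_mem_Ioo i2) z2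
  have hAP := analyticOnNhd_jostP (m := m) (κ := κ) hv hγ
  have hAN := analyticOnNhd_jostN (m := m) (κ := κ) hv hγ
  have hdd : d₁ * d₂ < 0 := by
    refine deriv_mul_deriv_neg_of_consecutive_zeros h12 (p := fun x : ℝ => (jostP m κ v γ x).re)
      (fun x hx => ?_) (fun x hx h => ?_) (by simp [z1]) (by simp [z2]) ?_ ?_ hd₁0 hd₂0
    · exact (Complex.continuous_re.continuousAt.comp
        ((hAP _ (mem_sheet_of_mem_Ioo (hI x (Ioo_subset_Icc_self hx)))).continuousAt.comp
        Complex.continuous_ofReal.continuousAt)).continuousWithinAt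
    · have hx' := hI x (Ioo_subset_Icc_self hx)
      exact hno x hx ((isEigenvalue_iff hm hv hγ hv0 hκ).2 ⟨hx', Complex.ext h (jostP_im hx')⟩)
    · simpa using hd₁.real_of_complex
    · simpa using hd₂.real_of_complex
  -- The eigenvalue `μ₁` is what guarantees that the Jost function of the non-physical sheet is not
  -- identically zero.
  have hord : ∀ z ∈ sheet m, analyticOrderAt (jostN m κ v γ) z ≠ ⊤ := fun z hz =>
    hAN.analyticOrderAt_ne_top_of_isPreconnected (isPreconnected_sheet hm) hs1 hz
      (by simp [(hAN _ hs1).analyticOrderAt_eq_zero.2 hN1])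
  have hfin : {x : ℝ | x ∈ Icc μ₁ μ₂ ∧ jostN m κ v γ x = 0}.Finite := by
    refine Finite.of_finite_image ((hAN.finite_inter_zeros (isPreconnected_sheet hm)
      ((isCompact_Icc (a := μ₁) (b := μ₂)).image Complex.continuous_ofReal) ?_ hs1 hN1).subset ?_)
      (Complex.ofReal_injective.injOn)
    · rintro _ ⟨x, hx, rfl⟩
      exact mem_sheet_of_mem_Ioo (hI x hx)
    · rintro _ ⟨x, hx, rfl⟩
      exact ⟨⟨x, hx.1, rfl⟩, hx.2⟩
  have hS : ∀ x : ℝ, x ∈ hfin.toFinset ↔ x ∈ Icc μ₁ μ₂ ∧ jostN m κ v γ x = 0 := fun x =>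
    hfin.mem_toFinset
  refine ⟨hfin.toFinset, fun x => ?_, ∑ x ∈ hfin.toFinset,
    analyticOrderNatAt (jostN m κ v γ) (x : ℂ), ?_, ?_⟩
  · rw [hS]
    constructor
    · rintro ⟨hx, h0⟩
      refine ⟨⟨lt_of_le_of_ne hx.1 ?_, lt_of_le_of_ne hx.2 ?_⟩,
        (isAntibound_iff hm hv hγ hv0 hκ (hord _ (mem_sheet_of_mem_Ioo (hI x hx)))).2
        ⟨hI x hx, h0⟩⟩
      · rintro rfl
        exact hN1 h0
      · rintro rfl
        exact hN2 h0
    · rintro ⟨hx, h0⟩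
      have hx := Ioo_subset_Icc_self hx
      exact ⟨hx, ((isAntibound_iff hm hv hγ hv0 hκ
        (hord _ (mem_sheet_of_mem_Ioo (hI x hx)))).1 h0).2⟩
  · have hpar := Complex.neg_one_pow_sum_analyticOrderNatAt_mul_pos h12.le hfin.toFinset
      (fun x hx => hAN _ (mem_sheet_of_mem_Ioo (hI x hx))) (fun x hx => jostN_im (hI x hx)) hS
      (fun x hx => hord _ (mem_sheet_of_mem_Ioo (hI x ((hS x).1 hx).1))) hN1 hN2
    -- An even total would give `jostN` equal signs at both ends. The sign law at `μ₁` and `μ₂`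
    -- would then make `d₁ * d₂` positive, whereas consecutive simple zeros make it negative.
    by_contra hev
    rw [Nat.not_odd_iff_even] at hev
    rw [hev.neg_one_pow, one_mul] at hpar
    have h1 := mul_pos p₁ p₂
    have h2 : ((-1 : ℝ) ^ κ) * (-1) ^ κ = 1 := by rw [← mul_pow]; simp
    have h3 : (-1) ^ κ * (d₁ * (jostN m κ v γ μ₁).re) * ((-1) ^ κ * (d₂ * (jostN m κ v γ μ₂).re)) =
        (d₁ * d₂) * ((jostN m κ v γ μ₁).re * (jostN m κ v γ μ₂).re) := by
      linear_combination ((d₁ * d₂) * ((jostN m κ v γ μ₁).re * (jostN m κ v γ μ₂).re)) * h2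
    rw [h3] at h1
    exact absurd h1 (not_lt.2 (mul_neg_of_neg_of_pos hdd hpar).le)
  · rw [Nat.cast_sum]
    refine Finset.sum_congr rfl fun x hx => ?_
    obtain ⟨hx, h0⟩ := (hS x).1 hx
    have ht := hord _ (mem_sheet_of_mem_Ioo (hI x hx))
    rw [antiboundMultiplicity_eq hm hv hγ hv0 hκ (hI x hx) ht h0, Nat.cast_analyticOrderNatAt ht]

end RadialDirac

theorem theorem2p2 (m : ℝ) (hm : 0 < m) (κ : ℕ) (hκ : 1 ≤ κ) (v : ℝ → ℝ) (γ : ℝ)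
    (hv : RadialDirac.ConditionA v γ) :
    (∀ h : ℝ → RadialDirac.Spinor, RadialDirac.IsTestFunction h →
      ∃ P G N : ℂ → ℂ, RadialDirac.IsContinuation m κ v h P G N) ∧
    {μ : ℝ | RadialDirac.IsEigenvalue m κ v μ}.Finite ∧
    (∀ μ : ℝ, RadialDirac.IsEigenvalue m κ v μ → ¬ RadialDirac.IsAntibound m κ v μ) ∧
    (∀ μ₁ μ₂ : ℝ, RadialDirac.IsEigenvalue m κ v μ₁ → RadialDirac.IsEigenvalue m κ v μ₂ →
      μ₁ < μ₂ → (∀ μ ∈ Set.Ioo μ₁ μ₂, ¬ RadialDirac.IsEigenvalue m κ v μ) →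
      ∃ S : Finset ℝ, (∀ μ : ℝ, μ ∈ S ↔ μ ∈ Set.Ioo μ₁ μ₂ ∧ RadialDirac.IsAntibound m κ v μ) ∧
        ∃ n : ℕ, Odd n ∧ ∑ μ ∈ S, RadialDirac.antiboundMultiplicity m κ v μ = (n : ℕ∞)) := by
  have hvi := hv.integrableOn
  have hv0 := hv.ae_eq_zero
  refine ⟨fun h hh => ?_, RadialDirac.finite_setOf_isEigenvalue hm hvi hv.pos hv0 hκ,
    fun μ => RadialDirac.IsEigenvalue.not_isAntibound hm hvi hv.pos hv0 hκ,
    fun μ₁ μ₂ => RadialDirac.odd_antibound_between hm hvi hv.pos hv0 hκ⟩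
  obtain ⟨a, c, ha, hac, hγc, hsupp⟩ := hh.exists_Icc γ
  exact ⟨_, _, _, RadialDirac.isContinuation_resolventBranch hm hvi hv.pos hv0 hκ hh ha hac hγc hsupp⟩
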